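/- Let $M$ be a smooth, Hausdorff, second countable manifold of dimension $n$ (without boundary, not necessarily compact). Let $\mathcal M$ be the set of all smooth Riemannian metrics on $M$ and $\mathcal D$ the space of smooth compactly supported symmetric $\binom02$-tensor fields on $M$. $\mathcal M$ is a manifold with charts given by the affine pieces $g+\mathcal D$ (so that $T_g\mathcal M=\mathcal D$ for every $g$): a map from an interval or a rectangle $S$ into $\mathcal M$ (or into $\mathcal D$) is smooth if it is jointly smooth on $S\times M$ and, locally in $S$, varies only within (respectively, has its supports in) a fixed compact subset of $M$. Let $$G_g(h,k)=\int_M\operatorname{tr}(g^{-1}hg^{-1}k)\,\operatorname{vol}(g)\qquad(g\in\mathcal M,\ h,k\in\mathcal D)$$ be the canonical weak Riemannian metric on $\mathcal M$, and let $$\Gamma_g(h,k)=\tfrac12hg^{-1}k+\tfrac12kg^{-1}h+\tfrac14\operatorname{tr}(g^{-1}hg^{-1}k)\,g-\tfrac14\operatorname{tr}(g^{-1}h)\,k-\tfrac14\operatorname{tr}(g^{-1}k)\,h .$$ For a smooth curve $g(t)$ in $\mathcal M$ and a smooth $V(t)$ in $\mathcal D$ put $\nabla_{\partial_t}V=V_t-\Gamma_g(g_t,V)$,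 and let $$R_g(h,k)\ell=d\Gamma(h)(k,\ell)-d\Gamma(k)(h,\ell)-\Gamma_g(h,\Gamma_g(k,\ell))+\Gamma_g(k,\Gamma_g(h,\ell))$$ be the curvature, i.e. $R(X,Y)=\nabla_{[X,Y]}-[\nabla_X,\nabla_Y]$. A smooth curve $g:J\to\mathcal M$ on an interval $J$ is a geodesic if $\nabla_{\partial_t}g_t=0$ on $J$. A geodesic variation of a geodesic segment $c:[a,b]\to\mathcal M$ is a smooth map $\alpha:[a,b]\times(-\varepsilon,\varepsilon)\to\mathcal M$, for some $\varepsilon>0$, such that every curve $\alpha(\cdot,s)$ is a geodesic and $\alpha(\cdot,0)=c$. A smooth vector field $\xi:J\to\mathcal D$ along a geodesic $g:J\to\mathcal M$ is a Jacobi field if on every segment $[a,b]\subseteq J$, $a<b$, it has the form $\xi(t)=\frac{\partial}{\partial s}\big|_0\alpha(t,s)$ for a geodesic variation $\alpha$ of $g|_{[a,b]}$. **Theorem 4.4.** $\nabla$ is the Levi-Civita connection of $(\mathcal M,G)$; that is, $\Gamma_g$ maps $\mathcal D\times\mathcal D$ to $\mathcal D$, is symmetric, and for all $h,k,\ell\in\mathcal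 D$ the derivative of $g\mapsto G_g(k,\ell)$ in the direction $h$ exists and equals $-G_g(\Gamma_g(h,k),\ell)-G_g(k,\Gamma_g(h,\ell))$. Moreover, let $J\subseteq\mathbb R$ be an interval with more than one point and $0\in J$, and let $g:J\to\mathcal M$ be a geodesic. Then: 1. For all $k,\ell\in T_{g(0)}\mathcal M=\mathcal D$ there is a unique Jacobi field $\xi$ along $g$ with $\xi(0)=k$ and $(\nabla_{\partial_t}\xi)(0)=\ell$. 2. A smooth vector field $\xi$ along $g$ is a Jacobi field if and only if it satisfies the Jacobi equation $\nabla_{\partial_t}\nabla_{\partial_t}\xi=R(\xi,g_t)g_t$ on $J$. -/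

import Mathlib

open Set Filter Topology MeasureTheory Bundle Manifold
open scoped ContDiff

set_option maxSynthPendingDepth 3

noncomputable section

namespace MetricManifold

/-- (Not necessarily smooth or symmetric) `(0,2)`-tensor fields on `M`, a bilinear form `h` on
`T_x M` being viewed as the linear map `X ↦ h(X, ·)` from `T_x M` to its dual. -/
abbrev Tensor2 (n : ℕ) (M : Type*) [TopologicalSpace M]
    [ChartedSpace (EuclideanSpace ℝ (Fin n)) M] : Type _ :=
  (x : M) → TangentSpace (𝓡 n) x →L[ℝ] TangentSpace (𝓡 n) x →L[ℝ] ℝ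

variable {n : ℕ} {M : Type*} [TopologicalSpace M] [ChartedSpace (EuclideanSpace ℝ (Fin n)) M]

/-- A family `σ` of `(0,2)`-tensor fields with parameters in `S ⊆ P` is jointly smooth in the
parameter and the point of `M`. -/
def IsSmoothFamilyOn [IsManifold (𝓡 n) ∞ M] {P : Type*} [NormedAddCommGroup P] [NormedSpace ℝ P]
    (S : Set P) (σ : P → Tensor2 n M) : Prop :=
  ContMDiffOn (𝓘(ℝ, P).prod (𝓡 n))
    ((𝓡 n).prod 𝓘(ℝ, EuclideanSpace ℝ (Fin n) →L[ℝ] EuclideanSpace ℝ (Fin n) →L[ℝ] ℝ)) ∞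
    (fun p : P × M => TotalSpace.mk'
      (EuclideanSpace ℝ (Fin n) →L[ℝ] EuclideanSpace ℝ (Fin n) →L[ℝ] ℝ)
      (E := fun x : M => TangentSpace (𝓡 n) x →L[ℝ] TangentSpace (𝓡 n) x →L[ℝ] ℝ)
      p.2 (σ p.1 p.2)) (S ×ˢ (univ : Set M))

variable (n M) in
/-- The set `𝓜` of all smooth Riemannian metrics on `M`. -/
abbrev Met [IsManifold (𝓡 n) ∞ M] : Type _ :=
  ContMDiffRiemannianMetric (𝓡 n) ∞ (EuclideanSpace ℝ (Fin n))
    (fun x : M => TangentSpace (𝓡 n) x)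

variable (n M) in
/-- The space `𝓓` of smooth compactly supported symmetric `(0,2)`-tensor fields on `M`; it is the
tangent space of `𝓜` at every point. -/
@[ext]
structure TestTensor [IsManifold (𝓡 n) ∞ M] where
  toFun : Tensor2 n M
  symm : ∀ (x : M) (v w : TangentSpace (𝓡 n) x), toFun x v w = toFun x w v
  contMDiff : ContMDiff (𝓡 n)
    ((𝓡 n).prod 𝓘(ℝ, EuclideanSpace ℝ (Fin n) →L[ℝ] EuclideanSpace ℝ (Fin n) →L[ℝ] ℝ)) ∞
    (fun x : M => TotalSpace.mk'
      (EuclideanSpace ℝ (Fin n) →L[ℝ] EuclideanSpace ℝ (Fin n) →L[ℝ] ℝ)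
      (E := fun x : M => TangentSpace (𝓡 n) x →L[ℝ] TangentSpace (𝓡 n) x →L[ℝ] ℝ)
      x (toFun x))
  compactSupport : ∃ K : Set M, IsCompact K ∧ ∀ x ∉ K, toFun x = 0

/-- A map from `S ⊆ P` to `𝓜` is smooth: it is smooth in all variables and, locally in the
parameter, it only varies within a compact subset of `M`. -/
def IsSmoothMapOn [IsManifold (𝓡 n) ∞ M] {P : Type*} [NormedAddCommGroup P] [NormedSpace ℝ P]
    (S : Set P) (α : P → Met n M) : Prop :=
  IsSmoothFamilyOn S (fun p => (α p).inner) ∧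
    ∀ p ∈ S, ∃ U ∈ 𝓝[S] p, ∃ K : Set M, IsCompact K ∧
      ∀ q ∈ U, ∀ x ∉ K, (α q).inner x = (α p).inner x

/-- `ξ` is a smooth map from `J ⊆ ℝ` to `𝓓` (smooth in all variables, with supports locally
contained in a fixed compact set), that is, a smooth vector field along any smooth curve
`J → 𝓜`; recall that all tangent spaces of `𝓜` are equal to `𝓓`. -/
def IsVectorFieldOn [IsManifold (𝓡 n) ∞ M] (J : Set ℝ) (ξ : ℝ → TestTensor n M) : Prop :=
  IsSmoothFamilyOn J (fun t => (ξ t).toFun) ∧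
    ∀ t ∈ J, ∃ U ∈ 𝓝[J] t, ∃ K : Set M, IsCompact K ∧
      ∀ τ ∈ U, ∀ x ∉ K, (ξ τ).toFun x = 0

/-! ### Bilinear forms on a vector space -/

section Fibre

variable {V : Type*} [AddCommGroup V] [Module ℝ V] [TopologicalSpace V] [IsTopologicalAddGroup V]
  [ContinuousSMul ℝ V]

/-- The endomorphism `g⁻¹ h` of `V`, for `g, h : V → V*`. -/
def raise (g h : V →L[ℝ] V →L[ℝ] ℝ) : V →L[ℝ] V := g.inverse ∘L h

/-- The trace of an endomorphism. -/
def tr (A : V →L[ℝ] V) : ℝ := LinearMap.trace ℝ V A.toLinearMap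

/-- The Christoffel symbol
`Γ_g(h,k) = ½ h g⁻¹ k + ½ k g⁻¹ h + ¼ tr(g⁻¹ h g⁻¹ k) g - ¼ tr(g⁻¹ h) k - ¼ tr(g⁻¹ k) h`. -/
def christoffelForm (g h k : V →L[ℝ] V →L[ℝ] ℝ) : V →L[ℝ] V →L[ℝ] ℝ :=
  (1 / 2 : ℝ) • (h ∘L raise g k) + (1 / 2 : ℝ) • (k ∘L raise g h)
    + (1 / 4 * tr (raise g h ∘L raise g k)) • g
    - (1 / 4 * tr (raise g h)) • k - (1 / 4 * tr (raise g k)) • h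

/-- The derivative `dΓ(h)(k,l)` of the Christoffel symbol at `g` in the direction `h`. -/
def dChristoffelForm (g h k l : V →L[ℝ] V →L[ℝ] ℝ) : V →L[ℝ] V →L[ℝ] ℝ :=
  deriv (fun s : ℝ => christoffelForm (g + s • h) k l) 0

/-- `R(h,k)l = dΓ(h)(k,l) - dΓ(k)(h,l) - Γ(h,Γ(k,l)) + Γ(k,Γ(h,l))`. -/
def curvatureForm (g h k l : V →L[ℝ] V →L[ℝ] ℝ) : V →L[ℝ] V →L[ℝ] ℝ :=
  dChristoffelForm g h k l - dChristoffelForm g k h l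
    - christoffelForm g h (christoffelForm g k l) + christoffelForm g k (christoffelForm g h l)

end Fibre

/-! ### The canonical Riemannian metric on the manifold of metrics -/

variable (n M) in
/-- A smooth partition of unity `(ρ_i)` on `M` with `supp ρ_i` contained in the domain of the
preferred chart at `i`. -/
def chartPartition [IsManifold (𝓡 n) ∞ M] [T2Space M] [SecondCountableTopology M] :
    SmoothPartitionOfUnity M (𝓡 n) M univ :=
  haveI : LocallyCompactSpace M := Manifold.locallyCompact_of_finiteDimensional (𝓡 n)
  Classical.choose (SmoothPartitionOfUnity.exists_isSubordinate_chartAt_source (𝓡 n) M)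

theorem chartPartition_isSubordinate [IsManifold (𝓡 n) ∞ M] [T2Space M]
    [SecondCountableTopology M] :
    (chartPartition n M).IsSubordinate
      (fun i => (chartAt (EuclideanSpace ℝ (Fin n)) i).source) :=
  haveI : LocallyCompactSpace M := Manifold.locallyCompact_of_finiteDimensional (𝓡 n)
  Classical.choose_spec (SmoothPartitionOfUnity.exists_isSubordinate_chartAt_source (𝓡 n) M)

/-- The coordinate vector field `∂_a` of the preferred chart at `i`, at the point with
coordinates `y`. -/
def coordVec (i : M) (y : EuclideanSpace ℝ (Fin n)) (a : Fin n) :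
    TangentSpace (𝓡 n) ((extChartAt (𝓡 n) i).symm y) :=
  mfderiv 𝓘(ℝ, EuclideanSpace ℝ (Fin n)) (𝓡 n) (extChartAt (𝓡 n) i).symm y
    (EuclideanSpace.single a 1)

/-- The local expression `√(det g_{ab})` of the volume density, in the preferred chart at `i`. -/
def volDensity (g : Tensor2 n M) (i : M) (y : EuclideanSpace ℝ (Fin n)) : ℝ :=
  Real.sqrt (Matrix.det (Matrix.of fun a b : Fin n =>
    g ((extChartAt (𝓡 n) i).symm y) (coordVec i y a) (coordVec i y b)))

/-- The integral `∫_M f vol(g)` of a continuous function with compact support with respect to the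
volume density of `g`, computed in charts by means of a partition of unity. -/
def volIntegral [IsManifold (𝓡 n) ∞ M] [T2Space M] [SecondCountableTopology M]
    (g : Tensor2 n M) (f : M → ℝ) : ℝ :=
  ∑ᶠ i : M, ∫ y in (extChartAt (𝓡 n) i).target,
    chartPartition n M i ((extChartAt (𝓡 n) i).symm y) * f ((extChartAt (𝓡 n) i).symm y) *
      volDensity g i y

/-- The canonical weak Riemannian metric `G_g(h,k) = ∫_M tr(g⁻¹ h g⁻¹ k) vol(g)` on `𝓜`. -/
def canonicalMetric [IsManifold (𝓡 n) ∞ M] [T2Space M] [SecondCountableTopology M]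
    (g h k : Tensor2 n M) : ℝ :=
  volIntegral g (fun x => tr (raise (g x) (h x) ∘L raise (g x) (k x)))

/-! ### Connection, geodesics, curvature -/

/-- The Christoffel symbol `Γ_g(h,k)` of the canonical Riemannian metric, in the charts `g + 𝓓`
of `𝓜`; it acts pointwise on `M`. The sign convention is that `∇_h k = dk(h) - Γ(h,k)`. -/
def christoffel (g h k : Tensor2 n M) : Tensor2 n M := fun x =>
  christoffelForm (g x) (h x) (k x)

variable (n M) in
/-- `Γ : 𝓜 × 𝓓 × 𝓓 → 𝓓` is the Christoffel symbol (with the sign convention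
`∇_h k = dk(h) - Γ(h,k)`) of the Levi-Civita connection of the canonical Riemannian metric `G`,
in the charts `g + 𝓓` of `𝓜`: it is torsion-free, and `dG(h)(k,l) = G(∇_h k, l) + G(k, ∇_h l)`
for constant `k`, `l`. -/
def IsLeviCivita [IsManifold (𝓡 n) ∞ M] [T2Space M] [SecondCountableTopology M]
    (Γ : Tensor2 n M → Tensor2 n M → Tensor2 n M → Tensor2 n M) : Prop :=
  ∀ (g : Met n M) (h k l : TestTensor n M),
    (∃ m : TestTensor n M, m.toFun = Γ g.inner h.toFun k.toFun) ∧
    Γ g.inner h.toFun k.toFun = Γ g.inner k.toFun h.toFun ∧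
    HasDerivAt (fun s : ℝ => canonicalMetric (g.inner + s • h.toFun) k.toFun l.toFun)
      (-(canonicalMetric g.inner (Γ g.inner h.toFun k.toFun) l.toFun
        + canonicalMetric g.inner k.toFun (Γ g.inner h.toFun l.toFun))) 0

/-- The time derivative (within `J`) of a curve of tensor fields. -/
def velocity (J : Set ℝ) (c : ℝ → Tensor2 n M) (t : ℝ) : Tensor2 n M := fun x =>
  derivWithin (fun τ => c τ x) J t

/-- The covariant derivative `∇_{∂_t} V = V_t - Γ_g(g_t, V)` along the curve `g`. -/
def covDeriv (J : Set ℝ) (g V : ℝ → Tensor2 n M) (t : ℝ) : Tensor2 n M := fun x =>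
  velocity J V t x - christoffel (g t) (velocity J g t) (V t) x

/-- The curvature `R(X,Y) s = (∇_[X,Y] - [∇_X, ∇_Y]) s`, which is given in the charts `g + 𝓓` by
`R(h,k)l = dΓ(h)(k,l) - dΓ(k)(h,l) - Γ(h,Γ(k,l)) + Γ(k,Γ(h,l))`. -/
def curvature (g h k l : Tensor2 n M) : Tensor2 n M := fun x =>
  curvatureForm (g x) (h x) (k x) (l x)

/-- `g : J → 𝓜` is a geodesic: a smooth curve with `∇_{∂_t} g_t = 0`. -/
def IsGeodesicOn [IsManifold (𝓡 n) ∞ M] (J : Set ℝ) (g : ℝ → Met n M) : Prop :=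
  IsSmoothMapOn J g ∧
    ∀ t ∈ J, covDeriv J (fun τ => (g τ).inner) (velocity J fun τ => (g τ).inner) t = 0

/-- `α : [a,b] × (-ε,ε) → 𝓜` is a geodesic variation of the geodesic segment `g : [a,b] → 𝓜`. -/
def IsGeodesicVariation [IsManifold (𝓡 n) ∞ M] (a b ε : ℝ) (g : ℝ → Met n M)
    (α : ℝ × ℝ → Met n M) : Prop :=
  IsSmoothMapOn (Icc a b ×ˢ Ioo (-ε) ε) α ∧
    (∀ s ∈ Ioo (-ε) ε, IsGeodesicOn (Icc a b) (fun t => α (t, s))) ∧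
    ∀ t ∈ Icc a b, α (t, 0) = g t

/-- The vector field `ξ` along `g : J → 𝓜` is a Jacobi field: on every geodesic segment
`[a,b] ⊆ J` it is the infinitesimal variation `∂_s|₀ α` of a geodesic variation `α` of `g`. -/
def IsJacobiFieldOn [IsManifold (𝓡 n) ∞ M] (J : Set ℝ) (g : ℝ → Met n M)
    (ξ : ℝ → TestTensor n M) : Prop :=
  IsVectorFieldOn J ξ ∧
    ∀ a b : ℝ, a < b → Icc a b ⊆ J →
      ∃ ε > 0, ∃ α : ℝ × ℝ → Met n M, IsGeodesicVariation a b ε g α ∧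
        ∀ t ∈ Icc a b, ∀ x : M,
          HasDerivAt (fun s : ℝ => (α (t, s)).inner x) ((ξ t).toFun x) 0

/-- The Jacobi equation `∇_{∂_t} ∇_{∂_t} ξ = R(ξ, g_t) g_t` along `g : J → 𝓜`. -/
def JacobiEquationOn [IsManifold (𝓡 n) ∞ M] (J : Set ℝ) (g : ℝ → Met n M)
    (ξ : ℝ → TestTensor n M) : Prop :=
  ∀ t ∈ J,
    covDeriv J (fun τ => (g τ).inner)
        (covDeriv J (fun τ => (g τ).inner) (fun τ => (ξ τ).toFun)) t =
      curvature (g t).inner (ξ t).toFun (velocity J (fun τ => (g τ).inner) t)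
        (velocity J (fun τ => (g τ).inner) t)

end MetricManifold

end

set_option linter.unusedSectionVars false

/-! The geodesic equation involves no derivatives along M. At each point x it is an ordinary
differential equation for positive forms on the tangent space, and it has a closed solution. With P
= g⁻¹g_t it reads P' = ¼ tr(P²) 1 - ½ tr(P) P. Let w be the ratio of volume densities, so w' = ½
tr(P) w and w(0) = 1. Then tr(P²) w is constant, hence so is w'', and w = 1 + at + bt² with a = ½ tr
P₀, b = (n/16) tr P₀². Moreover wP = P₀ + ¼ tr(P₀²) t 1, and integrating gives g = exp(¼ tr(P₀²) ∫
s/w) g₀ exp((∫ 1/w) P₀). This is `geoFlow`. It is smooth in time and initial data on the open set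
`geoDomain`, where w stays positive up to time t, and `geodesic_eq_geoFlow` shows that every
geodesic has this form.

Existence of Jacobi fields: start the flow at (g₀ + sk, h₀ + sl), h₀ being the initial velocity. The
formula commutes with linear changes of frame, so it defines smooth tensor fields. As k and l have
compact support, one ε serves all points of M and a whole segment of times
(`exists_strip_geoDomain`, `exists_isGeodesicVariation`). The s-derivative at 0 is a Jacobi field
with initial value k and initial velocity l (`exists_jacobiField`).

The Jacobi equation: along a geodesic it coincides with the linearised geodesic equation
(`jacobi_iff_linGeodesic`). Variation fields satisfy the latter because partial derivatives commute
(`linGeodesic_of_family`), and its solutions are determined by their initial data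
(`linGeodesic_unique`). This gives uniqueness. It also gives the converse, since a solution must
equal the Jacobi field constructed from its own initial data.

The Levi-Civita property: metric compatibility is a pointwise identity for the density tr(G⁻¹KG⁻¹L)
√det G (`hasDerivAt_formDensity_zero`). It is integrated by differentiating under the integral over
finitely many compact pieces of charts. -/

noncomputable section

namespace MetricManifold

/-! ### Algebra and calculus of the Christoffel symbol on one vector space -/

section FibreAlgebra

variable {V W : Type*} [NormedAddCommGroup V] [NormedSpace ℝ V] [FiniteDimensional ℝ V]
  [NormedAddCommGroup W] [NormedSpace ℝ W] [FiniteDimensional ℝ W]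

variable (V) in
/-- The trace as a continuous linear functional. -/
def trCLM : (V →L[ℝ] V) →L[ℝ] ℝ :=
  LinearMap.toContinuousLinearMap (LinearMap.trace ℝ V ∘ₗ ContinuousLinearMap.coeLM ℝ)

theorem trCLM_apply (A : V →L[ℝ] V) : trCLM V A = tr A := rfl

theorem tr_add (A B : V →L[ℝ] V) : tr (A + B) = tr A + tr B := map_add (trCLM V) A B

theorem tr_sub (A B : V →L[ℝ] V) : tr (A - B) = tr A - tr B := map_sub (trCLM V) A B

theorem tr_smul (a : ℝ) (A : V →L[ℝ] V) : tr (a • A) = a * tr A := map_smul (trCLM V) a A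

theorem tr_mul_comm (A B : V →L[ℝ] V) : tr (A * B) = tr (B * A) :=
  LinearMap.trace_mul_comm ℝ (A : V →ₗ[ℝ] V) (B : V →ₗ[ℝ] V)

theorem tr_comp_comm (A B : V →L[ℝ] V) : tr (A ∘L B) = tr (B ∘L A) := tr_mul_comm A B

theorem tr_one : tr (1 : V →L[ℝ] V) = Module.finrank ℝ V := LinearMap.trace_one ℝ V

theorem tr_conj (L : V ≃L[ℝ] W) (A : W →L[ℝ] W) :
    tr ((L.symm : W →L[ℝ] V) ∘L A ∘L (L : V →L[ℝ] W)) = tr A :=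
  LinearMap.trace_conj' (A : W →ₗ[ℝ] W) L.symm.toLinearEquiv

theorem raise_add (g h k : V →L[ℝ] V →L[ℝ] ℝ) : raise g (h + k) = raise g h + raise g k :=
  ContinuousLinearMap.comp_add _ _ _

theorem raise_smul (a : ℝ) (g h : V →L[ℝ] V →L[ℝ] ℝ) : raise g (a • h) = a • raise g h :=
  ContinuousLinearMap.comp_smul _ _ _

theorem comp_raise {g : V →L[ℝ] V →L[ℝ] ℝ} (hg : g.IsInvertible) (h : V →L[ℝ] V →L[ℝ] ℝ) :
    g ∘L raise g h = h := by
  rw [raise, ← ContinuousLinearMap.comp_assoc, hg.self_comp_inverse, ContinuousLinearMap.id_comp]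

theorem raise_comp {g : V →L[ℝ] V →L[ℝ] ℝ} (hg : g.IsInvertible) (A : V →L[ℝ] V) :
    raise g (g ∘L A) = A := by
  rw [raise, ← ContinuousLinearMap.comp_assoc, hg.inverse_comp_self, ContinuousLinearMap.id_comp]

/-- Writing forms as g composed with endomorphisms cancels every g⁻¹, so computations with Γ become
computations in the algebra of endomorphisms. -/
theorem christoffelForm_comp {g : V →L[ℝ] V →L[ℝ] ℝ} (hg : g.IsInvertible) (A B : V →L[ℝ] V) :
    christoffelForm g (g ∘L A) (g ∘L B) =
      g ∘L ((1 / 2 : ℝ) • (A * B) + (1 / 2 : ℝ) • (B * A) + (1 / 4 * tr (A * B)) • 1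
        - (1 / 4 * tr A) • B - (1 / 4 * tr B) • A) := by
  simp only [christoffelForm, raise_comp hg, ContinuousLinearMap.comp_add,
    ContinuousLinearMap.comp_sub, ContinuousLinearMap.comp_smul, ContinuousLinearMap.comp_assoc]
  rfl

theorem raise_christoffelForm {g : V →L[ℝ] V →L[ℝ] ℝ} (hg : g.IsInvertible)
    (h k : V →L[ℝ] V →L[ℝ] ℝ) :
    raise g (christoffelForm g h k) =
      (1 / 2 : ℝ) • (raise g h * raise g k) + (1 / 2 : ℝ) • (raise g k * raise g h)
        + (1 / 4 * tr (raise g h * raise g k)) • 1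
        - (1 / 4 * tr (raise g h)) • raise g k - (1 / 4 * tr (raise g k)) • raise g h := by
  conv_lhs => rw [← comp_raise hg h, ← comp_raise hg k, christoffelForm_comp hg, raise_comp hg]

theorem christoffelForm_comm (g h k : V →L[ℝ] V →L[ℝ] ℝ) :
    christoffelForm g h k = christoffelForm g k h := by
  rw [christoffelForm, christoffelForm, tr_comp_comm]
  abel

theorem christoffelForm_add_left (g h₁ h₂ k : V →L[ℝ] V →L[ℝ] ℝ) :
    christoffelForm g (h₁ + h₂) k = christoffelForm g h₁ k + christoffelForm g h₂ k := by
  simp only [christoffelForm, raise_add, ContinuousLinearMap.add_comp, ContinuousLinearMap.comp_add,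
    tr_add, mul_add, add_smul, smul_add]
  abel

theorem christoffelForm_smul_left (a : ℝ) (g h k : V →L[ℝ] V →L[ℝ] ℝ) :
    christoffelForm g (a • h) k = a • christoffelForm g h k := by
  simp only [christoffelForm, raise_smul, ContinuousLinearMap.smul_comp,
    ContinuousLinearMap.comp_smul, tr_smul]
  module

theorem christoffelForm_add_right (g h k₁ k₂ : V →L[ℝ] V →L[ℝ] ℝ) :
    christoffelForm g h (k₁ + k₂) = christoffelForm g h k₁ + christoffelForm g h k₂ := by
  rw [christoffelForm_comm, christoffelForm_add_left, christoffelForm_comm g k₁,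
    christoffelForm_comm g k₂]

theorem christoffelForm_smul_right (a : ℝ) (g h k : V →L[ℝ] V →L[ℝ] ℝ) :
    christoffelForm g h (a • k) = a • christoffelForm g h k := by
  rw [christoffelForm_comm, christoffelForm_smul_left, christoffelForm_comm]

theorem christoffelForm_zero_left (g k : V →L[ℝ] V →L[ℝ] ℝ) : christoffelForm g 0 k = 0 := by
  simpa using christoffelForm_smul_left 0 g 0 k

theorem christoffelForm_sub_right (g h k₁ k₂ : V →L[ℝ] V →L[ℝ] ℝ) :
    christoffelForm g h (k₁ - k₂) = christoffelForm g h k₁ - christoffelForm g h k₂ := by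
  rw [sub_eq_add_neg, christoffelForm_add_right, ← neg_one_smul ℝ k₂, christoffelForm_smul_right,
    neg_one_smul, ← sub_eq_add_neg]

/-- A bilinear form is positive definite (symmetry is not required). -/
def IsPos (g : V →L[ℝ] V →L[ℝ] ℝ) : Prop := ∀ v : V, v ≠ 0 → 0 < g v v

theorem IsPos.isInvertible {g : V →L[ℝ] V →L[ℝ] ℝ} (hg : IsPos g) : g.IsInvertible := by
  have hinj : Function.Injective (g : V →ₗ[ℝ] V →L[ℝ] ℝ) := by
    rw [← LinearMap.ker_eq_bot, LinearMap.ker_eq_bot']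
    intro v hv
    by_contra h
    have := hg v h
    rw [show g v = 0 from hv] at this
    simp at this
  have hdim : Module.finrank ℝ V = Module.finrank ℝ (V →L[ℝ] ℝ) := by
    rw [← (LinearMap.toContinuousLinearMap : (V →ₗ[ℝ] ℝ) ≃ₗ[ℝ] (V →L[ℝ] ℝ)).finrank_eq]
    exact (Subspace.dual_finrank_eq (K := ℝ) (V := V)).symm
  exact ⟨(LinearEquiv.ofInjectiveOfFinrankEq _ hinj hdim).toContinuousLinearEquiv, rfl⟩

/-- Positivity need only be tested on the compact unit sphere, where it persists under small
perturbations. Because symmetry is not demanded, the set is open in the space of all forms and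
ordinary calculus applies on it. -/
theorem isOpen_isPos : IsOpen {g : V →L[ℝ] V →L[ℝ] ℝ | IsPos g} := by
  rw [isOpen_iff_mem_nhds]
  intro g hg
  have hK : IsCompact (Metric.sphere (0 : V) 1) := isCompact_sphere 0 1
  have hcont : Continuous fun p : (V →L[ℝ] V →L[ℝ] ℝ) × V => p.1 p.2 p.2 := by fun_prop
  have h1 : ∀ᶠ g' in 𝓝 g, ∀ v ∈ Metric.sphere (0 : V) 1, 0 < g' v v := by
    refine hK.eventually_forall_of_forall_eventually fun v hv => ?_
    have hv0 : v ≠ 0 := by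
      rintro rfl
      simp at hv
    exact hcont.continuousAt.eventually (lt_mem_nhds (a := (0 : ℝ)) (b := g v v) (hg v hv0))
  filter_upwards [h1] with g' hg' v hv
  have hn : 0 < ‖v‖ := norm_pos_iff.2 hv
  have := hg' (‖v‖⁻¹ • v) (by simp [norm_smul, hn.ne'])
  simp only [map_smul, smul_apply, smul_eq_mul] at this
  have h2 : 0 < ‖v‖⁻¹ := inv_pos.2 hn
  exact pos_of_mul_pos_right (pos_of_mul_pos_right this h2.le) h2.le

theorem contDiffAt_raise {g : V →L[ℝ] V →L[ℝ] ℝ} (hg : g.IsInvertible) (h : V →L[ℝ] V →L[ℝ] ℝ)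
    {m : WithTop ℕ∞} :
    ContDiffAt ℝ m (fun p : (V →L[ℝ] V →L[ℝ] ℝ) × (V →L[ℝ] V →L[ℝ] ℝ) => raise p.1 p.2)
      (g, h) := by
  have : CompleteSpace V := FiniteDimensional.complete ℝ V
  exact ((hg.contDiffAt_map_inverse).comp (g, h) contDiffAt_fst).clm_comp contDiffAt_snd

theorem contDiffAt_christoffelForm {g : V →L[ℝ] V →L[ℝ] ℝ} (hg : g.IsInvertible)
    (h k : V →L[ℝ] V →L[ℝ] ℝ) {m : WithTop ℕ∞} :
    ContDiffAt ℝ m (fun p : (V →L[ℝ] V →L[ℝ] ℝ) × (V →L[ℝ] V →L[ℝ] ℝ) × (V →L[ℝ] V →L[ℝ] ℝ) =>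
      christoffelForm p.1 p.2.1 p.2.2) (g, h, k) := by
  have hr1 : ContDiffAt ℝ m (fun p : (V →L[ℝ] V →L[ℝ] ℝ) × (V →L[ℝ] V →L[ℝ] ℝ) ×
      (V →L[ℝ] V →L[ℝ] ℝ) => raise p.1 p.2.1) (g, h, k) :=
    (contDiffAt_raise hg h).comp (g, h, k)
      (contDiff_fst.prodMk (contDiff_fst.comp contDiff_snd)).contDiffAt
  have hr2 : ContDiffAt ℝ m (fun p : (V →L[ℝ] V →L[ℝ] ℝ) × (V →L[ℝ] V →L[ℝ] ℝ) ×
      (V →L[ℝ] V →L[ℝ] ℝ) => raise p.1 p.2.2) (g, h, k) :=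
    (contDiffAt_raise hg k).comp (g, h, k)
      (contDiff_fst.prodMk (contDiff_snd.comp contDiff_snd)).contDiffAt
  have h1 : ContDiffAt ℝ m (fun p : (V →L[ℝ] V →L[ℝ] ℝ) × (V →L[ℝ] V →L[ℝ] ℝ) ×
      (V →L[ℝ] V →L[ℝ] ℝ) => p.2.1) (g, h, k) := (contDiff_fst.comp contDiff_snd).contDiffAt
  have h2 : ContDiffAt ℝ m (fun p : (V →L[ℝ] V →L[ℝ] ℝ) × (V →L[ℝ] V →L[ℝ] ℝ) ×
      (V →L[ℝ] V →L[ℝ] ℝ) => p.2.2) (g, h, k) := (contDiff_snd.comp contDiff_snd).contDiffAt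
  have htr : ∀ {A : (V →L[ℝ] V →L[ℝ] ℝ) × (V →L[ℝ] V →L[ℝ] ℝ) × (V →L[ℝ] V →L[ℝ] ℝ) → V →L[ℝ] V},
      ContDiffAt ℝ m A (g, h, k) → ContDiffAt ℝ m (fun p => 1 / 4 * tr (A p)) (g, h, k) :=
    fun hA => contDiffAt_const.mul ((trCLM V).contDiff.contDiffAt.comp (g, h, k) hA)
  exact (((((h1.clm_comp hr2).const_smul _).add ((h2.clm_comp hr1).const_smul _)).add
    ((htr (hr1.clm_comp hr2)).smul contDiffAt_fst)).sub ((htr hr1).smul h2)).sub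
    ((htr hr2).smul h1)

/-- Chain rule, with the total derivative split along the three arguments. The first partial
derivative is `dChristoffelForm` by definition; in the other two arguments Γ is linear. -/
theorem hasDerivWithinAt_christoffelForm {c u w : ℝ → V →L[ℝ] V →L[ℝ] ℝ}
    {c' u' w' : V →L[ℝ] V →L[ℝ] ℝ} {J : Set ℝ} {t : ℝ} (hg : (c t).IsInvertible)
    (hc : HasDerivWithinAt c c' J t) (hu : HasDerivWithinAt u u' J t)
    (hw : HasDerivWithinAt w w' J t) :
    HasDerivWithinAt (fun τ => christoffelForm (c τ) (u τ) (w τ))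
      (dChristoffelForm (c t) c' (u t) (w t) + christoffelForm (c t) u' (w t)
        + christoffelForm (c t) (u t) w') J t := by
  set Φ := fun p : (V →L[ℝ] V →L[ℝ] ℝ) × (V →L[ℝ] V →L[ℝ] ℝ) × (V →L[ℝ] V →L[ℝ] ℝ) =>
      christoffelForm p.1 p.2.1 p.2.2 with hΦ
  have hD : HasFDerivAt Φ (fderiv ℝ Φ (c t, u t, w t)) (c t, u t, w t) :=
    ((contDiffAt_christoffelForm hg (u t) (w t) (m := 1)).differentiableAt one_ne_zero).hasFDerivAt
  set D := fderiv ℝ Φ (c t, u t, w t)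
  have h1 : D (c', 0, 0) = dChristoffelForm (c t) c' (u t) (w t) := by
    have hl : HasDerivAt (fun s : ℝ => (c t + s • c', u t, w t)) (c', 0, 0) 0 := by
      refine HasDerivAt.prodMk ?_ (hasDerivAt_const _ _)
      simpa using ((hasDerivAt_id (0 : ℝ)).smul_const c').const_add (c t)
    have hD' : HasFDerivAt Φ D (c t + (0 : ℝ) • c', u t, w t) := by simpa using hD
    exact (HasFDerivAt.comp_hasDerivAt (f := fun s : ℝ => (c t + s • c', u t, w t)) 0 hD'
      hl).deriv.symm
  have h2 : D (0, u', 0) = christoffelForm (c t) u' (w t) := by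
    have hl : HasDerivAt (fun s : ℝ => (c t, u t + s • u', w t)) (0, u', 0) 0 := by
      refine HasDerivAt.prodMk (hasDerivAt_const _ _) (HasDerivAt.prodMk ?_ (hasDerivAt_const _ _))
      simpa using ((hasDerivAt_id (0 : ℝ)).smul_const u').const_add (u t)
    have hD' : HasFDerivAt Φ D (c t, u t + (0 : ℝ) • u', w t) := by simpa using hD
    refine (HasFDerivAt.comp_hasDerivAt (f := fun s : ℝ => (c t, u t + s • u', w t)) 0 hD'
      hl).unique ?_
    have : Φ ∘ (fun s : ℝ => (c t, u t + s • u', w t)) = fun s : ℝ =>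
        christoffelForm (c t) (u t) (w t) + s • christoffelForm (c t) u' (w t) := by
      ext1 s
      simp [hΦ, christoffelForm_add_left, christoffelForm_smul_left]
    rw [this]
    simpa using ((hasDerivAt_id (0 : ℝ)).smul_const (christoffelForm (c t) u' (w t))).const_add
      (christoffelForm (c t) (u t) (w t))
  have h3 : D (0, 0, w') = christoffelForm (c t) (u t) w' := by
    have hl : HasDerivAt (fun s : ℝ => (c t, u t, w t + s • w')) (0, 0, w') 0 := by
      refine HasDerivAt.prodMk (hasDerivAt_const _ _) (HasDerivAt.prodMk (hasDerivAt_const _ _) ?_)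
      simpa using ((hasDerivAt_id (0 : ℝ)).smul_const w').const_add (w t)
    have hD' : HasFDerivAt Φ D (c t, u t, w t + (0 : ℝ) • w') := by simpa using hD
    refine (HasFDerivAt.comp_hasDerivAt (f := fun s : ℝ => (c t, u t, w t + s • w')) 0 hD'
      hl).unique ?_
    have : Φ ∘ (fun s : ℝ => (c t, u t, w t + s • w')) = fun s : ℝ =>
        christoffelForm (c t) (u t) (w t) + s • christoffelForm (c t) (u t) w' := by
      ext1 s
      simp [hΦ, christoffelForm_add_right, christoffelForm_smul_right]
    rw [this]
    simpa using ((hasDerivAt_id (0 : ℝ)).smul_const (christoffelForm (c t) (u t) w')).const_add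
      (christoffelForm (c t) (u t) (w t))
  have hsum : (c', u', w') = (c', 0, 0) + (0, u', 0) + (0, 0, w') := by simp
  have := HasFDerivAt.comp_hasDerivWithinAt (f := fun τ => (c τ, u τ, w τ)) t hD
    (hc.prodMk (hu.prodMk hw))
  rw [hsum, map_add, map_add, h1, h2, h3] at this
  exact this

/-- The right hand side of the linearised geodesic equation. -/
def linGeodesic (g u ξ η : V →L[ℝ] V →L[ℝ] ℝ) : V →L[ℝ] V →L[ℝ] ℝ :=
  dChristoffelForm g ξ u u + (2 : ℝ) • christoffelForm g u η

/-- Along a geodesic, the Jacobi equation is the linearised geodesic equation. -/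
theorem jacobi_iff_linGeodesic {c u ξ η : ℝ → V →L[ℝ] V →L[ℝ] ℝ} {ζ : V →L[ℝ] V →L[ℝ] ℝ}
    {J : Set ℝ} {t : ℝ} (hJ : UniqueDiffWithinAt ℝ J t) (hg : (c t).IsInvertible)
    (hc : HasDerivWithinAt c (u t) J t)
    (hu : HasDerivWithinAt u (christoffelForm (c t) (u t) (u t)) J t)
    (hξ : HasDerivWithinAt ξ (η t) J t) (hη : HasDerivWithinAt η ζ J t) :
    derivWithin (fun τ => η τ - christoffelForm (c τ) (u τ) (ξ τ)) J t
        - christoffelForm (c t) (u t) (η t - christoffelForm (c t) (u t) (ξ t))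
      = curvatureForm (c t) (ξ t) (u t) (u t) ↔
    ζ = linGeodesic (c t) (u t) (ξ t) (η t) := by
  rw [(hη.fun_sub (hasDerivWithinAt_christoffelForm hg hc hu hξ)).derivWithin hJ, curvatureForm,
    linGeodesic, christoffelForm_sub_right, christoffelForm_comm (c t) (ξ t) (u t),
    christoffelForm_comm (c t) (ξ t) (christoffelForm (c t) (u t) (u t))]
  -- Differentiating Γ(u, ξ) yields dΓ(u)(u, ξ), while the curvature contains dΓ(u)(ξ, u). Once
  -- these are identified, everything cancels except the terms of the linearised equation.
  have : dChristoffelForm (c t) (u t) (ξ t) (u t) = dChristoffelForm (c t) (u t) (u t) (ξ t) := by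
    simp only [dChristoffelForm, christoffelForm_comm _ (ξ t) (u t)]
  rw [this, two_smul, ← sub_eq_zero, ← sub_eq_zero (a := ζ)]
  refine iff_of_eq (congrArg (· = 0) ?_)
  abel

end FibreAlgebra

/-! ### Smooth dependence of the integrals ∫ sʲ / (1 + ps + qs²) on all parameters -/

section ParametricIntegral

/-- The integrals `∫₀¹ uʲ (1 + u z₁ + u² z₂)^{-(m+1)} du`. -/
def ratInt (j m : ℕ) (z : ℝ × ℝ) : ℝ :=
  ∫ u in (0 : ℝ)..1, u ^ j * ((1 + u * z.1 + u ^ 2 * z.2) ^ (m + 1))⁻¹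

/-- The set of `z` such that `1 + u z₁ + u² z₂` is positive for `u ∈ [0, 1]`. -/
def quadPos : Set (ℝ × ℝ) := {z | ∀ u ∈ Icc (0 : ℝ) 1, 0 < 1 + u * z.1 + u ^ 2 * z.2}

theorem isOpen_quadPos : IsOpen quadPos := by
  rw [isOpen_iff_mem_nhds]
  intro z hz
  have hcont : Continuous fun p : (ℝ × ℝ) × ℝ => 1 + p.2 * p.1.1 + p.2 ^ 2 * p.1.2 := by fun_prop
  have h : ∀ᶠ z' in 𝓝 z, ∀ u ∈ Icc (0 : ℝ) 1, 0 < 1 + u * z'.1 + u ^ 2 * z'.2 :=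
    isCompact_Icc.eventually_forall_of_forall_eventually fun u hu =>
      hcont.continuousAt.eventually
        (lt_mem_nhds (a := (0 : ℝ)) (b := 1 + u * z.1 + u ^ 2 * z.2) (hz u hu))
  exact h

/-- Differentiation under the integral stays in the family: the exponent of the denominator rises by
one, the power of u by one or two. -/
theorem hasFDerivAt_ratInt (j m : ℕ) {z : ℝ × ℝ} (hz : z ∈ quadPos) :
    HasFDerivAt (ratInt j m)
      ((-((m : ℝ) + 1) * ratInt (j + 1) (m + 1) z) • ContinuousLinearMap.fst ℝ ℝ ℝ
        + (-((m : ℝ) + 1) * ratInt (j + 2) (m + 1) z) • ContinuousLinearMap.snd ℝ ℝ ℝ) z := by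
  -- On a closed ball inside `quadPos`, times [0, 1], the differentiated integrand is continuous on
  -- a compact set; its bound there is the dominating constant.
  obtain ⟨r, hr, hrU⟩ := Metric.nhds_basis_closedBall.mem_iff.1 (isOpen_quadPos.mem_nhds hz)
  have hcont : ∀ i l : ℕ, ContinuousOn
      (fun w : (ℝ × ℝ) × ℝ => w.2 ^ i * ((1 + w.2 * w.1.1 + w.2 ^ 2 * w.1.2) ^ (l + 1))⁻¹)
      (Metric.closedBall z r ×ˢ Icc (0 : ℝ) 1) := by
    intro i l
    refine ContinuousOn.mul (by fun_prop) (ContinuousOn.inv₀ (by fun_prop) fun w hw => ?_)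
    exact (pow_pos (hrU hw.1 w.2 hw.2) _).ne'
  have hcont' : ∀ i l : ℕ, ∀ w ∈ Metric.closedBall z r, ContinuousOn
      (fun u : ℝ => u ^ i * ((1 + u * w.1 + u ^ 2 * w.2) ^ (l + 1))⁻¹) (Icc 0 1) := by
    intro i l w hw
    exact (hcont i l).comp (f := fun u : ℝ => (w, u)) (by fun_prop) fun u hu => ⟨hw, hu⟩
  have hint : ∀ i l : ℕ, IntervalIntegrable
      (fun u : ℝ => u ^ i * ((1 + u * z.1 + u ^ 2 * z.2) ^ (l + 1))⁻¹) volume 0 1 := fun i l =>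
    ContinuousOn.intervalIntegrable_of_Icc zero_le_one
      (hcont' i l z (Metric.mem_closedBall_self hr.le))
  set F' : ℝ × ℝ → ℝ → (ℝ × ℝ →L[ℝ] ℝ) := fun w u =>
    (-((m : ℝ) + 1) * (u ^ (j + 1) * ((1 + u * w.1 + u ^ 2 * w.2) ^ (m + 1 + 1))⁻¹)) •
        ContinuousLinearMap.fst ℝ ℝ ℝ
      + (-((m : ℝ) + 1) * (u ^ (j + 2) * ((1 + u * w.1 + u ^ 2 * w.2) ^ (m + 1 + 1))⁻¹)) •
        ContinuousLinearMap.snd ℝ ℝ ℝ with hF'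
  have hF'cont : ContinuousOn (fun w : (ℝ × ℝ) × ℝ => F' w.1 w.2)
      (Metric.closedBall z r ×ˢ Icc (0 : ℝ) 1) :=
    ((continuousOn_const.mul (hcont _ _)).smul continuousOn_const).add
      ((continuousOn_const.mul (hcont _ _)).smul continuousOn_const)
  obtain ⟨C, hC⟩ := ((isCompact_closedBall z r).prod isCompact_Icc).exists_bound_of_continuousOn
    hF'cont
  have hsub : uIoc (0 : ℝ) 1 ⊆ Icc 0 1 := by
    rw [uIoc_of_le zero_le_one]
    exact Ioc_subset_Icc_self
  have key := intervalIntegral.hasFDerivAt_integral_of_dominated_of_fderiv_le (μ := volume)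
    (a := 0) (b := 1) (x₀ := z) (𝕜 := ℝ) (bound := fun _ => C)
    (F := fun w u => u ^ j * ((1 + u * w.1 + u ^ 2 * w.2) ^ (m + 1))⁻¹) (F' := F')
    (Metric.closedBall_mem_nhds z hr) ?_ (hint j m) ?_ ?_ intervalIntegrable_const ?_
  · convert! key using 1
    simp only [hF']
    rw [intervalIntegral.integral_add, intervalIntegral.integral_smul_const,
      intervalIntegral.integral_smul_const, intervalIntegral.integral_const_mul,
      intervalIntegral.integral_const_mul]
    · rfl
    all_goals
      exact ContinuousOn.intervalIntegrable_of_Icc zero_le_one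
        ((continuousOn_const.mul (hcont' _ _ z (Metric.mem_closedBall_self hr.le))).smul
          continuousOn_const)
  · filter_upwards [Metric.closedBall_mem_nhds z hr] with w hw
    exact ((hcont' j m w hw).mono hsub).aestronglyMeasurable measurableSet_uIoc
  · refine ContinuousOn.aestronglyMeasurable ?_ measurableSet_uIoc
    exact hF'cont.comp (f := fun u : ℝ => (z, u)) (by fun_prop)
      fun u hu => ⟨Metric.mem_closedBall_self hr.le, hsub hu⟩
  · exact ae_of_all _ fun u hu w hw => hC (w, u) ⟨hw, hsub hu⟩
  · refine ae_of_all _ fun u hu w hw => ?_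
    have hpos := hrU hw u (hsub hu)
    have hlin : HasFDerivAt (fun w : ℝ × ℝ => 1 + u * w.1 + u ^ 2 * w.2)
        (u • ContinuousLinearMap.fst ℝ ℝ ℝ + u ^ 2 • ContinuousLinearMap.snd ℝ ℝ ℝ) w := by
      refine HasFDerivAt.add (HasFDerivAt.const_add 1 ?_) ?_
      · exact hasFDerivAt_fst.const_mul u
      · exact hasFDerivAt_snd.const_mul _
    have hpow : HasDerivAt (fun x : ℝ => u ^ j * (x ^ (m + 1))⁻¹)
        (u ^ j * (-(((m + 1 : ℕ) : ℝ) * (1 + u * w.1 + u ^ 2 * w.2) ^ m) /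
          ((1 + u * w.1 + u ^ 2 * w.2) ^ (m + 1)) ^ 2)) (1 + u * w.1 + u ^ 2 * w.2) := by
      refine HasDerivAt.const_mul _ (HasDerivAt.fun_inv ?_ (pow_pos hpos _).ne')
      simpa using hasDerivAt_pow (m + 1) (1 + u * w.1 + u ^ 2 * w.2)
    refine (hpow.comp_hasFDerivAt w hlin).congr_fderiv ?_
    simp only [hF', smul_add, smul_smul]
    congr 2
    · push_cast
      field_simp
      ring
    · push_cast
      field_simp
      ring

/-- Induction on the order of differentiability, for all j and m at once because the derivative
involves other members of the family. -/
theorem contDiffOn_ratInt (j m : ℕ) : ContDiffOn ℝ ∞ (ratInt j m) quadPos := by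
  rw [contDiffOn_infty]
  intro k
  induction k generalizing j m with
  | zero =>
    exact contDiffOn_zero.2 fun z hz =>
      (hasFDerivAt_ratInt j m hz).continuousAt.continuousWithinAt
  | succ k ih =>
    refine (contDiffOn_succ_iff_hasFDerivWithinAt_of_uniqueDiffOn
      isOpen_quadPos.uniqueDiffOn).2 ⟨fun h => absurd h (WithTop.natCast_ne_top k), _, ?_, fun z hz =>
        (hasFDerivAt_ratInt j m hz).hasFDerivWithinAt⟩
    exact ((contDiffOn_const.mul (ih _ _)).smul contDiffOn_const).add
      ((contDiffOn_const.mul (ih _ _)).smul contDiffOn_const)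

/-- The primitive `∫₀ᵗ sʲ / (1 + p s + q s²) ds`. -/
def ratPrim (j : ℕ) (p q t : ℝ) : ℝ := t ^ (j + 1) * ratInt j 0 (t * p, t ^ 2 * q)

/-- Substitution s = tu. The definition over the fixed interval [0, 1] gives joint smoothness in (p,
q, t); this form gives the t-derivative by the fundamental theorem of calculus. -/
theorem ratPrim_eq_integral (j : ℕ) (p q t : ℝ) :
    ratPrim j p q t = ∫ s in (0 : ℝ)..t, s ^ j * (1 + p * s + q * s ^ 2)⁻¹ := by
  have h := intervalIntegral.smul_integral_comp_mul_left (a := 0) (b := 1)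
    (fun s : ℝ => s ^ j * (1 + p * s + q * s ^ 2)⁻¹) t
  rw [mul_zero, mul_one] at h
  rw [← h, ratPrim, ratInt, pow_succ', mul_assoc, smul_eq_mul,
    ← intervalIntegral.integral_const_mul (t ^ j)]
  congr 1
  refine intervalIntegral.integral_congr fun u _ => ?_
  simp only [zero_add, pow_one]
  ring_nf

theorem ratPrim_zero (j : ℕ) (p q : ℝ) : ratPrim j p q 0 = 0 := by simp [ratPrim]

/-- The rescaling u = s / t matches [0, 1] with the segment from 0 to t, whatever the sign of t; t =
0 is treated apart. -/
theorem quad_pos_of_mem {p q t s : ℝ} (h : (t * p, t ^ 2 * q) ∈ quadPos) (hs : s ∈ uIcc 0 t) :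
    0 < 1 + p * s + q * s ^ 2 := by
  rcases eq_or_ne t 0 with rfl | ht
  · simp only [uIcc_self, mem_singleton_iff] at hs
    simp [hs]
  · have hu : s / t ∈ Icc (0 : ℝ) 1 := by
      rcases lt_or_gt_of_ne ht with ht' | ht'
      · rw [uIcc_of_ge ht'.le] at hs
        exact ⟨div_nonneg_of_nonpos hs.2 ht'.le, (div_le_one_of_neg ht').2 hs.1⟩
      · rw [uIcc_of_le ht'.le] at hs
        exact ⟨div_nonneg hs.1 ht'.le, (div_le_one ht').2 hs.2⟩
    convert! h _ hu using 1
    field_simp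

theorem mem_quadPos_of_pos {p q t : ℝ} (h : ∀ s ∈ uIcc 0 t, 0 < 1 + p * s + q * s ^ 2) :
    (t * p, t ^ 2 * q) ∈ quadPos := by
  intro u hu
  have hm : u * t ∈ uIcc 0 t := by
    rcases le_total 0 t with ht | ht
    · rw [uIcc_of_le ht]
      exact ⟨mul_nonneg hu.1 ht, mul_le_of_le_one_left ht hu.2⟩
    · rw [uIcc_of_ge ht]
      exact ⟨by nlinarith [hu.1, hu.2], mul_nonpos_of_nonneg_of_nonpos hu.1 ht⟩
  convert! h _ hm using 1
  ring

theorem hasDerivAt_ratPrim (j : ℕ) {p q t : ℝ} (h : (t * p, t ^ 2 * q) ∈ quadPos) :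
    HasDerivAt (ratPrim j p q) (t ^ j * (1 + p * t + q * t ^ 2)⁻¹) t := by
  have heq : ratPrim j p q = fun t => ∫ s in (0 : ℝ)..t, s ^ j * (1 + p * s + q * s ^ 2)⁻¹ :=
    funext fun t => ratPrim_eq_integral j p q t
  rw [heq]
  refine intervalIntegral.integral_hasDerivAt_right ?_ ?_ ?_
  · refine ContinuousOn.intervalIntegrable fun s hs => ContinuousAt.continuousWithinAt ?_
    exact ContinuousAt.mul (by fun_prop)
      (ContinuousAt.inv₀ (by fun_prop) (quad_pos_of_mem h hs).ne')
  · refine (Measurable.stronglyMeasurable ?_).stronglyMeasurableAtFilter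
    fun_prop
  · exact ContinuousAt.mul (by fun_prop)
      (ContinuousAt.inv₀ (by fun_prop) (quad_pos_of_mem h right_mem_uIcc).ne')

end ParametricIntegral

/-! ### The explicit geodesics in one fibre -/

section FibreGeodesics

variable {V W : Type*} [NormedAddCommGroup V] [NormedSpace ℝ V] [FiniteDimensional ℝ V]
  [NormedAddCommGroup W] [NormedSpace ℝ W] [FiniteDimensional ℝ W]

theorem exp_mul_exp_neg (A : V →L[ℝ] V) : NormedSpace.exp A * NormedSpace.exp (-A) = 1 := by
  have : CompleteSpace V := FiniteDimensional.complete ℝ V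
  let : NormedAlgebra ℚ (V →L[ℝ] V) := NormedAlgebra.restrictScalars ℚ ℝ _
  rw [← NormedSpace.exp_add_of_commute (Commute.neg_right (Commute.refl A)), add_neg_cancel,
    NormedSpace.exp_zero]

theorem hasDerivAt_exp_smul_comp {a : ℝ → ℝ} {a' t : ℝ} (ha : HasDerivAt a a' t)
    (A : V →L[ℝ] V) :
    HasDerivAt (fun τ => NormedSpace.exp (a τ • A)) (a' • (NormedSpace.exp (a t • A) * A)) t := by
  have : CompleteSpace V := FiniteDimensional.complete ℝ V
  exact (hasDerivAt_exp_smul_const A (a t)).scomp t ha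

theorem contDiff_exp_clm {m : WithTop ℕ∞} :
    ContDiff ℝ m (NormedSpace.exp : (V →L[ℝ] V) → (V →L[ℝ] V)) := by
  have : CompleteSpace V := FiniteDimensional.complete ℝ V
  exact contDiff_iff_contDiffAt.2 fun A => (NormedSpace.exp_analytic (𝕂 := ℝ) A).contDiffAt

/-- The linear coefficient of the volume density along a geodesic. -/
def volLin (g h : V →L[ℝ] V →L[ℝ] ℝ) : ℝ := 1 / 2 * tr (raise g h)

/-- The quadratic coefficient of the volume density along a geodesic. -/
def volQuad (g h : V →L[ℝ] V →L[ℝ] ℝ) : ℝ :=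
  (Module.finrank ℝ V : ℝ) / 16 * tr (raise g h * raise g h)

/-- The geodesic in the space of metrics with initial value `g` and initial velocity `h`. -/
def geoFlow (t : ℝ) (g h : V →L[ℝ] V →L[ℝ] ℝ) : V →L[ℝ] V →L[ℝ] ℝ :=
  Real.exp (1 / 4 * tr (raise g h * raise g h) * ratPrim 1 (volLin g h) (volQuad g h) t) •
    (g ∘L NormedSpace.exp (ratPrim 0 (volLin g h) (volQuad g h) t • raise g h))

/-- The logarithmic derivative of `geoFlow`. -/
def geoLog (t : ℝ) (g h : V →L[ℝ] V →L[ℝ] ℝ) : V →L[ℝ] V :=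
  (1 + volLin g h * t + volQuad g h * t ^ 2)⁻¹ •
    (raise g h + (1 / 4 * tr (raise g h * raise g h) * t) • 1)

variable (V) in
/-- The triples `(t, g, h)` such that the geodesic with initial value `g` and initial velocity `h`
exists up to time `t`. -/
def geoDomain : Set (ℝ × (V →L[ℝ] V →L[ℝ] ℝ) × (V →L[ℝ] V →L[ℝ] ℝ)) :=
  {x | IsPos x.2.1 ∧
    (x.1 * volLin x.2.1 x.2.2, x.1 ^ 2 * volQuad x.2.1 x.2.2) ∈ quadPos}

theorem contDiffAt_volLin {g : V →L[ℝ] V →L[ℝ] ℝ} (hg : g.IsInvertible)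
    (h : V →L[ℝ] V →L[ℝ] ℝ) {m : WithTop ℕ∞} :
    ContDiffAt ℝ m (fun p : (V →L[ℝ] V →L[ℝ] ℝ) × (V →L[ℝ] V →L[ℝ] ℝ) => volLin p.1 p.2)
      (g, h) :=
  contDiffAt_const.mul ((trCLM V).contDiff.contDiffAt.comp (g, h) (contDiffAt_raise hg h))

theorem contDiffAt_tr_raise_sq {g : V →L[ℝ] V →L[ℝ] ℝ} (hg : g.IsInvertible)
    (h : V →L[ℝ] V →L[ℝ] ℝ) {m : WithTop ℕ∞} :
    ContDiffAt ℝ m (fun p : (V →L[ℝ] V →L[ℝ] ℝ) × (V →L[ℝ] V →L[ℝ] ℝ) =>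
      tr (raise p.1 p.2 * raise p.1 p.2)) (g, h) :=
  (trCLM V).contDiff.contDiffAt.comp (g, h)
    ((contDiffAt_raise hg h).clm_comp (contDiffAt_raise hg h))

theorem contDiffAt_volQuad {g : V →L[ℝ] V →L[ℝ] ℝ} (hg : g.IsInvertible)
    (h : V →L[ℝ] V →L[ℝ] ℝ) {m : WithTop ℕ∞} :
    ContDiffAt ℝ m (fun p : (V →L[ℝ] V →L[ℝ] ℝ) × (V →L[ℝ] V →L[ℝ] ℝ) => volQuad p.1 p.2)
      (g, h) :=
  contDiffAt_const.mul (contDiffAt_tr_raise_sq hg h)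

theorem contDiffAt_quadArgs {x : ℝ × (V →L[ℝ] V →L[ℝ] ℝ) × (V →L[ℝ] V →L[ℝ] ℝ)}
    (hg : x.2.1.IsInvertible) {m : WithTop ℕ∞} :
    ContDiffAt ℝ m (fun x : ℝ × (V →L[ℝ] V →L[ℝ] ℝ) × (V →L[ℝ] V →L[ℝ] ℝ) =>
      (x.1 * volLin x.2.1 x.2.2, x.1 ^ 2 * volQuad x.2.1 x.2.2)) x :=
  (contDiffAt_fst.mul ((contDiffAt_volLin hg x.2.2).comp x contDiffAt_snd)).prodMk
    ((contDiffAt_fst.pow 2).mul ((contDiffAt_volQuad hg x.2.2).comp x contDiffAt_snd))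

theorem isOpen_geoDomain : IsOpen (geoDomain V) := by
  have ho : IsOpen {x : ℝ × (V →L[ℝ] V →L[ℝ] ℝ) × (V →L[ℝ] V →L[ℝ] ℝ) | IsPos x.2.1} :=
    isOpen_isPos.preimage (continuous_fst.comp continuous_snd)
  refine ContinuousOn.isOpen_inter_preimage (f := fun x : ℝ × (V →L[ℝ] V →L[ℝ] ℝ) ×
    (V →L[ℝ] V →L[ℝ] ℝ) => (x.1 * volLin x.2.1 x.2.2, x.1 ^ 2 * volQuad x.2.1 x.2.2)) ?_ ho
      isOpen_quadPos
  exact fun x hx => (contDiffAt_quadArgs (m := 0) (IsPos.isInvertible hx)).continuousAt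
    |>.continuousWithinAt

theorem contDiffOn_geoFlow :
    ContDiffOn ℝ ∞ (fun x : ℝ × (V →L[ℝ] V →L[ℝ] ℝ) × (V →L[ℝ] V →L[ℝ] ℝ) =>
      geoFlow x.1 x.2.1 x.2.2) (geoDomain V) := by
  intro x hx
  refine ContDiffAt.contDiffWithinAt ?_
  have hg : x.2.1.IsInvertible := hx.1.isInvertible
  have hprim : ∀ j, ContDiffAt ℝ ∞ (fun x : ℝ × (V →L[ℝ] V →L[ℝ] ℝ) × (V →L[ℝ] V →L[ℝ] ℝ) =>
      ratPrim j (volLin x.2.1 x.2.2) (volQuad x.2.1 x.2.2) x.1) x := fun j =>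
    (contDiffAt_fst.pow (j + 1)).mul
      (((contDiffOn_ratInt j 0).contDiffAt (isOpen_quadPos.mem_nhds hx.2)).comp x
        (contDiffAt_quadArgs hg))
  have hr : ContDiffAt ℝ ∞ (fun x : ℝ × (V →L[ℝ] V →L[ℝ] ℝ) × (V →L[ℝ] V →L[ℝ] ℝ) =>
      raise x.2.1 x.2.2) x := (contDiffAt_raise hg x.2.2).comp x contDiffAt_snd
  have htr : ContDiffAt ℝ ∞ (fun x : ℝ × (V →L[ℝ] V →L[ℝ] ℝ) × (V →L[ℝ] V →L[ℝ] ℝ) =>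
      tr (raise x.2.1 x.2.2 * raise x.2.1 x.2.2)) x :=
    ContDiffAt.comp (g := fun p : (V →L[ℝ] V →L[ℝ] ℝ) × (V →L[ℝ] V →L[ℝ] ℝ) =>
      tr (raise p.1 p.2 * raise p.1 p.2)) x (contDiffAt_tr_raise_sq hg x.2.2) contDiffAt_snd
  exact (((contDiffAt_const.mul htr).mul (hprim 1)).exp).smul
    ((contDiffAt_fst.comp x contDiffAt_snd).clm_comp
      (contDiff_exp_clm.contDiffAt.comp x ((hprim 0).smul hr)))

theorem geoFlow_zero (g h : V →L[ℝ] V →L[ℝ] ℝ) : geoFlow 0 g h = g := by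
  rw [geoFlow, ratPrim_zero, ratPrim_zero, mul_zero, Real.exp_zero, one_smul, zero_smul,
    NormedSpace.exp_zero]
  rfl

theorem geoLog_zero (g h : V →L[ℝ] V →L[ℝ] ℝ) : geoLog 0 g h = raise g h := by
  simp [geoLog]

theorem isInvertible_geoFlow (t : ℝ) {g : V →L[ℝ] V →L[ℝ] ℝ} (hg : g.IsInvertible)
    (h : V →L[ℝ] V →L[ℝ] ℝ) : (geoFlow t g h).IsInvertible := by
  rw [geoFlow]
  set a := 1 / 4 * tr (raise g h * raise g h) * ratPrim 1 (volLin g h) (volQuad g h) t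
  set A := ratPrim 0 (volLin g h) (volQuad g h) t • raise g h
  have hU : (Real.exp a • NormedSpace.exp A : V →L[ℝ] V).IsInvertible := by
    refine ContinuousLinearMap.IsInvertible.of_inverse
      (g := (Real.exp (-a) • NormedSpace.exp (-A) : V →L[ℝ] V)) ?_ ?_
    · have h1 := exp_mul_exp_neg A
      calc (Real.exp a • NormedSpace.exp A : V →L[ℝ] V) * (Real.exp (-a) • NormedSpace.exp (-A))
          = 1 := by
            rw [smul_mul_smul_comm, h1, ← Real.exp_add, add_neg_cancel, Real.exp_zero, one_smul]
        _ = _ := rfl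
    · have h1 := exp_mul_exp_neg (-A)
      rw [neg_neg] at h1
      calc (Real.exp (-a) • NormedSpace.exp (-A) : V →L[ℝ] V) * (Real.exp a • NormedSpace.exp A)
          = 1 := by
            rw [smul_mul_smul_comm, h1, ← Real.exp_add, neg_add_cancel, Real.exp_zero, one_smul]
        _ = _ := rfl
  rw [← ContinuousLinearMap.comp_smul]
  exact hg.comp hU

theorem hasDerivAt_geoFlow {t : ℝ} {g h : V →L[ℝ] V →L[ℝ] ℝ} (hx : (t, g, h) ∈ geoDomain V) :
    HasDerivAt (fun τ => geoFlow τ g h) (geoFlow t g h ∘L geoLog t g h) t := by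
  have h0 := hasDerivAt_ratPrim 0 hx.2
  have h1 := hasDerivAt_ratPrim 1 hx.2
  have hexp := hasDerivAt_exp_smul_comp h0 (raise g h)
  have hsc := (h1.const_mul (1 / 4 * tr (raise g h * raise g h))).exp
  have hcomp := (hasDerivAt_const t g).clm_comp hexp
  refine (hsc.smul hcomp).congr_deriv ?_
  simp only [geoFlow, geoLog, pow_zero, one_mul, pow_one, ContinuousLinearMap.zero_comp, zero_add]
  set a := Real.exp (1 / 4 * tr (raise g h * raise g h) * ratPrim 1 (volLin g h) (volQuad g h) t)
  set X := NormedSpace.exp (ratPrim 0 (volLin g h) (volQuad g h) t • raise g h)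
  set P := raise g h
  ext v w
  have hone : (1 : V →L[ℝ] V) v = v := rfl
  simp [hone]
  ring

/-- With w = 1 + at + bt² the right side is 2w'/w, in accordance with w being the ratio of volume
densities. -/
theorem tr_geoLog (t : ℝ) (g h : V →L[ℝ] V →L[ℝ] ℝ) :
    tr (geoLog t g h) = (1 + volLin g h * t + volQuad g h * t ^ 2)⁻¹ *
      (2 * (volLin g h + 2 * volQuad g h * t)) := by
  rw [geoLog, tr_smul, tr_add, tr_smul, tr_one, volLin, volQuad]
  ring

/-- The coefficients a and b are such that the trace of (P₀ + ¼ tr(P₀²) t 1)² factors as w tr(P₀²),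
so one of the two factors w⁻¹ cancels. -/
theorem tr_geoLog_sq (t : ℝ) (g h : V →L[ℝ] V →L[ℝ] ℝ) :
    tr (geoLog t g h * geoLog t g h) = (1 + volLin g h * t + volQuad g h * t ^ 2)⁻¹ *
      tr (raise g h * raise g h) := by
  have : tr (geoLog t g h * geoLog t g h) =
      (1 + volLin g h * t + volQuad g h * t ^ 2)⁻¹ * (1 + volLin g h * t + volQuad g h * t ^ 2)⁻¹ *
      ((1 + volLin g h * t + volQuad g h * t ^ 2) * tr (raise g h * raise g h)) := by
    rw [geoLog, smul_mul_smul_comm, tr_smul, add_mul, mul_add, mul_add, mul_smul_comm,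
      smul_mul_assoc, smul_mul_assoc, mul_one, one_mul, mul_smul_comm, mul_one, tr_add, tr_add,
      tr_add, tr_smul, tr_smul, tr_smul, tr_one]
    congr 1
    rw [volLin, volQuad]
    ring
  rw [this]
  field_simp

/-- The closed formula solves the geodesic equation. With Q the logarithmic derivative, (gQ)' = g(Q²
+ Q'), so by `christoffelForm_comp` it suffices that Q' = ¼ tr(Q²) 1 - ½ tr(Q) Q, which the two
trace formulas provide. -/
theorem hasDerivAt_geoVel {t : ℝ} {g h : V →L[ℝ] V →L[ℝ] ℝ} (hx : (t, g, h) ∈ geoDomain V) :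
    HasDerivAt (fun τ => geoFlow τ g h ∘L geoLog τ g h)
      (christoffelForm (geoFlow t g h) (geoFlow t g h ∘L geoLog t g h)
        (geoFlow t g h ∘L geoLog t g h)) t := by
  have hv : 1 + volLin g h * t + volQuad g h * t ^ 2 ≠ 0 :=
    (quad_pos_of_mem hx.2 right_mem_uIcc).ne'
  have hvd : HasDerivAt (fun t => 1 + volLin g h * t + volQuad g h * t ^ 2)
      (volLin g h + 2 * volQuad g h * t) t := by
    have h1 := ((hasDerivAt_id t).const_mul (volLin g h)).const_add 1
    have h2 := (hasDerivAt_pow 2 t).const_mul (volQuad g h)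
    convert! h1.add h2 using 1
    push_cast
    ring
  have hlin : HasDerivAt (fun t : ℝ => raise g h + (1 / 4 * tr (raise g h * raise g h) * t) • 1)
      ((1 / 4 * tr (raise g h * raise g h)) • (1 : V →L[ℝ] V)) t := by
    refine HasDerivAt.const_add _ (HasDerivAt.smul_const ?_ _)
    simpa using (hasDerivAt_id t).const_mul (1 / 4 * tr (raise g h * raise g h))
  have hQ := (hvd.fun_inv hv).fun_smul hlin
  refine ((hasDerivAt_geoFlow hx).clm_comp hQ).congr_deriv ?_
  rw [christoffelForm_comp (isInvertible_geoFlow t hx.1.isInvertible h), tr_geoLog, tr_geoLog_sq]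
  have hQ' : (1 + volLin g h * t + volQuad g h * t ^ 2)⁻¹ •
    (raise g h + (1 / 4 * tr (raise g h * raise g h) * t) • 1) = geoLog t g h := rfl
  have hL : raise g h + (1 / 4 * tr (raise g h * raise g h) * t) • 1 =
      (1 + volLin g h * t + volQuad g h * t ^ 2) • geoLog t g h := by
    rw [geoLog, smul_inv_smul₀ hv]
  rw [hQ', hL, ContinuousLinearMap.comp_assoc, ← ContinuousLinearMap.comp_add]
  congr 1
  set Q := geoLog t g h
  set v := 1 + volLin g h * t + volQuad g h * t ^ 2
  change Q * Q + _ = _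
  rw [smul_smul, smul_smul]
  have hc : -(volLin g h + 2 * volQuad g h * t) / v ^ 2 * v =
    - (v⁻¹ * (volLin g h + 2 * volQuad g h * t)) := by
    field_simp
  rw [hc]
  module

/-- Powers of a g-symmetric endomorphism are g-symmetric, and the exponential series is summed term
by term. -/
theorem apply_exp_comm {g : V →L[ℝ] V →L[ℝ] ℝ} {A : V →L[ℝ] V}
    (hA : ∀ v w, g (A v) w = g v (A w)) (v w : V) :
    g (NormedSpace.exp A v) w = g v (NormedSpace.exp A w) := by
  have : CompleteSpace V := FiniteDimensional.complete ℝ V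
  have hpow : ∀ (m : ℕ) (v w : V), g ((A ^ m) v) w = g v ((A ^ m) w) := by
    intro m
    induction m with
    | zero => simp
    | succ m ih =>
      intro v w
      calc g ((A ^ (m + 1)) v) w = g ((A ^ m) (A v)) w := by rw [pow_succ]; rfl
        _ = g v (A ((A ^ m) w)) := by rw [ih, hA]
        _ = g v ((A ^ (m + 1)) w) := by rw [pow_succ']; rfl
  have hs := NormedSpace.exp_series_hasSum_exp' (𝕂 := ℝ) A
  have h1 := hs.mapL ((ContinuousLinearMap.apply ℝ ℝ w ∘L g) ∘L ContinuousLinearMap.apply ℝ V v)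
  have h2 := hs.mapL (g v ∘L ContinuousLinearMap.apply ℝ V w)
  refine h1.unique ?_
  convert! h2 using 2 with m
  rw [map_smul, map_smul]
  exact congrArg (fun x : ℝ => (m.factorial : ℝ)⁻¹ • x) (hpow m v w)

/-- Multiples of g⁻¹h are g-symmetric, hence so are their exponentials. For positivity, exp A =
exp(A/2)² gives g(exp(A)v, v) = g(exp(A/2)v, exp(A/2)v), and exp(A/2) is injective. -/
theorem geoFlow_apply_comm {g h : V →L[ℝ] V →L[ℝ] ℝ} (hg : IsPos g)
    (hgs : ∀ v w, g v w = g w v) (hhs : ∀ v w, h v w = h w v) (t : ℝ) (v w : V) :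
    geoFlow t g h v w = geoFlow t g h w v ∧ (v ≠ 0 → 0 < geoFlow t g h v v) := by
  have hgP : ∀ v, g (raise g h v) = h v := fun v => congr($(comp_raise hg.isInvertible h) v)
  have hP : ∀ (a : ℝ) (v w : V), g ((a • raise g h) v) w = g v ((a • raise g h) w) := by
    intro a v w
    simp only [smul_apply, map_smul, smul_eq_mul, hgP]
    rw [hgs v, hgP, hhs]
  set a := ratPrim 0 (volLin g h) (volQuad g h) t
  have happ : ∀ v w, geoFlow t g h v w =
    Real.exp (1 / 4 * tr (raise g h * raise g h) * ratPrim 1 (volLin g h) (volQuad g h) t) *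
      g (NormedSpace.exp (a • raise g h) v) w := fun v w => rfl
  constructor
  · rw [happ, happ, apply_exp_comm (hP a), hgs]
  · intro hv
    rw [happ]
    refine mul_pos (Real.exp_pos _) ?_
    have hhalf : NormedSpace.exp (a • raise g h) =
        NormedSpace.exp ((a / 2) • raise g h) * NormedSpace.exp ((a / 2) • raise g h) := by
      have : CompleteSpace V := FiniteDimensional.complete ℝ V
      let : NormedAlgebra ℚ (V →L[ℝ] V) := NormedAlgebra.restrictScalars ℚ ℝ _
      rw [← NormedSpace.exp_add_of_commute (Commute.refl _), ← add_smul, add_halves]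
    rw [hhalf, mul_apply_eq_comp, apply_exp_comm (hP _)]
    refine hg _ fun h0 => hv ?_
    have h1 := exp_mul_exp_neg (-((a / 2) • raise g h))
    rw [neg_neg] at h1
    calc v = (NormedSpace.exp (-((a / 2) • raise g h)) * NormedSpace.exp ((a / 2) • raise g h)) v := by
          rw [h1]; rfl
      _ = 0 := by rw [mul_apply_eq_comp, h0, map_zero]

theorem isPos_geoFlow {g h : V →L[ℝ] V →L[ℝ] ℝ} (hg : IsPos g)
    (hgs : ∀ v w, g v w = g w v) (hhs : ∀ v w, h v w = h w v) (t : ℝ) :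
    IsPos (geoFlow t g h) := fun v => (geoFlow_apply_comm hg hgs hhs t v v).2

/-- Smoothness of inversion shows that P = g⁻¹u is differentiable; its derivative is then found by
differentiating u = gP and solving for P'. -/
theorem hasDerivWithinAt_raise {c u : ℝ → V →L[ℝ] V →L[ℝ] ℝ} {c' u' : V →L[ℝ] V →L[ℝ] ℝ}
    {J : Set ℝ} {t : ℝ} (hJ : UniqueDiffWithinAt ℝ J t) (ht : t ∈ J)
    (hg : ∀ s ∈ J, (c s).IsInvertible)
    (hc : HasDerivWithinAt c c' J t) (hu : HasDerivWithinAt u u' J t) :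
    HasDerivWithinAt (fun τ => raise (c τ) (u τ))
      (raise (c t) u' - raise (c t) c' * raise (c t) (u t)) J t := by
  have hD : HasFDerivAt (fun p : (V →L[ℝ] V →L[ℝ] ℝ) × (V →L[ℝ] V →L[ℝ] ℝ) => raise p.1 p.2)
      _ (c t, u t) :=
    ((contDiffAt_raise (hg t ht) (u t) (m := 1)).differentiableAt one_ne_zero).hasFDerivAt
  have hP := hD.comp_hasDerivWithinAt (f := fun τ => (c τ, u τ)) t (hc.prodMk hu)
  set P' := fderiv ℝ (fun p : (V →L[ℝ] V →L[ℝ] ℝ) × (V →L[ℝ] V →L[ℝ] ℝ) => raise p.1 p.2)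
    (c t, u t) (c', u')
  have h1 : HasDerivWithinAt u (c' ∘L raise (c t) (u t) + c t ∘L P') J t :=
    (hc.clm_comp hP).congr (fun s hs => (comp_raise (hg s hs) (u s)).symm)
      (comp_raise (hg t ht) (u t)).symm
  refine hP.congr_deriv ?_
  have h2 := hJ.eq_deriv _ hu h1
  rw [h2, raise_add, raise_comp (hg t ht)]
  have : raise (c t) (c' ∘L raise (c t) (u t)) = raise (c t) c' * raise (c t) (u t) := rfl
  rw [this, add_sub_cancel_left]

theorem eq_of_hasDerivWithinAt_zero {F : Type*} [NormedAddCommGroup F] [NormedSpace ℝ F]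
    {f : ℝ → F} {I : Set ℝ} (hI : Convex ℝ I) (hf : ∀ s ∈ I, HasDerivWithinAt f 0 I s)
    {a b : ℝ} (ha : a ∈ I) (hb : b ∈ I) : f b = f a := by
  have := hI.norm_image_sub_le_of_norm_hasDerivWithin_le (f' := fun _ => 0) (C := 0) hf
    (fun _ _ => by simp) ha hb
  rw [zero_mul] at this
  exact sub_eq_zero.1 (norm_le_zero_iff.1 this)

/-- Geodesics in the space of metrics are given by the explicit formula `geoFlow`. -/
theorem geodesic_eq_geoFlow {c u : ℝ → V →L[ℝ] V →L[ℝ] ℝ} {t : ℝ}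
    (hpos : ∀ s ∈ uIcc 0 t, IsPos (c s))
    (hc : ∀ s ∈ uIcc 0 t, HasDerivWithinAt c (u s) (uIcc 0 t) s)
    (hu : ∀ s ∈ uIcc 0 t,
      HasDerivWithinAt u (christoffelForm (c s) (u s) (u s)) (uIcc 0 t) s) :
    (t, c 0, u 0) ∈ geoDomain V ∧ c t = geoFlow t (c 0) (u 0) := by
  rcases eq_or_ne t 0 with rfl | ht
  · exact ⟨⟨hpos 0 left_mem_uIcc, by simp [quadPos]⟩, (geoFlow_zero _ _).symm⟩
  have hlt : min 0 t < max 0 t := min_lt_max.2 ht.symm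
  have hconv : Convex ℝ (uIcc 0 t) := convex_uIcc 0 t
  have h0I : (0 : ℝ) ∈ uIcc 0 t := left_mem_uIcc
  have hJ : ∀ s ∈ uIcc 0 t, UniqueDiffWithinAt ℝ (uIcc 0 t) s := uniqueDiffOn_Icc hlt
  have hinv : ∀ s ∈ uIcc 0 t, (c s).IsInvertible := fun s hs => (hpos s hs).isInvertible
  set P : ℝ → V →L[ℝ] V := fun s => raise (c s) (u s) with hPdef
  have hP : ∀ s ∈ uIcc 0 t, HasDerivWithinAt P
      ((1 / 4 * tr (P s * P s)) • 1 - (1 / 2 * tr (P s)) • P s) (uIcc 0 t) s := by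
    intro s hs
    refine (hasDerivWithinAt_raise (hJ s hs) hs hinv (hc s hs) (hu s hs)).congr_deriv ?_
    rw [raise_christoffelForm (hinv s hs)]
    change (1 / 2 : ℝ) • (P s * P s) + (1 / 2 : ℝ) • (P s * P s) + (1 / 4 * tr (P s * P s)) • 1
        - (1 / 4 * tr (P s)) • P s - (1 / 4 * tr (P s)) • P s - P s * P s = _
    module
  have htr : ∀ {A : ℝ → V →L[ℝ] V} {A' : V →L[ℝ] V} {s : ℝ},
      HasDerivWithinAt A A' (uIcc 0 t) s →
      HasDerivWithinAt (fun s => tr (A s)) (tr A') (uIcc 0 t) s := fun hA =>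
    (trCLM V).hasFDerivAt.comp_hasDerivWithinAt _ hA
  have hp : ∀ s ∈ uIcc 0 t, HasDerivWithinAt (fun s => tr (P s))
      ((Module.finrank ℝ V : ℝ) / 4 * tr (P s * P s) - 1 / 2 * tr (P s) ^ 2) (uIcc 0 t) s := by
    intro s hs
    refine (htr (hP s hs)).congr_deriv ?_
    rw [tr_sub, tr_smul, tr_smul, tr_one]
    ring
  have hq : ∀ s ∈ uIcc 0 t, HasDerivWithinAt (fun s => tr (P s * P s))
      (-(1 / 2 * tr (P s) * tr (P s * P s))) (uIcc 0 t) s := by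
    intro s hs
    refine (htr ((hP s hs).mul (hP s hs))).congr_deriv ?_
    rw [mul_sub, sub_mul, smul_mul_assoc, mul_smul_comm, smul_mul_assoc, mul_smul_comm, one_mul,
      mul_one, tr_add, tr_sub, tr_smul, tr_smul]
    ring
  have hpcont : ContinuousOn (fun s => 1 / 2 * tr (P s)) (Icc (min 0 t) (max 0 t)) :=
    fun s hs => ((hp s hs).const_mul (1 / 2)).continuousWithinAt
  -- Extending ½ tr P continuously to ℝ makes its primitive differentiable at every point, including
  -- the ends of the segment.
  set pe : ℝ → ℝ := IccExtend hlt.le ((Icc (min 0 t) (max 0 t)).domRestrict fun s => 1 / 2 * tr (P s))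
    with hpe
  have hpecont : Continuous pe := hpcont.domRestrict.Icc_extend'
  have hpeeq : ∀ s ∈ uIcc 0 t, pe s = 1 / 2 * tr (P s) := fun s hs =>
    IccExtend_of_mem hlt.le _ hs
  set w : ℝ → ℝ := fun s => Real.exp (∫ r in (0 : ℝ)..s, pe r) with hwdef
  have hw : ∀ s ∈ uIcc 0 t, HasDerivWithinAt w (1 / 2 * tr (P s) * w s) (uIcc 0 t) s := by
    intro s hs
    have := (hpecont.integral_hasStrictDerivAt 0 s).hasDerivAt.exp
    rw [hpeeq s hs, mul_comm] at this
    exact this.hasDerivWithinAt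
  have hw0 : w 0 = 1 := by simp [hwdef]
  set q₀ := tr (P 0 * P 0) with hq₀
  -- First integral: the logarithmic derivative of tr(P²) is -½ tr P, opposite to that of w; as an
  -- equation this needs no division.
  have hqw : ∀ s ∈ uIcc 0 t, tr (P s * P s) * w s = q₀ := by
    intro s hs
    have := eq_of_hasDerivWithinAt_zero (f := fun s => tr (P s * P s) * w s) hconv
      (fun r hr => ((hq r hr).fun_mul (hw r hr)).congr_deriv (by ring)) h0I hs
    simpa [hw0] using this
  -- The derivative of ½ tr(P) w is (n/8) tr(P²) w, which by the first integral is the constant 2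
  -- `volQuad`.
  have hw' : ∀ s ∈ uIcc 0 t, 1 / 2 * tr (P s) * w s =
      volLin (c 0) (u 0) + 2 * volQuad (c 0) (u 0) * s := by
    intro s hs
    have := eq_of_hasDerivWithinAt_zero
      (f := fun s => 1 / 2 * tr (P s) * w s - 2 * volQuad (c 0) (u 0) * s) hconv
      (fun r hr => ((((hp r hr).const_mul (1 / 2)).fun_mul (hw r hr)).fun_sub
        ((hasDerivWithinAt_id r _).const_mul (2 * volQuad (c 0) (u 0)))).congr_deriv (by
          have h1 := hqw r hr
          have h2 : volQuad (c 0) (u 0) = (Module.finrank ℝ V : ℝ) / 16 * q₀ := rfl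
          rw [h2, ← h1]
          ring)) h0I hs
    simp only [hw0, mul_zero, sub_zero, mul_one] at this
    rw [sub_eq_iff_eq_add] at this
    rw [this]
    rfl
  have hwv : ∀ s ∈ uIcc 0 t, w s = 1 + volLin (c 0) (u 0) * s + volQuad (c 0) (u 0) * s ^ 2 := by
    intro s hs
    have := eq_of_hasDerivWithinAt_zero
      (f := fun s => w s - (volLin (c 0) (u 0) * s + volQuad (c 0) (u 0) * s ^ 2)) hconv
      (fun r hr => ((hw r hr).fun_sub
        (((hasDerivWithinAt_id r _).const_mul (volLin (c 0) (u 0))).fun_add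
          ((hasDerivAt_pow 2 r).hasDerivWithinAt.const_mul
            (volQuad (c 0) (u 0))))).congr_deriv (by
          rw [hw' r hr]
          push_cast
          ring)) h0I hs
    simp only [hw0] at this
    linarith
  have hPw : ∀ s ∈ uIcc 0 t, w s • P s = P 0 + (1 / 4 * q₀ * s) • 1 := by
    intro s hs
    have := eq_of_hasDerivWithinAt_zero
      (f := fun s => w s • P s - (1 / 4 * q₀ * s) • (1 : V →L[ℝ] V)) hconv
      (fun r hr => (((hw r hr).fun_smul (hP r hr)).fun_sub
        (((hasDerivWithinAt_id r _).const_mul (1 / 4 * q₀)).smul_const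
          (1 : V →L[ℝ] V))).congr_deriv (by
          have h1 := hqw r hr
          rw [← h1]
          module)) h0I hs
    simpa [hw0, sub_eq_iff_eq_add] using this
  -- The quadratic polynomial agrees with w, an exponential, so it stays positive for as long as the
  -- geodesic exists.
  have hdom : ∀ s ∈ uIcc 0 t, (s, c 0, u 0) ∈ geoDomain V := fun s hs =>
    ⟨hpos 0 h0I, mem_quadPos_of_pos fun r hr => by
      have hr' : r ∈ uIcc 0 t := uIcc_subset_uIcc h0I hs hr
      rw [← hwv r hr']
      exact Real.exp_pos _⟩
  refine ⟨hdom t right_mem_uIcc, ?_⟩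
  have hlog : ∀ s ∈ uIcc 0 t, P s = geoLog s (c 0) (u 0) := by
    intro s hs
    rw [geoLog, ← hwv s hs]
    exact (eq_inv_smul_iff₀ (Real.exp_pos _).ne').2 (hPw s hs)
  set A := ratPrim 0 (volLin (c 0) (u 0)) (volQuad (c 0) (u 0))
  set B := ratPrim 1 (volLin (c 0) (u 0)) (volQuad (c 0) (u 0))
  -- Undoing both exponential factors of the formula turns c into a curve with zero derivative. Here
  -- P₀ commutes with its own exponential.
  have hconst := eq_of_hasDerivWithinAt_zero
    (f := fun s => Real.exp (-(1 / 4 * q₀ * B s)) • (c s ∘L NormedSpace.exp (-A s • P 0))) hconv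
    (fun r hr => by
      have h0 := (hasDerivAt_ratPrim 0 (hdom r hr).2).fun_neg
      have h1 := ((hasDerivAt_ratPrim 1 (hdom r hr).2).const_mul (1 / 4 * q₀)).fun_neg.exp
      have hexp := (hasDerivAt_exp_smul_comp h0 (P 0)).hasDerivWithinAt (s := uIcc 0 t)
      refine (h1.hasDerivWithinAt.fun_smul ((hc r hr).clm_comp hexp)).congr_deriv ?_
      have hur : u r = c r ∘L P r := (comp_raise (hinv r hr) (u r)).symm
      simp only [pow_zero, one_mul, pow_one]
      rw [hur, hlog r hr]
      simp only [geoLog]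
      change _ = (0 : V →L[ℝ] V →L[ℝ] ℝ)
      have hcm : Commute (NormedSpace.exp (-A r • P 0)) (P 0) := by
        have : CompleteSpace V := FiniteDimensional.complete ℝ V
        let : NormedAlgebra ℚ (V →L[ℝ] V) := NormedAlgebra.restrictScalars ℚ ℝ _
        exact ((Commute.refl (P 0)).smul_left (-A r)).exp_left
      have hcm' : ∀ x, NormedSpace.exp (-A r • P 0) (P 0 x) =
          P 0 (NormedSpace.exp (-A r • P 0) x) := fun x => congr($hcm.eq x)
      set X := NormedSpace.exp (-A r • P 0)
      have hone : ∀ x, (1 : V →L[ℝ] V) x = x := fun x => rfl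
      have hPP : raise (c 0) (u 0) = P 0 := rfl
      ext v y
      simp [hone, hcm', hPP, ← hq₀]
      ring) h0I (right_mem_uIcc : t ∈ uIcc 0 t)
  have hA0 : A 0 = 0 := ratPrim_zero _ _ _
  have hB0 : B 0 = 0 := ratPrim_zero _ _ _
  simp only [hA0, hB0, mul_zero, neg_zero, Real.exp_zero, zero_smul, NormedSpace.exp_zero,
    one_smul] at hconst
  have hc0 : c 0 ∘L (1 : V →L[ℝ] V) = c 0 := rfl
  rw [hc0] at hconst
  rw [geoFlow]
  change c t = Real.exp (1 / 4 * q₀ * B t) • (c 0 ∘L NormedSpace.exp (A t • P 0))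
  have h1 := exp_mul_exp_neg (-(A t • P 0))
  rw [neg_neg] at h1
  rw [← hconst, neg_smul, ContinuousLinearMap.smul_comp, smul_smul, ← Real.exp_add, add_neg_cancel,
    Real.exp_zero, one_smul, ContinuousLinearMap.comp_assoc]
  exact (congrArg (fun X : V →L[ℝ] V => c t ∘L X) h1).symm

end FibreGeodesics

/-! ### Behaviour under linear isomorphisms -/

section Naturality

variable {V W : Type*} [NormedAddCommGroup V] [NormedSpace ℝ V] [FiniteDimensional ℝ V]
  [NormedAddCommGroup W] [NormedSpace ℝ W] [FiniteDimensional ℝ W]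

/-- The pullback of a bilinear form under a linear map. -/
def pull (L : V →L[ℝ] W) (h : W →L[ℝ] W →L[ℝ] ℝ) : V →L[ℝ] V →L[ℝ] ℝ := h.bilinearComp L L

@[simp]
theorem pull_apply (L : V →L[ℝ] W) (h : W →L[ℝ] W →L[ℝ] ℝ) (v w : V) :
    pull L h v w = h (L v) (L w) := rfl

theorem pull_add (L : V →L[ℝ] W) (h k : W →L[ℝ] W →L[ℝ] ℝ) :
    pull L (h + k) = pull L h + pull L k := rfl

theorem pull_smul (L : V →L[ℝ] W) (a : ℝ) (h : W →L[ℝ] W →L[ℝ] ℝ) :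
    pull L (a • h) = a • pull L h := rfl

theorem pull_pull_symm (L : V ≃L[ℝ] W) (h : W →L[ℝ] W →L[ℝ] ℝ) :
    pull (L.symm : W →L[ℝ] V) (pull (L : V →L[ℝ] W) h) = h := by
  ext v w
  simp

theorem IsPos.pull {g : W →L[ℝ] W →L[ℝ] ℝ} (hg : IsPos g) (L : V ≃L[ℝ] W) :
    IsPos (pull (L : V →L[ℝ] W) g) :=
  fun v hv => hg (L v) (by simpa using hv)

/-- Since g⁻¹h is an endomorphism, a change of frame conjugates it. Traces, and with them the
coefficients of w, are therefore invariant. -/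
theorem raise_pull {g : W →L[ℝ] W →L[ℝ] ℝ} (hg : IsPos g) (L : V ≃L[ℝ] W)
    (h : W →L[ℝ] W →L[ℝ] ℝ) :
    raise (pull (L : V →L[ℝ] W) g) (pull (L : V →L[ℝ] W) h) =
      (L.symm : W →L[ℝ] V) ∘L raise g h ∘L (L : V →L[ℝ] W) := by
  have : pull (L : V →L[ℝ] W) h = pull (L : V →L[ℝ] W) g ∘L
      ((L.symm : W →L[ℝ] V) ∘L raise g h ∘L (L : V →L[ℝ] W)) := by
    ext v w
    have h1 : g (raise g h (L v)) = h (L v) := congr($(comp_raise hg.isInvertible h) (L v))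
    simp [h1]
  rw [this, raise_comp (hg.pull L).isInvertible]

theorem raise_mul_raise_pull {g : W →L[ℝ] W →L[ℝ] ℝ} (hg : IsPos g) (L : V ≃L[ℝ] W)
    (h k : W →L[ℝ] W →L[ℝ] ℝ) :
    raise (pull (L : V →L[ℝ] W) g) (pull (L : V →L[ℝ] W) h) ∘L
        raise (pull (L : V →L[ℝ] W) g) (pull (L : V →L[ℝ] W) k) =
      (L.symm : W →L[ℝ] V) ∘L (raise g h ∘L raise g k) ∘L (L : V →L[ℝ] W) := by
  rw [raise_pull hg, raise_pull hg]
  ext v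
  simp

theorem christoffelForm_pull {g : W →L[ℝ] W →L[ℝ] ℝ} (hg : IsPos g) (L : V ≃L[ℝ] W)
    (h k : W →L[ℝ] W →L[ℝ] ℝ) :
    christoffelForm (pull (L : V →L[ℝ] W) g) (pull (L : V →L[ℝ] W) h) (pull (L : V →L[ℝ] W) k) =
      pull (L : V →L[ℝ] W) (christoffelForm g h k) := by
  rw [christoffelForm, raise_mul_raise_pull hg, raise_pull hg, raise_pull hg, tr_conj, tr_conj,
    tr_conj]
  ext v w
  simp [christoffelForm]

theorem finrank_eq_of_equiv (L : V ≃L[ℝ] W) : Module.finrank ℝ V = Module.finrank ℝ W :=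
  L.toLinearEquiv.finrank_eq

theorem volLin_pull {g : W →L[ℝ] W →L[ℝ] ℝ} (hg : IsPos g) (L : V ≃L[ℝ] W)
    (h : W →L[ℝ] W →L[ℝ] ℝ) :
    volLin (pull (L : V →L[ℝ] W) g) (pull (L : V →L[ℝ] W) h) = volLin g h := by
  rw [volLin, raise_pull hg, tr_conj, volLin]

theorem tr_raise_sq_pull {g : W →L[ℝ] W →L[ℝ] ℝ} (hg : IsPos g) (L : V ≃L[ℝ] W)
    (h k : W →L[ℝ] W →L[ℝ] ℝ) :
    tr (raise (pull (L : V →L[ℝ] W) g) (pull (L : V →L[ℝ] W) h) ∘L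
      raise (pull (L : V →L[ℝ] W) g) (pull (L : V →L[ℝ] W) k)) =
      tr (raise g h ∘L raise g k) := by
  rw [raise_mul_raise_pull hg, tr_conj]

theorem volQuad_pull {g : W →L[ℝ] W →L[ℝ] ℝ} (hg : IsPos g) (L : V ≃L[ℝ] W)
    (h : W →L[ℝ] W →L[ℝ] ℝ) :
    volQuad (pull (L : V →L[ℝ] W) g) (pull (L : V →L[ℝ] W) h) = volQuad g h := by
  rw [volQuad, volQuad, finrank_eq_of_equiv L]
  exact congrArg _ (tr_raise_sq_pull hg L h h)

theorem geoDomain_pull {t : ℝ} {g h : W →L[ℝ] W →L[ℝ] ℝ} (hx : (t, g, h) ∈ geoDomain W)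
    (L : V ≃L[ℝ] W) :
    (t, pull (L : V →L[ℝ] W) g, pull (L : V →L[ℝ] W) h) ∈ geoDomain V := by
  refine ⟨hx.1.pull L, ?_⟩
  simpa only [volLin_pull hx.1, volQuad_pull hx.1] using hx.2

theorem geoDomain_of_pull {t : ℝ} {g h : W →L[ℝ] W →L[ℝ] ℝ} (L : V ≃L[ℝ] W)
    (hx : (t, pull (L : V →L[ℝ] W) g, pull (L : V →L[ℝ] W) h) ∈ geoDomain V) :
    (t, g, h) ∈ geoDomain W := by
  have := geoDomain_pull hx L.symm
  rwa [pull_pull_symm, pull_pull_symm] at this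

theorem exp_conj_equiv (L : V ≃L[ℝ] W) (A : W →L[ℝ] W) :
    NormedSpace.exp ((L.symm : W →L[ℝ] V) ∘L A ∘L (L : V →L[ℝ] W)) =
      (L.symm : W →L[ℝ] V) ∘L NormedSpace.exp A ∘L (L : V →L[ℝ] W) := by
  have : CompleteSpace V := FiniteDimensional.complete ℝ V
  have : CompleteSpace W := FiniteDimensional.complete ℝ W
  let : NormedAlgebra ℚ (V →L[ℝ] V) := NormedAlgebra.restrictScalars ℚ ℝ _
  let : NormedAlgebra ℚ (W →L[ℝ] W) := NormedAlgebra.restrictScalars ℚ ℝ _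
  exact (NormedSpace.map_exp L.symm.conjContinuousAlgEquiv
    L.symm.conjContinuousAlgEquiv.continuous A).symm

/-- This turns the fibrewise formula into a smooth tensor field: its expression in a chart is the
same formula applied to the chart expressions of g and h. -/
theorem geoFlow_pull (t : ℝ) {g : W →L[ℝ] W →L[ℝ] ℝ} (hg : IsPos g) (L : V ≃L[ℝ] W)
    (h : W →L[ℝ] W →L[ℝ] ℝ) :
    geoFlow t (pull (L : V →L[ℝ] W) g) (pull (L : V →L[ℝ] W) h) =
      pull (L : V →L[ℝ] W) (geoFlow t g h) := by
  have h1 : tr (raise (pull (L : V →L[ℝ] W) g) (pull (L : V →L[ℝ] W) h) *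
      raise (pull (L : V →L[ℝ] W) g) (pull (L : V →L[ℝ] W) h)) = tr (raise g h * raise g h) :=
    tr_raise_sq_pull hg L h h
  have h2 : ∀ a : ℝ, a • ((L.symm : W →L[ℝ] V) ∘L raise g h ∘L (L : V →L[ℝ] W)) =
      (L.symm : W →L[ℝ] V) ∘L (a • raise g h) ∘L (L : V →L[ℝ] W) := by
    intro a
    ext v
    simp
  rw [geoFlow, h1, volLin_pull hg, volQuad_pull hg, raise_pull hg, h2, exp_conj_equiv, geoFlow]
  ext v w
  simp

end Naturality

/-! ### Commuting partial derivatives on a strip with closed time interval -/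

section MixedPartials

variable {F : Type*} [NormedAddCommGroup F] [NormedSpace ℝ F]

/-- The strip `[a, b] × (-ε, ε)`. -/
def strip (a b ε : ℝ) : Set (ℝ × ℝ) := Icc a b ×ˢ Ioo (-ε) ε

/-- The partial derivative within a set of a function of two real variables, in a direction. -/
def dirDeriv (S : Set (ℝ × ℝ)) (e : ℝ × ℝ) (f : ℝ × ℝ → F) (p : ℝ × ℝ) : F := fderivWithin ℝ f S p e

theorem uniqueDiffOn_strip {a b : ℝ} (hab : a < b) (ε : ℝ) : UniqueDiffOn ℝ (strip a b ε) :=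
  (uniqueDiffOn_Icc hab).prod isOpen_Ioo.uniqueDiffOn

theorem contDiffOn_dirDeriv {a b ε : ℝ} (hab : a < b) {f : ℝ × ℝ → F}
    (hf : ContDiffOn ℝ ∞ f (strip a b ε)) (e : ℝ × ℝ) :
    ContDiffOn ℝ ∞ (dirDeriv (strip a b ε) e f) (strip a b ε) :=
  (hf.fderivWithin (uniqueDiffOn_strip hab ε) (by simp)).clm_apply contDiffOn_const

theorem hasDerivWithinAt_dirDeriv_fst {a b ε : ℝ} {f : ℝ × ℝ → F}
    (hf : ContDiffOn ℝ ∞ f (strip a b ε)) {t s : ℝ} (h : (t, s) ∈ strip a b ε) :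
    HasDerivWithinAt (fun τ => f (τ, s)) (dirDeriv (strip a b ε) (1, 0) f (t, s)) (Icc a b) t := by
  have h1 := (hf.differentiableOn (by simp) (t, s) h).hasFDerivWithinAt
  exact h1.comp_hasDerivWithinAt (f := fun τ => (τ, s)) t
    ((hasDerivWithinAt_id t _).prodMk (hasDerivWithinAt_const t _ s)) fun τ hτ => ⟨hτ, h.2⟩

theorem hasDerivAt_dirDeriv_snd {a b ε : ℝ} {f : ℝ × ℝ → F}
    (hf : ContDiffOn ℝ ∞ f (strip a b ε)) {t s : ℝ} (h : (t, s) ∈ strip a b ε) :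
    HasDerivAt (fun σ => f (t, σ)) (dirDeriv (strip a b ε) (0, 1) f (t, s)) s := by
  have h1 := (hf.differentiableOn (by simp) (t, s) h).hasFDerivWithinAt
  exact (h1.comp_hasDerivWithinAt (f := fun σ => (t, σ)) s
    ((hasDerivWithinAt_const s (Ioo (-ε) ε) t).prodMk (hasDerivWithinAt_id s _))
    fun σ hσ => ⟨h.1, hσ⟩).hasDerivAt (Ioo_mem_nhds h.2.1 h.2.2)

/-- The strip contains its edges t = a and t = b. Symmetry of the second derivative holds there too,
since every point of the strip is a limit of interior points. -/
theorem dirDeriv_comm {a b ε : ℝ} (hab : a < b) {f : ℝ × ℝ → F}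
    (hf : ContDiffOn ℝ ∞ f (strip a b ε)) {p : ℝ × ℝ} (hp : p ∈ strip a b ε) (e e' : ℝ × ℝ) :
    dirDeriv (strip a b ε) e (dirDeriv (strip a b ε) e' f) p =
      dirDeriv (strip a b ε) e' (dirDeriv (strip a b ε) e f) p := by
  have hu := uniqueDiffOn_strip hab ε
  have hd : DifferentiableWithinAt ℝ (fderivWithin ℝ f (strip a b ε)) (strip a b ε) p :=
    (hf.fderivWithin (m := ∞) hu (by simp)).differentiableOn (by simp) p hp
  have hsymm : IsSymmSndFDerivWithinAt ℝ f (strip a b ε) p := by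
    refine (hf p hp).isSymmSndFDerivWithinAt
      (by rw [minSmoothness_of_isRCLikeNormedField]; exact ENat.LEInfty.out) hu ?_ hp
    rw [strip, interior_prod_eq, closure_prod_eq, interior_Icc, interior_Ioo, closure_Ioo hab.ne]
    exact ⟨hp.1, subset_closure hp.2⟩
  have hval : ∀ e e' : ℝ × ℝ, dirDeriv (strip a b ε) e (dirDeriv (strip a b ε) e' f) p =
      fderivWithin ℝ (fderivWithin ℝ f (strip a b ε)) (strip a b ε) p e e' := by
    intro e e'
    have := hd.hasFDerivWithinAt.clm_apply (hasFDerivWithinAt_const e' p (strip a b ε))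
    change fderivWithin ℝ (fun q => fderivWithin ℝ f (strip a b ε) q e') (strip a b ε) p e = _
    rw [this.fderivWithin (hu p hp)]
    simp
  rw [hval, hval]
  exact hsymm e e'

end MixedPartials

/-! ### The linearised geodesic equation -/

section LinearisedEquation

variable {V : Type*} [NormedAddCommGroup V] [NormedSpace ℝ V] [FiniteDimensional ℝ V]

/-- The variation field of a family of geodesics satisfies the linearised geodesic equation. -/
theorem linGeodesic_of_family {a b ε : ℝ} (hab : a < b) (hε : 0 < ε)
    {f : ℝ × ℝ → V →L[ℝ] V →L[ℝ] ℝ} (hf : ContDiffOn ℝ ∞ f (strip a b ε))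
    (hinv : ∀ p ∈ strip a b ε, (f p).IsInvertible)
    (hgeo : ∀ p ∈ strip a b ε, dirDeriv (strip a b ε) (1, 0) (dirDeriv (strip a b ε) (1, 0) f) p =
      christoffelForm (f p) (dirDeriv (strip a b ε) (1, 0) f p) (dirDeriv (strip a b ε) (1, 0) f p))
    {t : ℝ} (ht : t ∈ Icc a b) :
    HasDerivWithinAt (fun τ => dirDeriv (strip a b ε) (0, 1) f (τ, 0))
        (dirDeriv (strip a b ε) (0, 1) (dirDeriv (strip a b ε) (1, 0) f) (t, 0)) (Icc a b) t ∧
      HasDerivWithinAt (fun τ => dirDeriv (strip a b ε) (0, 1) (dirDeriv (strip a b ε) (1, 0) f) (τ, 0))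
        (linGeodesic (f (t, 0)) (dirDeriv (strip a b ε) (1, 0) f (t, 0))
          (dirDeriv (strip a b ε) (0, 1) f (t, 0))
          (dirDeriv (strip a b ε) (0, 1) (dirDeriv (strip a b ε) (1, 0) f) (t, 0))) (Icc a b) t := by
  have h0 : (0 : ℝ) ∈ Ioo (-ε) ε := ⟨neg_lt_zero.2 hε, hε⟩
  have hp : (t, (0 : ℝ)) ∈ strip a b ε := ⟨ht, h0⟩
  have hf1 := contDiffOn_dirDeriv hab hf (1, 0)
  have hf2 := contDiffOn_dirDeriv hab hf (0, 1)
  have hf11 := contDiffOn_dirDeriv hab hf1 (1, 0)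
  have hf21 := contDiffOn_dirDeriv hab hf1 (0, 1)
  refine ⟨?_, ?_⟩
  · rw [dirDeriv_comm hab hf hp]
    exact hasDerivWithinAt_dirDeriv_fst hf2 hp
  · have h1 := hasDerivWithinAt_dirDeriv_fst hf21 hp
    -- Commutation applied to ∂_t f gives ∂_t ∂_s ∂_t f = ∂_s ∂_t ∂_t f, and for s near 0 the
    -- geodesic equation replaces ∂_t ∂_t f by the Christoffel symbol.
    rw [dirDeriv_comm hab hf1 hp] at h1
    refine h1.congr_deriv ?_
    have h2 := hasDerivAt_dirDeriv_snd hf11 hp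
    have h3 := (hasDerivWithinAt_christoffelForm (J := univ) (t := 0)
      (c := fun σ => f (t, σ)) (u := fun σ => dirDeriv (strip a b ε) (1, 0) f (t, σ))
      (w := fun σ => dirDeriv (strip a b ε) (1, 0) f (t, σ)) (hinv _ hp)
      (hasDerivAt_dirDeriv_snd hf hp).hasDerivWithinAt
      (hasDerivAt_dirDeriv_snd hf1 hp).hasDerivWithinAt
      (hasDerivAt_dirDeriv_snd hf1 hp).hasDerivWithinAt)
    rw [hasDerivWithinAt_univ] at h3
    have heq : (fun σ => dirDeriv (strip a b ε) (1, 0) (dirDeriv (strip a b ε) (1, 0) f) (t, σ))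
        =ᶠ[𝓝 0] fun σ => christoffelForm (f (t, σ)) (dirDeriv (strip a b ε) (1, 0) f (t, σ))
          (dirDeriv (strip a b ε) (1, 0) f (t, σ)) := by
      filter_upwards [Ioo_mem_nhds h0.1 h0.2] with σ hσ
      exact hgeo (t, σ) ⟨ht, hσ⟩
    rw [h2.unique (h3.congr_of_eventuallyEq heq), linGeodesic, two_smul, add_assoc]
    congr 2
    exact christoffelForm_comm _ _ _

theorem contDiffAt_geodesicField {g : V →L[ℝ] V →L[ℝ] ℝ} (hg : g.IsInvertible)
    (u : V →L[ℝ] V →L[ℝ] ℝ) {m : WithTop ℕ∞} :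
    ContDiffAt ℝ m (fun p : (V →L[ℝ] V →L[ℝ] ℝ) × (V →L[ℝ] V →L[ℝ] ℝ) =>
      christoffelForm p.1 p.2 p.2) (g, u) :=
  (contDiffAt_christoffelForm hg u u).comp (g, u)
    (contDiffAt_fst.prodMk (contDiffAt_snd.prodMk contDiffAt_snd))

/-- Presents `linGeodesic` as a bounded linear operator in (ξ, η) that depends continuously on (g,
u), which yields the Lipschitz bound for uniqueness. -/
theorem fderiv_geodesicField {g : V →L[ℝ] V →L[ℝ] ℝ} (hg : g.IsInvertible)
    (u ξ η : V →L[ℝ] V →L[ℝ] ℝ) :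
    fderiv ℝ (fun p : (V →L[ℝ] V →L[ℝ] ℝ) × (V →L[ℝ] V →L[ℝ] ℝ) =>
      christoffelForm p.1 p.2 p.2) (g, u) (ξ, η) = linGeodesic g u ξ η := by
  have h1 : HasDerivAt (fun s : ℝ => g + s • ξ) ξ 0 := by
    simpa using ((hasDerivAt_id (0 : ℝ)).smul_const ξ).const_add g
  have h2 : HasDerivAt (fun s : ℝ => u + s • η) η 0 := by
    simpa using ((hasDerivAt_id (0 : ℝ)).smul_const η).const_add u
  have hD : HasFDerivAt (fun p : (V →L[ℝ] V →L[ℝ] ℝ) × (V →L[ℝ] V →L[ℝ] ℝ) =>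
      christoffelForm p.1 p.2 p.2)
      (fderiv ℝ (fun p : (V →L[ℝ] V →L[ℝ] ℝ) × (V →L[ℝ] V →L[ℝ] ℝ) =>
      christoffelForm p.1 p.2 p.2) (g, u)) (g + (0 : ℝ) • ξ, u + (0 : ℝ) • η) := by
    simpa using ((contDiffAt_geodesicField hg u (m := 1)).differentiableAt one_ne_zero).hasFDerivAt
  have h3 := hD.comp_hasDerivAt (f := fun s : ℝ => (g + s • ξ, u + s • η)) 0 (h1.prodMk h2)
  have h4 := hasDerivWithinAt_christoffelForm (J := univ) (t := 0) (c := fun s : ℝ => g + s • ξ)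
    (by simpa using hg) h1.hasDerivWithinAt h2.hasDerivWithinAt h2.hasDerivWithinAt
  rw [hasDerivWithinAt_univ] at h4
  rw [h3.unique h4, linGeodesic, two_smul, add_assoc, christoffelForm_comm _ η]
  simp

/-- Solutions of the linearised geodesic equation are determined by their initial values. -/
theorem linGeodesic_unique {a b t₀ : ℝ} (ht₀ : t₀ ∈ Icc a b)
    {c u ξ η ξ' η' : ℝ → V →L[ℝ] V →L[ℝ] ℝ} (hc : ContinuousOn c (Icc a b))
    (hu : ContinuousOn u (Icc a b)) (hinv : ∀ t ∈ Icc a b, (c t).IsInvertible)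
    (hξ : ∀ t ∈ Icc a b, HasDerivWithinAt ξ (η t) (Icc a b) t)
    (hη : ∀ t ∈ Icc a b, HasDerivWithinAt η (linGeodesic (c t) (u t) (ξ t) (η t)) (Icc a b) t)
    (hξ' : ∀ t ∈ Icc a b, HasDerivWithinAt ξ' (η' t) (Icc a b) t)
    (hη' : ∀ t ∈ Icc a b, HasDerivWithinAt η' (linGeodesic (c t) (u t) (ξ' t) (η' t)) (Icc a b) t)
    (h0 : ξ t₀ = ξ' t₀) (h1 : η t₀ = η' t₀) : EqOn ξ ξ' (Icc a b) := by
  set Λ := fun p : (V →L[ℝ] V →L[ℝ] ℝ) × (V →L[ℝ] V →L[ℝ] ℝ) => christoffelForm p.1 p.2 p.2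
  set A : ℝ → (V →L[ℝ] V →L[ℝ] ℝ) × (V →L[ℝ] V →L[ℝ] ℝ) →L[ℝ]
      (V →L[ℝ] V →L[ℝ] ℝ) × (V →L[ℝ] V →L[ℝ] ℝ) := fun t =>
    (ContinuousLinearMap.snd ℝ _ _).prod (fderiv ℝ Λ (c t, u t)) with hA
  have hcont : ContinuousOn (fun t => fderiv ℝ Λ (c t, u t)) (Icc a b) := by
    intro t ht
    have h2 : ContinuousAt (fderiv ℝ Λ) (c t, u t) :=
      ((contDiffAt_geodesicField (hinv t ht) (u t) (m := 1)).fderiv_right (m := 0)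
        (by simp)).continuousAt
    exact h2.comp_continuousWithinAt (f := fun t => (c t, u t)) ((hc t ht).prodMk (hu t ht))
  obtain ⟨C, hC⟩ := isCompact_Icc.exists_bound_of_continuousOn hcont
  -- The system is (ξ, η)' = (η, DΛ(ξ, η)): 1 bounds the projection onto η, and C bounds DΛ along
  -- the compact interval.
  set K : NNReal := max 1 (Real.toNNReal C)
  have hlip : ∀ t ∈ Icc a b, LipschitzOnWith K (A t) univ := by
    intro t ht
    refine ((A t).lipschitz.weaken ?_).lipschitzOnWith
    rw [← NNReal.coe_le_coe, coe_nnnorm, hA]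
    change ‖(ContinuousLinearMap.snd ℝ _ _).prod (fderiv ℝ Λ (c t, u t))‖ ≤ _
    rw [ContinuousLinearMap.opNorm_prod, Prod.norm_def]
    refine max_le ?_ ?_
    · exact (ContinuousLinearMap.norm_snd_le ℝ _ _).trans (by simp [K])
    · exact (hC t ht).trans ((Real.le_coe_toNNReal C).trans (by simp [K]))
  have hAlin : ∀ t ∈ Icc a b, ∀ z, A t z = (z.2, linGeodesic (c t) (u t) z.1 z.2) := by
    intro t ht z
    rw [← fderiv_geodesicField (hinv t ht)]
    rfl
  have hz : ∀ t ∈ Icc a b, HasDerivWithinAt (fun t => (ξ t, η t)) (A t (ξ t, η t)) (Icc a b) t := by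
    intro t ht
    rw [hAlin t ht]
    exact (hξ t ht).prodMk (hη t ht)
  have hz' : ∀ t ∈ Icc a b,
      HasDerivWithinAt (fun t => (ξ' t, η' t)) (A t (ξ' t, η' t)) (Icc a b) t := by
    intro t ht
    rw [hAlin t ht]
    exact (hξ' t ht).prodMk (hη' t ht)
  have hzc : ContinuousOn (fun t => (ξ t, η t)) (Icc a b) := fun t ht => (hz t ht).continuousWithinAt
  have hzc' : ContinuousOn (fun t => (ξ' t, η' t)) (Icc a b) :=
    fun t ht => (hz' t ht).continuousWithinAt
  have hr : Icc t₀ b ⊆ Icc a b := Icc_subset_Icc_left ht₀.1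
  have hl : Icc a t₀ ⊆ Icc a b := Icc_subset_Icc_right ht₀.2
  have hright : EqOn (fun t => (ξ t, η t)) (fun t => (ξ' t, η' t)) (Icc t₀ b) := by
    refine ODE_solution_unique_of_mem_Icc_right (v := fun t => A t) (s := fun _ => univ) (K := K)
      (fun t ht => hlip t (hr (Ico_subset_Icc_self ht))) (hzc.mono hr) (fun t ht => ?_)
      (fun _ _ => mem_univ _) (hzc'.mono hr) (fun t ht => ?_) (fun _ _ => mem_univ _)
      (Prod.ext h0 h1)
    · exact (hz t (hr (Ico_subset_Icc_self ht))).mono_of_mem_nhdsWithin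
        (mem_of_superset (Icc_mem_nhdsGE ht.2) (Icc_subset_Icc_left (ht₀.1.trans ht.1)))
    · exact (hz' t (hr (Ico_subset_Icc_self ht))).mono_of_mem_nhdsWithin
        (mem_of_superset (Icc_mem_nhdsGE ht.2) (Icc_subset_Icc_left (ht₀.1.trans ht.1)))
  have hleft : EqOn (fun t => (ξ t, η t)) (fun t => (ξ' t, η' t)) (Icc a t₀) := by
    refine ODE_solution_unique_of_mem_Icc_left (v := fun t => A t) (s := fun _ => univ) (K := K)
      (fun t ht => hlip t (hl (Ioc_subset_Icc_self ht))) (hzc.mono hl) (fun t ht => ?_)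
      (fun _ _ => mem_univ _) (hzc'.mono hl) (fun t ht => ?_) (fun _ _ => mem_univ _)
      (Prod.ext h0 h1)
    · exact (hz t (hl (Ioc_subset_Icc_self ht))).mono_of_mem_nhdsWithin
        (mem_of_superset (Icc_mem_nhdsLE ht.1) (Icc_subset_Icc_right (ht.2.trans ht₀.2)))
    · exact (hz' t (hl (Ioc_subset_Icc_self ht))).mono_of_mem_nhdsWithin
        (mem_of_superset (Icc_mem_nhdsLE ht.1) (Icc_subset_Icc_right (ht.2.trans ht₀.2)))
  intro t ht
  rcases le_total t₀ t with h | h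
  · exact congrArg Prod.fst (hright ⟨h, ht.2⟩)
  · exact congrArg Prod.fst (hleft ⟨ht.1, h⟩)

end LinearisedEquation

/-! ### Chart expressions of tensor fields and joint smoothness -/

section LocalRepresentatives

variable {n : ℕ} {M : Type*} [TopologicalSpace M] [ChartedSpace (EuclideanSpace ℝ (Fin n)) M]

/-- The derivative of the inverse of the preferred chart at `i`. -/
def frame (i : M) (y : EuclideanSpace ℝ (Fin n)) :
    EuclideanSpace ℝ (Fin n) →L[ℝ] EuclideanSpace ℝ (Fin n) :=
  mfderiv 𝓘(ℝ, EuclideanSpace ℝ (Fin n)) (𝓡 n) (extChartAt (𝓡 n) i).symm y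

/-- The value at `x` of a tensor field, as a bilinear form on the model space. -/
def Tensor2.at (h : Tensor2 n M) (x : M) :
    EuclideanSpace ℝ (Fin n) →L[ℝ] EuclideanSpace ℝ (Fin n) →L[ℝ] ℝ := h x

/-- The local expression of a tensor field in the preferred chart at `i`. -/
def rep (i : M) (h : Tensor2 n M) (y : EuclideanSpace ℝ (Fin n)) :
    EuclideanSpace ℝ (Fin n) →L[ℝ] EuclideanSpace ℝ (Fin n) →L[ℝ] ℝ :=
  pull (frame i y) (Tensor2.at h ((extChartAt (𝓡 n) i).symm y))

variable [IsManifold (𝓡 n) ∞ M]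

theorem exists_equiv_frame (i : M) {y : EuclideanSpace ℝ (Fin n)}
    (hy : y ∈ (extChartAt (𝓡 n) i).target) :
    ∃ L : EuclideanSpace ℝ (Fin n) ≃L[ℝ] EuclideanSpace ℝ (Fin n),
      (L : EuclideanSpace ℝ (Fin n) →L[ℝ] EuclideanSpace ℝ (Fin n)) = frame i y := by
  have : IsManifold (𝓡 n) 1 M := IsManifold.of_le (n := ∞) ENat.LEInfty.out
  have h := isInvertible_mfderivWithin_extChartAt_symm (I := 𝓡 n) hy
  rw [modelWithCornersSelf_coe, range_id, mfderivWithin_univ] at h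
  exact h

/-- The trivialisation of the bundle of bilinear forms is transport by the coordinate frame, so
smoothness of a section can be read off from `rep`. -/
theorem trivializationAt_snd_eq_pull (i : M) {x : M}
    (hx : x ∈ (chartAt (EuclideanSpace ℝ (Fin n)) i).source)
    (h : TangentSpace (𝓡 n) x →L[ℝ] TangentSpace (𝓡 n) x →L[ℝ] ℝ) :
    (trivializationAt (EuclideanSpace ℝ (Fin n) →L[ℝ] EuclideanSpace ℝ (Fin n) →L[ℝ] ℝ)
      (fun x : M => TangentSpace (𝓡 n) x →L[ℝ] TangentSpace (𝓡 n) x →L[ℝ] ℝ) i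
      (TotalSpace.mk' (EuclideanSpace ℝ (Fin n) →L[ℝ] EuclideanSpace ℝ (Fin n) →L[ℝ] ℝ) x h)).2 =
    pull (frame i (extChartAt (𝓡 n) i x)) h := by
  have : IsManifold (𝓡 n) 1 M := IsManifold.of_le (n := ∞) ENat.LEInfty.out
  have h1 : (trivializationAt (EuclideanSpace ℝ (Fin n)) (TangentSpace (𝓡 n)) i).symmL ℝ x =
      frame i (extChartAt (𝓡 n) i x) := by
    rw [TangentBundle.symmL_trivializationAt hx, frame]
    simp only [modelWithCornersSelf_coe, range_id, mfderivWithin_univ]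
    rfl
  rw [hom_trivializationAt_apply]
  ext v w
  rw [← h1]
  simp [hom_trivializationAt_apply, ContinuousLinearMap.inCoordinates, hx]
  rfl

theorem trivializationAt_snd_eq_rep (i : M) {x : M}
    (hx : x ∈ (chartAt (EuclideanSpace ℝ (Fin n)) i).source) (h : Tensor2 n M) :
    (trivializationAt (EuclideanSpace ℝ (Fin n) →L[ℝ] EuclideanSpace ℝ (Fin n) →L[ℝ] ℝ)
      (fun x : M => TangentSpace (𝓡 n) x →L[ℝ] TangentSpace (𝓡 n) x →L[ℝ] ℝ) i
      (TotalSpace.mk' (EuclideanSpace ℝ (Fin n) →L[ℝ] EuclideanSpace ℝ (Fin n) →L[ℝ] ℝ)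
        x (h x))).2 = rep i h (extChartAt (𝓡 n) i x) := by
  rw [trivializationAt_snd_eq_pull i hx, rep,
    (extChartAt (𝓡 n) i).left_inv (by rwa [extChartAt_source])]
  rfl

theorem mem_source_hom (i : M) {x : M}
    (hx : x ∈ (chartAt (EuclideanSpace ℝ (Fin n)) i).source)
    (h : TangentSpace (𝓡 n) x →L[ℝ] TangentSpace (𝓡 n) x →L[ℝ] ℝ) :
    TotalSpace.mk' (EuclideanSpace ℝ (Fin n) →L[ℝ] EuclideanSpace ℝ (Fin n) →L[ℝ] ℝ)
      (E := fun x : M => TangentSpace (𝓡 n) x →L[ℝ] TangentSpace (𝓡 n) x →L[ℝ] ℝ) x h ∈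
    (trivializationAt (EuclideanSpace ℝ (Fin n) →L[ℝ] EuclideanSpace ℝ (Fin n) →L[ℝ] ℝ)
      (fun x : M => TangentSpace (𝓡 n) x →L[ℝ] TangentSpace (𝓡 n) x →L[ℝ] ℝ) i).source := by
  rw [Trivialization.mem_source]
  simp [hom_trivializationAt_baseSet, hx]

variable {P : Type*} [NormedAddCommGroup P] [NormedSpace ℝ P]

/-- A family of tensor fields is smooth if and only if its local expressions are. -/
theorem isSmoothFamilyOn_iff {S : Set P} {σ : P → Tensor2 n M} :
    IsSmoothFamilyOn S σ ↔ ∀ i : M, ContDiffOn ℝ ∞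
      (fun q : P × EuclideanSpace ℝ (Fin n) => rep i (σ q.1) q.2)
      (S ×ˢ (extChartAt (𝓡 n) i).target) := by
  constructor
  · intro h i
    have hchart : ContMDiffOn 𝓘(ℝ, P × EuclideanSpace ℝ (Fin n)) (𝓘(ℝ, P).prod (𝓡 n)) ∞
        (fun q : P × EuclideanSpace ℝ (Fin n) => (q.1, (extChartAt (𝓡 n) i).symm q.2))
        (S ×ˢ (extChartAt (𝓡 n) i).target) :=
      (contDiff_fst.contMDiff.contMDiffOn).prodMk
        ((contMDiffOn_extChartAt_symm i).comp contDiff_snd.contMDiff.contMDiffOn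
          fun q hq => hq.2)
    have hmaps : MapsTo (fun q : P × EuclideanSpace ℝ (Fin n) =>
        (q.1, (extChartAt (𝓡 n) i).symm q.2)) (S ×ˢ (extChartAt (𝓡 n) i).target)
        (S ×ˢ (univ : Set M)) := fun q hq => ⟨hq.1, mem_univ _⟩
    have hsrc : ∀ q ∈ S ×ˢ (extChartAt (𝓡 n) i).target,
        (extChartAt (𝓡 n) i).symm q.2 ∈ (chartAt (EuclideanSpace ℝ (Fin n)) i).source := by
      intro q hq
      have := (extChartAt (𝓡 n) i).map_target hq.2
      rwa [extChartAt_source] at this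
    have h1 := ContMDiffOn.comp h hchart hmaps
    have h2 := (Bundle.Trivialization.contMDiffOn_iff (e := trivializationAt
      (EuclideanSpace ℝ (Fin n) →L[ℝ] EuclideanSpace ℝ (Fin n) →L[ℝ] ℝ)
      (fun x : M => TangentSpace (𝓡 n) x →L[ℝ] TangentSpace (𝓡 n) x →L[ℝ] ℝ) i)
      (fun q hq => mem_source_hom i (hsrc q hq) _)).1 h1
    rw [← contMDiffOn_iff_contDiffOn]
    refine h2.2.congr fun q hq => ?_
    refine Eq.trans ?_ (trivializationAt_snd_eq_rep i (hsrc q hq) (σ q.1)).symm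
    rw [(extChartAt (𝓡 n) i).right_inv hq.2]
  · intro h p hp
    have hx : p.2 ∈ (chartAt (EuclideanSpace ℝ (Fin n)) p.2).source := mem_chart_source _ _
    have hx' : p.2 ∈ (extChartAt (𝓡 n) p.2).source := mem_extChartAt_source p.2
    refine (Bundle.Trivialization.contMDiffWithinAt_iff (e := trivializationAt
      (EuclideanSpace ℝ (Fin n) →L[ℝ] EuclideanSpace ℝ (Fin n) →L[ℝ] ℝ)
      (fun x : M => TangentSpace (𝓡 n) x →L[ℝ] TangentSpace (𝓡 n) x →L[ℝ] ℝ) p.2)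
      (f := fun p : P × M => TotalSpace.mk'
        (EuclideanSpace ℝ (Fin n) →L[ℝ] EuclideanSpace ℝ (Fin n) →L[ℝ] ℝ)
        (E := fun x : M => TangentSpace (𝓡 n) x →L[ℝ] TangentSpace (𝓡 n) x →L[ℝ] ℝ)
        p.2 (σ p.1 p.2)) (x₀ := p) (mem_source_hom p.2 hx _)).2 ⟨contMDiffWithinAt_snd, ?_⟩
    have hchart : ContMDiffAt (𝓘(ℝ, P).prod (𝓡 n)) 𝓘(ℝ, P × EuclideanSpace ℝ (Fin n)) ∞
        (fun q : P × M => (q.1, extChartAt (𝓡 n) p.2 q.2)) p :=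
      ContMDiffAt.prodMk_space contMDiffAt_fst
        (ContMDiffAt.comp p (contMDiffAt_extChartAt' hx) contMDiffAt_snd)
    have hopen : (chartAt (EuclideanSpace ℝ (Fin n)) p.2).source ∈ 𝓝 p.2 :=
      chart_source_mem_nhds _ _
    have hnhds : ∀ᶠ q : P × M in 𝓝 p, q.2 ∈ (chartAt (EuclideanSpace ℝ (Fin n)) p.2).source :=
      continuousAt_snd.eventually hopen
    have h1 := (h p.2 (p.1, extChartAt (𝓡 n) p.2 p.2)
      ⟨hp.1, mem_extChartAt_target p.2⟩).contMDiffWithinAt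
    have hmem : {q : P × M | (q.1, extChartAt (𝓡 n) p.2 q.2) ∈
        S ×ˢ (extChartAt (𝓡 n) p.2).target} ∈ 𝓝[S ×ˢ (univ : Set M)] p := by
      filter_upwards [self_mem_nhdsWithin, mem_nhdsWithin_of_mem_nhds hnhds] with q hq hq2
      refine ⟨hq.1, (extChartAt (𝓡 n) p.2).map_source ?_⟩
      rwa [extChartAt_source]
    have h2 := (ContMDiffWithinAt.comp' p h1
      (hchart.contMDiffWithinAt (s := S ×ˢ (univ : Set M)))).mono_of_mem_nhdsWithin
        (inter_mem self_mem_nhdsWithin hmem)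
    refine h2.congr_of_eventuallyEq ?_ (trivializationAt_snd_eq_rep p.2 hx (σ p.1))
    filter_upwards [mem_nhdsWithin_of_mem_nhds hnhds] with q hq
    exact trivializationAt_snd_eq_rep p.2 hq (σ q.1)

/-- Bilinear forms on the model space. -/
abbrev Form (n : ℕ) : Type := EuclideanSpace ℝ (Fin n) →L[ℝ] EuclideanSpace ℝ (Fin n) →L[ℝ] ℝ

/-- The tensor field with given values. -/
def tensorOf (f : M → Form n) : Tensor2 n M := f

theorem tensorOf_at (f : M → Form n) (x : M) : (tensorOf f).at x = f x := rfl

theorem exists_equiv_rep (i : M) {y : EuclideanSpace ℝ (Fin n)}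
    (hy : y ∈ (extChartAt (𝓡 n) i).target) :
    ∃ L : EuclideanSpace ℝ (Fin n) ≃L[ℝ] EuclideanSpace ℝ (Fin n), ∀ h : Tensor2 n M,
      rep i h y = pull (L : EuclideanSpace ℝ (Fin n) →L[ℝ] EuclideanSpace ℝ (Fin n))
        (h.at ((extChartAt (𝓡 n) i).symm y)) := by
  obtain ⟨L, hL⟩ := exists_equiv_frame i hy
  exact ⟨L, fun h => by rw [hL, rep]⟩

theorem exists_equiv_rep_self (x : M) :
    ∃ L : EuclideanSpace ℝ (Fin n) ≃L[ℝ] EuclideanSpace ℝ (Fin n), ∀ h : Tensor2 n M,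
      rep x h (extChartAt (𝓡 n) x x) =
        pull (L : EuclideanSpace ℝ (Fin n) →L[ℝ] EuclideanSpace ℝ (Fin n)) (h.at x) := by
  obtain ⟨L, hL⟩ := exists_equiv_rep x (mem_extChartAt_target (I := 𝓡 n) x)
  refine ⟨L, fun h => ?_⟩
  rw [hL, extChartAt_to_inv]

/-- The pullback of bilinear forms as a continuous linear map. -/
def pullCLM (L : EuclideanSpace ℝ (Fin n) →L[ℝ] EuclideanSpace ℝ (Fin n)) : Form n →L[ℝ] Form n :=
  LinearMap.toContinuousLinearMap
    { toFun := pull L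
      map_add' := pull_add L
      map_smul' := pull_smul L }

theorem pullCLM_apply (L : EuclideanSpace ℝ (Fin n) →L[ℝ] EuclideanSpace ℝ (Fin n)) (h : Form n) :
    pullCLM L h = pull L h := rfl

/-- At a fixed point of M the coordinate frame is one fixed isomorphism, so the value in the fibre
is a fixed linear image of the chart expression. -/
theorem IsSmoothFamilyOn.contDiffOn_at {S : Set P} {σ : P → Tensor2 n M}
    (h : IsSmoothFamilyOn S σ) (x : M) : ContDiffOn ℝ ∞ (fun p => (σ p).at x) S := by
  obtain ⟨L, hL⟩ := exists_equiv_rep_self (n := n) x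
  have h1 : ContDiffOn ℝ ∞ (fun p => rep x (σ p) (extChartAt (𝓡 n) x x)) S :=
    (isSmoothFamilyOn_iff.1 h x).comp (f := fun p => (p, extChartAt (𝓡 n) x x))
      (contDiff_id.prodMk contDiff_const).contDiffOn
      fun p hp => ⟨hp, mem_extChartAt_target x⟩
  have h2 := (pullCLM (n := n) L.symm).contDiff.comp_contDiffOn h1
  refine h2.congr fun p _ => ?_
  rw [Function.comp_apply, hL, pullCLM_apply, pull_pull_symm]

theorem IsSmoothFamilyOn.congr {S : Set P} {σ τ : P → Tensor2 n M} (h : IsSmoothFamilyOn S σ)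
    (hS : ∀ p ∈ S, τ p = σ p) : IsSmoothFamilyOn S τ :=
  ContMDiffOn.congr h fun p hp => by rw [hS p.1 hp.1]

theorem IsSmoothFamilyOn.comp {Q : Type*} [NormedAddCommGroup Q] [NormedSpace ℝ Q] {S : Set P}
    {σ : P → Tensor2 n M} (h : IsSmoothFamilyOn S σ) {T : Set Q} {f : Q → P}
    (hf : ContDiffOn ℝ ∞ f T) (hm : MapsTo f T S) : IsSmoothFamilyOn T (fun q => σ (f q)) := by
  rw [isSmoothFamilyOn_iff] at h ⊢
  intro i
  exact (h i).comp (f := fun q : Q × EuclideanSpace ℝ (Fin n) => (f q.1, q.2))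
    ((hf.comp contDiff_fst.contDiffOn fun q hq => hq.1).prodMk contDiff_snd.contDiffOn)
    fun q hq => ⟨hm hq.1, hq.2⟩

/-- A tensor field is smooth. -/
def IsSmoothTensor (h : Tensor2 n M) : Prop :=
  ContMDiff (𝓡 n)
    ((𝓡 n).prod 𝓘(ℝ, EuclideanSpace ℝ (Fin n) →L[ℝ] EuclideanSpace ℝ (Fin n) →L[ℝ] ℝ)) ∞
    (fun x : M => TotalSpace.mk'
      (EuclideanSpace ℝ (Fin n) →L[ℝ] EuclideanSpace ℝ (Fin n) →L[ℝ] ℝ)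
      (E := fun x : M => TangentSpace (𝓡 n) x →L[ℝ] TangentSpace (𝓡 n) x →L[ℝ] ℝ)
      x (h x))

theorem IsSmoothTensor.isSmoothFamilyOn {h : Tensor2 n M} (hh : IsSmoothTensor h) (S : Set P) :
    IsSmoothFamilyOn S (fun _ => h) :=
  ContMDiff.contMDiffOn (ContMDiff.comp hh contMDiff_snd)

theorem IsSmoothFamilyOn.isSmoothTensor {S : Set P} {σ : P → Tensor2 n M}
    (h : IsSmoothFamilyOn S σ) {p : P} (hp : p ∈ S) : IsSmoothTensor (σ p) := by
  have h1 : ContMDiffOn (𝓡 n) (𝓘(ℝ, P).prod (𝓡 n)) ∞ (fun x : M => (p, x)) univ :=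
    (contMDiff_const.prodMk contMDiff_id).contMDiffOn
  exact contMDiffOn_univ.1 (ContMDiffOn.comp h h1 fun x _ => ⟨hp, mem_univ _⟩)

theorem IsSmoothFamilyOn.add {S : Set P} {σ τ : P → Tensor2 n M} (hσ : IsSmoothFamilyOn S σ)
    (hτ : IsSmoothFamilyOn S τ) : IsSmoothFamilyOn S (fun p => σ p + τ p) := by
  rw [isSmoothFamilyOn_iff] at hσ hτ ⊢
  exact fun i => (hσ i).add (hτ i)

theorem IsSmoothFamilyOn.smul {S : Set P} {f : P → ℝ} {σ : P → Tensor2 n M}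
    (hf : ContDiffOn ℝ ∞ f S) (hσ : IsSmoothFamilyOn S σ) :
    IsSmoothFamilyOn S (fun p => f p • σ p) := by
  rw [isSmoothFamilyOn_iff] at hσ ⊢
  exact fun i => (hf.comp contDiff_fst.contDiffOn fun q hq => hq.1).smul (hσ i)

theorem IsSmoothFamilyOn.christoffel {S : Set P} {g h k : P → Tensor2 n M}
    (hg : IsSmoothFamilyOn S g) (hpos : ∀ p ∈ S, ∀ x, IsPos ((g p).at x))
    (hh : IsSmoothFamilyOn S h) (hk : IsSmoothFamilyOn S k) :
    IsSmoothFamilyOn S (fun p => christoffel (g p) (h p) (k p)) := by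
  rw [isSmoothFamilyOn_iff] at hg hh hk ⊢
  intro i q hq
  have heq : ∀ q ∈ S ×ˢ (extChartAt (𝓡 n) i).target,
      rep i (MetricManifold.christoffel (g q.1) (h q.1) (k q.1)) q.2 =
        christoffelForm (rep i (g q.1) q.2) (rep i (h q.1) q.2) (rep i (k q.1) q.2) := by
    intro q hq
    obtain ⟨L, hL⟩ := exists_equiv_rep i hq.2
    rw [hL, hL, hL, hL, christoffelForm_pull (hpos q.1 hq.1 _)]
    rfl
  refine ContDiffWithinAt.congr ?_ heq (heq q hq)
  have hinv : (rep i (g q.1) q.2).IsInvertible := by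
    obtain ⟨L, hL⟩ := exists_equiv_rep i hq.2
    rw [hL]
    exact ((hpos q.1 hq.1 _).pull L).isInvertible
  exact (contDiffAt_christoffelForm hinv _ _).comp_contDiffWithinAt
    (f := fun q : P × EuclideanSpace ℝ (Fin n) =>
      (rep i (g q.1) q.2, rep i (h q.1) q.2, rep i (k q.1) q.2)) q
    ((hg i q hq).prodMk ((hh i q hq).prodMk (hk i q hq)))

theorem IsSmoothFamilyOn.geoFlow {S : Set P} {τ : P → ℝ} {g h : P → Tensor2 n M}
    (hτ : ContDiffOn ℝ ∞ τ S) (hg : IsSmoothFamilyOn S g) (hh : IsSmoothFamilyOn S h)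
    (hdom : ∀ p ∈ S, ∀ x, (τ p, (g p).at x, (h p).at x) ∈ geoDomain (EuclideanSpace ℝ (Fin n))) :
    IsSmoothFamilyOn S (fun p => tensorOf fun x => geoFlow (τ p) ((g p).at x) ((h p).at x)) := by
  rw [isSmoothFamilyOn_iff] at hg hh ⊢
  intro i
  have hd : ∀ q ∈ S ×ˢ (extChartAt (𝓡 n) i).target,
      (τ q.1, rep i (g q.1) q.2, rep i (h q.1) q.2) ∈ geoDomain (EuclideanSpace ℝ (Fin n)) := by
    intro q hq
    obtain ⟨L, hL⟩ := exists_equiv_rep i hq.2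
    rw [hL, hL]
    exact geoDomain_pull (hdom q.1 hq.1 _) L
  refine ((contDiffOn_geoFlow (V := EuclideanSpace ℝ (Fin n))).comp
    (f := fun q : P × EuclideanSpace ℝ (Fin n) => (τ q.1, rep i (g q.1) q.2, rep i (h q.1) q.2))
    ((hτ.comp contDiff_fst.contDiffOn fun q hq => hq.1).prodMk ((hg i).prodMk (hh i))) hd).congr ?_
  intro q hq
  obtain ⟨L, hL⟩ := exists_equiv_rep i hq.2
  rw [Function.comp_apply]
  simp only [hL]
  rw [geoFlow_pull _ (hdom q.1 hq.1 _).1]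
  rfl

/-- The derivative of `geoFlow` in the direction `(k, l)` of the initial values. -/
def geoVar (t : ℝ) (g h k l : Form n) : Form n :=
  deriv (fun s : ℝ => geoFlow t (g + s • k) (h + s • l)) 0

theorem hasDerivAt_line {F : Type*} [NormedAddCommGroup F] [NormedSpace ℝ F] (a b : F) (s : ℝ) :
    HasDerivAt (fun s : ℝ => a + s • b) b s := by
  simpa using ((hasDerivAt_id s).smul_const b).const_add a

theorem hasDerivAt_geoFlow_line {t : ℝ} {g h : Form n}
    (hx : (t, g, h) ∈ geoDomain (EuclideanSpace ℝ (Fin n))) (k l : Form n) :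
    HasDerivAt (fun s : ℝ => geoFlow t (g + s • k) (h + s • l))
      (fderiv ℝ (fun x : ℝ × Form n × Form n => geoFlow x.1 x.2.1 x.2.2) (t, g, h) (0, k, l)) 0 := by
  have hD : HasFDerivAt (fun x : ℝ × Form n × Form n => geoFlow x.1 x.2.1 x.2.2)
      (fderiv ℝ (fun x : ℝ × Form n × Form n => geoFlow x.1 x.2.1 x.2.2) (t, g, h))
      (t, g + (0 : ℝ) • k, h + (0 : ℝ) • l) := by
    rw [zero_smul, zero_smul, add_zero, add_zero]
    exact ((contDiffOn_geoFlow.contDiffAt (isOpen_geoDomain.mem_nhds hx)).differentiableAt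
      (by simp)).hasFDerivAt
  exact hD.comp_hasDerivAt (f := fun s : ℝ => (t, g + s • k, h + s • l)) 0
    ((hasDerivAt_const _ _).prodMk ((hasDerivAt_line g k 0).prodMk (hasDerivAt_line h l 0)))

theorem geoVar_eq_fderiv {t : ℝ} {g h : Form n}
    (hx : (t, g, h) ∈ geoDomain (EuclideanSpace ℝ (Fin n))) (k l : Form n) :
    geoVar t g h k l =
      fderiv ℝ (fun x : ℝ × Form n × Form n => geoFlow x.1 x.2.1 x.2.2) (t, g, h) (0, k, l) :=
  (hasDerivAt_geoFlow_line hx k l).deriv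

theorem hasDerivAt_geoVar {t : ℝ} {g h : Form n}
    (hx : (t, g, h) ∈ geoDomain (EuclideanSpace ℝ (Fin n))) (k l : Form n) :
    HasDerivAt (fun s : ℝ => geoFlow t (g + s • k) (h + s • l)) (geoVar t g h k l) 0 := by
  rw [geoVar_eq_fderiv hx]
  exact hasDerivAt_geoFlow_line hx k l

theorem eventually_isPos_line {g : Form n} (hg : IsPos g) (k : Form n) :
    ∀ᶠ s : ℝ in 𝓝 0, IsPos (g + s • k) := by
  have h1 : ContinuousAt (fun s : ℝ => g + s • k) 0 := (hasDerivAt_line g k 0).continuousAt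
  refine h1.eventually (isOpen_isPos.mem_nhds ?_)
  simpa using hg

/-- The s-derivative of `geoFlow_pull`; the positivity it requires holds along the line for small s.
-/
theorem geoVar_pull {t : ℝ} {g h : Form n}
    (hx : (t, g, h) ∈ geoDomain (EuclideanSpace ℝ (Fin n))) (k l : Form n)
    (L : EuclideanSpace ℝ (Fin n) ≃L[ℝ] EuclideanSpace ℝ (Fin n)) :
    geoVar t (pull (L : EuclideanSpace ℝ (Fin n) →L[ℝ] EuclideanSpace ℝ (Fin n)) g)
      (pull (L : EuclideanSpace ℝ (Fin n) →L[ℝ] EuclideanSpace ℝ (Fin n)) h)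
      (pull (L : EuclideanSpace ℝ (Fin n) →L[ℝ] EuclideanSpace ℝ (Fin n)) k)
      (pull (L : EuclideanSpace ℝ (Fin n) →L[ℝ] EuclideanSpace ℝ (Fin n)) l) =
    pull (L : EuclideanSpace ℝ (Fin n) →L[ℝ] EuclideanSpace ℝ (Fin n)) (geoVar t g h k l) := by
  have h1 := (pullCLM (L : EuclideanSpace ℝ (Fin n) →L[ℝ]
    EuclideanSpace ℝ (Fin n))).hasFDerivAt.comp_hasDerivAt 0 (hasDerivAt_geoVar hx k l)
  refine HasDerivAt.deriv (h1.congr_of_eventuallyEq ?_)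
  filter_upwards [eventually_isPos_line hx.1 k] with s hs
  exact geoFlow_pull t hs L (h + s • l)

theorem IsSmoothFamilyOn.geoVar {S : Set P} {τ : P → ℝ} {g h k l : P → Tensor2 n M}
    (hτ : ContDiffOn ℝ ∞ τ S) (hg : IsSmoothFamilyOn S g) (hh : IsSmoothFamilyOn S h)
    (hk : IsSmoothFamilyOn S k) (hl : IsSmoothFamilyOn S l)
    (hdom : ∀ p ∈ S, ∀ x, (τ p, (g p).at x, (h p).at x) ∈ geoDomain (EuclideanSpace ℝ (Fin n))) :
    IsSmoothFamilyOn S (fun p => tensorOf fun x =>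
      geoVar (τ p) ((g p).at x) ((h p).at x) ((k p).at x) ((l p).at x)) := by
  rw [isSmoothFamilyOn_iff] at hg hh hk hl ⊢
  intro i
  have hd : ∀ q ∈ S ×ˢ (extChartAt (𝓡 n) i).target,
      (τ q.1, rep i (g q.1) q.2, rep i (h q.1) q.2) ∈ geoDomain (EuclideanSpace ℝ (Fin n)) := by
    intro q hq
    obtain ⟨L, hL⟩ := exists_equiv_rep i hq.2
    rw [hL, hL]
    exact geoDomain_pull (hdom q.1 hq.1 _) L
  have hF : ContDiffOn ℝ ∞
      (fderiv ℝ (fun x : ℝ × Form n × Form n => MetricManifold.geoFlow x.1 x.2.1 x.2.2))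
      (geoDomain (EuclideanSpace ℝ (Fin n))) :=
    contDiffOn_geoFlow.fderiv_of_isOpen isOpen_geoDomain (by simp)
  refine ((hF.comp
    (f := fun q : P × EuclideanSpace ℝ (Fin n) => (τ q.1, rep i (g q.1) q.2, rep i (h q.1) q.2))
    ((hτ.comp contDiff_fst.contDiffOn fun q hq => hq.1).prodMk
      ((hg i).prodMk (hh i))) hd).clm_apply
    (contDiffOn_const (c := (0 : ℝ)).prodMk ((hk i).prodMk (hl i)))).congr ?_
  intro q hq
  rw [Function.comp_apply, ← geoVar_eq_fderiv (hd q hq)]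
  obtain ⟨L, hL⟩ := exists_equiv_rep i hq.2
  simp only [hL]
  rw [geoVar_pull (hdom q.1 hq.1 _)]
  rfl

theorem IsSmoothFamilyOn.hasDerivWithinAt {J : Set ℝ} {c : ℝ → Tensor2 n M}
    (hc : IsSmoothFamilyOn J c) {t : ℝ} (ht : t ∈ J) (x : M) :
    HasDerivWithinAt (fun τ => (c τ).at x) ((velocity J c t).at x) J t :=
  ((hc.contDiffOn_at x).differentiableOn (by simp) t ht).hasDerivWithinAt

theorem velocity_eq {J : Set ℝ} {c : ℝ → Tensor2 n M} {t : ℝ} (hJ : UniqueDiffWithinAt ℝ J t)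
    {v : Tensor2 n M} (h : ∀ x, HasDerivWithinAt (fun τ => (c τ).at x) (v.at x) J t) :
    velocity J c t = v :=
  funext fun x => (h x).derivWithin hJ

/-- In a chart the velocity is the derivative of the joint expression in direction (1, 0). Unique
differentiability of J times the chart domain covers the endpoints of J. -/
theorem IsSmoothFamilyOn.velocity {J : Set ℝ} (hJ : UniqueDiffOn ℝ J) {c : ℝ → Tensor2 n M}
    (hc : IsSmoothFamilyOn J c) : IsSmoothFamilyOn J (velocity J c) := by
  rw [isSmoothFamilyOn_iff]
  intro i
  have h1 := isSmoothFamilyOn_iff.1 hc i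
  have hopen : IsOpen (extChartAt (𝓡 n) i).target := isOpen_extChartAt_target i
  have hu : UniqueDiffOn ℝ (J ×ˢ (extChartAt (𝓡 n) i).target) := hJ.prod hopen.uniqueDiffOn
  refine ((h1.fderivWithin (m := ∞) hu (by simp)).clm_apply
    (contDiffOn_const (c := ((1 : ℝ), (0 : EuclideanSpace ℝ (Fin n)))))).congr ?_
  intro q hq
  have h2 := (h1.differentiableOn (by simp) q hq).hasFDerivWithinAt
  have h3 := h2.comp_hasDerivWithinAt (f := fun τ => (τ, q.2)) q.1
    ((hasDerivWithinAt_id q.1 J).prodMk (hasDerivWithinAt_const q.1 J q.2))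
    fun τ hτ => ⟨hτ, hq.2⟩
  have h4 := (pullCLM (frame i q.2)).hasFDerivAt.comp_hasDerivWithinAt q.1
    (hc.hasDerivWithinAt hq.1 ((extChartAt (𝓡 n) i).symm q.2))
  exact (hJ q.1 hq.1).eq_deriv _ h4 h3

/-- Boundedness of the unit ball is part of the structure of a Riemannian metric. It follows from
g(v, v) ≥ c|v|², where c is the minimum on the unit sphere. -/
theorem isVonNBounded_of_isPos {g : Form n} (hg : IsPos g) :
    Bornology.IsVonNBounded ℝ {v : EuclideanSpace ℝ (Fin n) | g v v < 1} := by
  rw [NormedSpace.isVonNBounded_iff]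
  have hK : IsCompact (Metric.sphere (0 : EuclideanSpace ℝ (Fin n)) 1) := isCompact_sphere 0 1
  have hcont : Continuous fun v => g v v := by fun_prop
  rcases (Metric.sphere (0 : EuclideanSpace ℝ (Fin n)) 1).eq_empty_or_nonempty with he | hne
  -- An empty unit sphere forces the space to be a point (n = 0).
  · refine (Bornology.isBounded_singleton (x := (0 : EuclideanSpace ℝ (Fin n)))).subset fun v _ => ?_
    by_contra hv
    have hv' : v ≠ 0 := hv
    have : ‖v‖⁻¹ • v ∈ Metric.sphere (0 : EuclideanSpace ℝ (Fin n)) 1 := by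
      simp [norm_smul, norm_ne_zero_iff.2 hv']
    rw [he] at this
    exact this
  · obtain ⟨v₀, hv₀, hmin⟩ := hK.exists_isMinOn hne hcont.continuousOn
    have hv₀0 : v₀ ≠ 0 := by
      rintro rfl
      simp at hv₀
    have hc : 0 < g v₀ v₀ := hg v₀ hv₀0
    refine (Metric.isBounded_iff_subset_closedBall 0).2 ⟨Real.sqrt ((g v₀ v₀)⁻¹), fun v hv => ?_⟩
    rw [mem_closedBall_zero_iff]
    refine Real.le_sqrt_of_sq_le ?_
    rcases eq_or_ne v 0 with rfl | hv0
    · simpa using hc.le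
    · have hn : 0 < ‖v‖ := norm_pos_iff.2 hv0
      have h1 : g v₀ v₀ ≤ g (‖v‖⁻¹ • v) (‖v‖⁻¹ • v) :=
        hmin (a := ‖v‖⁻¹ • v) (by simp [norm_smul, hn.ne'])
      simp only [map_smul, smul_apply, smul_eq_mul] at h1
      have h2 : g v₀ v₀ * ‖v‖ ^ 2 ≤ g v v := by
        calc g v₀ v₀ * ‖v‖ ^ 2 ≤ ‖v‖⁻¹ * (‖v‖⁻¹ * g v v) * ‖v‖ ^ 2 := by gcongr
          _ = g v v := by field_simp
      rw [← one_div, le_div_iff₀ hc, mul_comm]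
      exact h2.trans (le_of_lt hv)

/-- A smooth field of positive definite symmetric forms is a Riemannian metric. -/
def metOfTensor (h : Tensor2 n M) (hs : ∀ x v w, h.at x v w = h.at x w v)
    (hp : ∀ x, IsPos (h.at x)) (hh : IsSmoothTensor h) : Met n M where
  inner := h
  symm := hs
  pos x := hp x
  isVonNBounded x := isVonNBounded_of_isPos (hp x)
  contMDiff := hh

/-- The metric as a tensor field. -/
def Met.tensor (g : Met n M) : Tensor2 n M := g.inner

theorem Met.isPos (g : Met n M) (x : M) : IsPos (g.tensor.at x) := g.pos x

theorem Met.at_comm (g : Met n M) (x : M) (v w : EuclideanSpace ℝ (Fin n)) :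
    g.tensor.at x v w = g.tensor.at x w v := g.symm x v w

theorem Met.isSmoothTensor (g : Met n M) : IsSmoothTensor g.tensor := g.contMDiff

theorem TestTensor.at_comm (h : TestTensor n M) (x : M) (v w : EuclideanSpace ℝ (Fin n)) :
    h.toFun.at x v w = h.toFun.at x w v := h.symm x v w

theorem TestTensor.isSmoothTensor (h : TestTensor n M) : IsSmoothTensor h.toFun := h.contMDiff

end LocalRepresentatives

/-! ### Geodesics on M and uniform existence of nearby geodesics -/

section GeodesicVariations

variable {n : ℕ} {M : Type*} [TopologicalSpace M] [ChartedSpace (EuclideanSpace ℝ (Fin n)) M]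
  [IsManifold (𝓡 n) ∞ M]

theorem Met.ext_tensor {g g' : Met n M} (h : g.tensor = g'.tensor) : g = g' := by
  cases g
  cases g'
  simp only [Met.tensor] at h
  subst h
  rfl

theorem uniqueDiffOn_of_ordConnected {J : Set ℝ} (hJ : J.OrdConnected) (hnt : J.Nontrivial) :
    UniqueDiffOn ℝ J := by
  refine uniqueDiffOn_convex hJ.convex ?_
  obtain ⟨x, hx, y, hy, hxy⟩ := hnt.exists_lt
  obtain ⟨z, hz⟩ := nonempty_Ioo.2 hxy
  exact ⟨z, interior_maximal (Ioo_subset_Icc_self.trans (hJ.out hx hy)) isOpen_Ioo hz⟩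

theorem exists_testTensor {h : Tensor2 n M} (hs : ∀ x v w, h.at x v w = h.at x w v)
    (hh : IsSmoothTensor h) {K : Set M} (hK : IsCompact K) (h0 : ∀ x ∉ K, h.at x = 0) :
    ∃ m : TestTensor n M, m.toFun = h :=
  ⟨⟨h, hs, hh, K, hK, h0⟩, rfl⟩

theorem TestTensor.exists_support (h : TestTensor n M) :
    ∃ K : Set M, IsCompact K ∧ ∀ x ∉ K, h.toFun.at x = 0 := h.compactSupport

/-- The forms h g⁻¹ k and k g⁻¹ h are transposes of each other, so their sum is symmetric; the
remaining terms are multiples of g, h and k. -/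
theorem christoffelForm_apply_comm {g h k : Form n} (hg : IsPos g) (hgs : ∀ v w, g v w = g w v)
    (hhs : ∀ v w, h v w = h w v) (hks : ∀ v w, k v w = k w v) (v w : EuclideanSpace ℝ (Fin n)) :
    christoffelForm g h k v w = christoffelForm g h k w v := by
  have hr : ∀ (f : Form n) v, g (raise g f v) = f v := fun f v =>
    congr($(comp_raise hg.isInvertible f) v)
  have key : ∀ v w, h (raise g k v) w = k (raise g h w) v := by
    intro v w
    rw [hhs, ← hr h w, hgs, hr k v, hks]
  simp only [christoffelForm, add_apply, sub_apply, smul_apply,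
    ContinuousLinearMap.comp_apply, smul_eq_mul, key, hgs v w, hhs v w, hks v w]
  ring

theorem exists_christoffel_testTensor (g : Met n M) (h k : TestTensor n M) :
    ∃ m : TestTensor n M, m.toFun = christoffel g.tensor h.toFun k.toFun := by
  obtain ⟨K, hK, h0⟩ := h.exists_support
  refine exists_testTensor (fun x => christoffelForm_apply_comm (g.isPos x) (g.at_comm x)
    (h.at_comm x) (k.at_comm x)) ?_ hK fun x hx => ?_
  · exact (IsSmoothFamilyOn.christoffel (g.isSmoothTensor.isSmoothFamilyOn (univ : Set ℝ))
      (fun _ _ => g.isPos) (h.isSmoothTensor.isSmoothFamilyOn _)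
      (k.isSmoothTensor.isSmoothFamilyOn _)).isSmoothTensor (mem_univ (0 : ℝ))
  · change christoffelForm (g.tensor.at x) (h.toFun.at x) (k.toFun.at x) = 0
    rw [h0 x hx, christoffelForm_zero_left]

theorem exists_add_testTensor (h k : TestTensor n M) :
    ∃ m : TestTensor n M, m.toFun = h.toFun + k.toFun := by
  obtain ⟨K, hK, h0⟩ := h.exists_support
  obtain ⟨K', hK', h0'⟩ := k.exists_support
  refine exists_testTensor (K := K ∪ K') (fun x v w => ?_) ?_ (hK.union hK') fun x hx => ?_
  · change h.toFun.at x v w + k.toFun.at x v w = h.toFun.at x w v + k.toFun.at x w v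
    rw [h.at_comm, k.at_comm]
  · exact ((h.isSmoothTensor.isSmoothFamilyOn (univ : Set ℝ)).add
      (k.isSmoothTensor.isSmoothFamilyOn _)).isSmoothTensor (mem_univ (0 : ℝ))
  · change h.toFun.at x + k.toFun.at x = 0
    rw [h0 x fun h => hx (Or.inl h), h0' x fun h => hx (Or.inr h), add_zero]

/-- The velocity of a smooth curve of symmetric tensors which locally only varies within a compact
set is a test tensor. -/
theorem exists_velocity_testTensor {J : Set ℝ} (hJ : UniqueDiffOn ℝ J) {c : ℝ → Tensor2 n M}
    (hc : IsSmoothFamilyOn J c) (hs : ∀ t x v w, (c t).at x v w = (c t).at x w v) {t : ℝ}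
    (ht : t ∈ J) (hsupp : ∃ U ∈ 𝓝[J] t, ∃ K : Set M, IsCompact K ∧
      ∀ τ ∈ U, ∀ x ∉ K, (c τ).at x = (c t).at x) :
    ∃ m : TestTensor n M, m.toFun = velocity J c t := by
  obtain ⟨U, hU, K, hK, h0⟩ := hsupp
  refine exists_testTensor (fun x v w => ?_) ((hc.velocity hJ).isSmoothTensor ht) hK fun x hx => ?_
  · have h1 := ((hc.hasDerivWithinAt ht x).clm_apply (hasDerivWithinAt_const t J v)).clm_apply
      (hasDerivWithinAt_const t J w)
    have h2 := ((hc.hasDerivWithinAt ht x).clm_apply (hasDerivWithinAt_const t J w)).clm_apply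
      (hasDerivWithinAt_const t J v)
    have h3 := (hJ t ht).eq_deriv _ h1 (h2.congr (fun τ _ => hs τ x v w) (hs t x v w))
    simpa using h3
  · refine (hJ t ht).eq_deriv _ (hc.hasDerivWithinAt ht x) ?_
    refine (hasDerivWithinAt_const t J ((c t).at x)).congr_of_eventuallyEq ?_ rfl
    filter_upwards [hU] with τ hτ
    exact h0 τ hτ x hx

section Geodesic

variable {J : Set ℝ} {g : ℝ → Met n M}

theorem IsGeodesicOn.isSmoothFamilyOn (hg : IsGeodesicOn J g) :
    IsSmoothFamilyOn J (fun t => (g t).tensor) := hg.1.1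

theorem IsGeodesicOn.hasDerivWithinAt (hg : IsGeodesicOn J g) {t : ℝ} (ht : t ∈ J) (x : M) :
    HasDerivWithinAt (fun τ => (g τ).tensor.at x)
      ((velocity J (fun τ => (g τ).tensor) t).at x) J t :=
  hg.isSmoothFamilyOn.hasDerivWithinAt ht x

theorem IsGeodesicOn.hasDerivWithinAt_velocity (hJ : UniqueDiffOn ℝ J) (hg : IsGeodesicOn J g)
    {t : ℝ} (ht : t ∈ J) (x : M) :
    HasDerivWithinAt (fun τ => (velocity J (fun τ => (g τ).tensor) τ).at x)
      (christoffelForm ((g t).tensor.at x) ((velocity J (fun τ => (g τ).tensor) t).at x)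
        ((velocity J (fun τ => (g τ).tensor) t).at x)) J t := by
  have h1 := (hg.isSmoothFamilyOn.velocity hJ).hasDerivWithinAt ht x
  refine h1.congr_deriv (sub_eq_zero.1 ?_)
  exact congrFun (hg.2 t ht) x

theorem IsGeodesicOn.velocity_mono (hg : IsGeodesicOn J g) {I : Set ℝ} (hI : UniqueDiffOn ℝ I)
    (hIJ : I ⊆ J) {t : ℝ} (ht : t ∈ I) :
    velocity I (fun τ => (g τ).tensor) t = velocity J (fun τ => (g τ).tensor) t :=
  velocity_eq (hI t ht) fun x => (hg.hasDerivWithinAt (hIJ ht) x).mono hIJ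

theorem IsGeodesicOn.eq_geoFlow (hJ : J.OrdConnected) (hnt : J.Nontrivial) (h0 : (0 : ℝ) ∈ J)
    (hg : IsGeodesicOn J g) {t : ℝ} (ht : t ∈ J) (x : M) :
    (t, (g 0).tensor.at x, (velocity J (fun τ => (g τ).tensor) 0).at x) ∈
        geoDomain (EuclideanSpace ℝ (Fin n)) ∧
      (g t).tensor.at x = geoFlow t ((g 0).tensor.at x)
        ((velocity J (fun τ => (g τ).tensor) 0).at x) := by
  have hI : uIcc 0 t ⊆ J := hJ.uIcc_subset h0 ht
  exact geodesic_eq_geoFlow (fun s _ => (g s).isPos x)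
    (fun s hs => (hg.hasDerivWithinAt (hI hs) x).mono hI)
    (fun s hs => (hg.hasDerivWithinAt_velocity (uniqueDiffOn_of_ordConnected hJ hnt)
      (hI hs) x).mono hI)

/-- A geodesic variation induces, at every point, a solution of the linearised geodesic
equation. -/
theorem linGeodesic_of_isGeodesicVariation {a b ε : ℝ} (hab : a < b) (hε : 0 < ε)
    {α : ℝ × ℝ → Met n M} (hα : IsGeodesicVariation a b ε g α) {x : M} {ξ : ℝ → Form n}
    (hξ : ∀ t ∈ Icc a b, HasDerivAt (fun s => (α (t, s)).tensor.at x) (ξ t) 0) :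
    ∃ η : ℝ → Form n, ∀ t ∈ Icc a b,
      HasDerivAt (fun s => (velocity (Icc a b) (fun τ => (α (τ, s)).tensor) t).at x) (η t) 0 ∧
      HasDerivWithinAt ξ (η t) (Icc a b) t ∧
      HasDerivWithinAt η (linGeodesic ((g t).tensor.at x)
        ((velocity (Icc a b) (fun τ => (g τ).tensor) t).at x) (ξ t) (η t)) (Icc a b) t := by
  have hI : UniqueDiffOn ℝ (Icc a b) := uniqueDiffOn_Icc hab
  have hz : (0 : ℝ) ∈ Ioo (-ε) ε := ⟨neg_lt_zero.2 hε, hε⟩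
  set f : ℝ × ℝ → Form n := fun p => (α p).tensor.at x with hfdef
  have hf : ContDiffOn ℝ ∞ f (strip a b ε) :=
    IsSmoothFamilyOn.contDiffOn_at (σ := fun p => (α p).tensor) hα.1.1 x
  have hd1 : ∀ p ∈ strip a b ε, dirDeriv (strip a b ε) (1, 0) f p =
      (velocity (Icc a b) (fun τ => (α (τ, p.2)).tensor) p.1).at x := fun p hp =>
    (hI p.1 hp.1).eq_deriv _ (hasDerivWithinAt_dirDeriv_fst hf hp)
      ((hα.2.1 p.2 hp.2).hasDerivWithinAt hp.1 x)
  have hd11 : ∀ p ∈ strip a b ε,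
      dirDeriv (strip a b ε) (1, 0) (dirDeriv (strip a b ε) (1, 0) f) p =
      christoffelForm (f p) (dirDeriv (strip a b ε) (1, 0) f p)
        (dirDeriv (strip a b ε) (1, 0) f p) := by
    intro p hp
    have h1 := hasDerivWithinAt_dirDeriv_fst (contDiffOn_dirDeriv hab hf (1, 0)) hp
    have h2 := (hα.2.1 p.2 hp.2).hasDerivWithinAt_velocity hI hp.1 x
    rw [hd1 p hp]
    refine (hI p.1 hp.1).eq_deriv _ h1 (h2.congr (fun τ hτ => ?_) ?_)
    · exact hd1 (τ, p.2) ⟨hτ, hp.2⟩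
    · exact hd1 p hp
  have hd2 : ∀ t ∈ Icc a b, dirDeriv (strip a b ε) (0, 1) f (t, 0) = ξ t := fun t ht =>
    (hasDerivAt_dirDeriv_snd hf ⟨ht, hz⟩).unique (hξ t ht)
  have hvel : ∀ t ∈ Icc a b, dirDeriv (strip a b ε) (1, 0) f (t, 0) =
      (velocity (Icc a b) (fun τ => (g τ).tensor) t).at x := by
    intro t ht
    rw [hd1 (t, 0) ⟨ht, hz⟩]
    refine congrArg (fun h : Tensor2 n M => h.at x) (velocity_eq (hI t ht) fun y => ?_)
    have h1 := (hα.2.1 0 hz).hasDerivWithinAt ht y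
    have heq : ∀ τ ∈ Icc a b, (g τ).tensor.at y = (α (τ, 0)).tensor.at y := fun τ hτ => by
      rw [hα.2.2 τ hτ]
    have h2 := h1.congr heq (heq t ht)
    exact h2.differentiableWithinAt.hasDerivWithinAt.congr (fun τ hτ => (heq τ hτ).symm)
      (heq t ht).symm
  -- The witness is ∂_s ∂_t α at s = 0. That it is the s-derivative of the velocities is kept in the
  -- conclusion because it later identifies the initial velocity.
  refine ⟨fun t => dirDeriv (strip a b ε) (0, 1) (dirDeriv (strip a b ε) (1, 0) f) (t, 0),
    fun t ht => ?_⟩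
  have hlin := linGeodesic_of_family hab hε hf (fun p _ => ((α p).isPos x).isInvertible) hd11 ht
  rw [hd2 t ht, hvel t ht, show f (t, 0) = (g t).tensor.at x by
    simp only [hfdef, hα.2.2 t ht]] at hlin
  refine ⟨?_, hlin.1.congr (fun τ hτ => (hd2 τ hτ).symm) (hd2 t ht).symm, hlin.2⟩
  have h1 := hasDerivAt_dirDeriv_snd (contDiffOn_dirDeriv hab hf (1, 0)) (t := t) (s := 0) ⟨ht, hz⟩
  refine h1.congr_of_eventuallyEq ?_
  filter_upwards [Ioo_mem_nhds hz.1 hz.2] with s hs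
  exact (hd1 (t, s) ⟨ht, hs⟩).symm

/-- Nearby initial values lead to geodesics which exist on a given compact interval. -/
theorem exists_strip_geoDomain {a b : ℝ} (g₀ h₀ : Tensor2 n M) (hg₀ : IsSmoothTensor g₀)
    (hh₀ : IsSmoothTensor h₀) (k l : TestTensor n M)
    (hdom : ∀ t ∈ Icc a b, ∀ x, (t, g₀.at x, h₀.at x) ∈ geoDomain (EuclideanSpace ℝ (Fin n))) :
    ∃ ε > 0, ∀ p ∈ strip a b ε, ∀ x,
      (p.1, (g₀ + p.2 • k.toFun).at x, (h₀ + p.2 • l.toFun).at x) ∈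
        geoDomain (EuclideanSpace ℝ (Fin n)) := by
  obtain ⟨K, hK, hk0⟩ := k.exists_support
  obtain ⟨K', hK', hl0⟩ := l.exists_support
  -- Openness of `geoDomain` and compactness of [a, b] × (K ∪ K') give a common range of s. Nearby
  -- fibres are compared in the chart at x, the domain being invariant under pullback.
  have hev : ∀ᶠ s in 𝓝 (0 : ℝ), ∀ z ∈ Icc a b ×ˢ (K ∪ K'),
      (z.1, (g₀ + s • k.toFun).at z.2, (h₀ + s • l.toFun).at z.2) ∈
        geoDomain (EuclideanSpace ℝ (Fin n)) := by
    refine (isCompact_Icc.prod (hK.union hK')).eventually_forall_of_forall_eventually ?_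
    rintro ⟨t, x⟩ ⟨ht, -⟩
    have hrep : ∀ {h : Tensor2 n M}, IsSmoothTensor h →
        ContinuousAt (fun z : ℝ × ℝ × M => rep x h (extChartAt (𝓡 n) x z.2.2)) (0, t, x) := by
      intro h hh
      have h1 := isSmoothFamilyOn_iff.1 (hh.isSmoothFamilyOn (univ : Set ℝ)) x
      have h2 : ContinuousAt (fun q : ℝ × EuclideanSpace ℝ (Fin n) => rep x h q.2)
          ((0 : ℝ), extChartAt (𝓡 n) x x) :=
        h1.continuousOn.continuousAt ((isOpen_univ.prod (isOpen_extChartAt_target x)).mem_nhds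
          ⟨mem_univ _, mem_extChartAt_target x⟩)
      have h3 : ContinuousAt (fun z : ℝ × ℝ × M => ((0 : ℝ), extChartAt (𝓡 n) x z.2.2))
          (0, t, x) := by
        refine continuousAt_const.prodMk ?_
        exact ContinuousAt.comp (f := fun z : ℝ × ℝ × M => z.2.2) (x := (0, t, x))
          (continuousAt_extChartAt x) (continuous_snd.comp continuous_snd).continuousAt
      exact ContinuousAt.comp (f := fun z : ℝ × ℝ × M => ((0 : ℝ), extChartAt (𝓡 n) x z.2.2))
        (x := (0, t, x)) h2 h3
    have hfst : ContinuousAt (fun z : ℝ × ℝ × M => z.1) (0, t, x) := continuous_fst.continuousAt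
    have hcont : ContinuousAt (fun z : ℝ × ℝ × M =>
        (z.2.1, rep x g₀ (extChartAt (𝓡 n) x z.2.2) + z.1 • rep x k.toFun (extChartAt (𝓡 n) x z.2.2),
          rep x h₀ (extChartAt (𝓡 n) x z.2.2) + z.1 • rep x l.toFun (extChartAt (𝓡 n) x z.2.2)))
        (0, t, x) :=
      (continuous_fst.comp continuous_snd).continuousAt.prodMk
        (((hrep hg₀).add (hfst.smul (hrep k.isSmoothTensor))).prodMk
          ((hrep hh₀).add (hfst.smul (hrep l.isSmoothTensor))))
    obtain ⟨L, hL⟩ := exists_equiv_rep_self (n := n) x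
    have hmem : (t, rep x g₀ (extChartAt (𝓡 n) x x) + (0 : ℝ) • rep x k.toFun (extChartAt (𝓡 n) x x),
          rep x h₀ (extChartAt (𝓡 n) x x) + (0 : ℝ) • rep x l.toFun (extChartAt (𝓡 n) x x)) ∈
        geoDomain (EuclideanSpace ℝ (Fin n)) := by
      rw [zero_smul, zero_smul, add_zero, add_zero, hL, hL]
      exact geoDomain_pull (hdom t ht x) L
    have hsrc : ∀ᶠ z : ℝ × ℝ × M in 𝓝 (0, t, x), z.2.2 ∈ (extChartAt (𝓡 n) x).source :=
      (continuous_snd.comp continuous_snd).continuousAt.eventually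
        (extChartAt_source_mem_nhds (I := 𝓡 n) x)
    filter_upwards [hcont.eventually (isOpen_geoDomain.mem_nhds hmem), hsrc] with z hz hzs
    obtain ⟨L', hL'⟩ := exists_equiv_rep x ((extChartAt (𝓡 n) x).map_source hzs)
    rw [hL', hL', hL', hL', (extChartAt (𝓡 n) x).left_inv hzs] at hz
    exact geoDomain_of_pull L' hz
  obtain ⟨ε, hε, hball⟩ := Metric.eventually_nhds_iff_ball.1 hev
  refine ⟨ε, hε, fun p hp x => ?_⟩
  have hp2 : p.2 ∈ Metric.ball (0 : ℝ) ε := by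
    rw [Real.ball_eq_Ioo, zero_sub, zero_add]
    exact hp.2
  -- Off the supports the initial data are unperturbed, so noncompactness of M does no harm.
  by_cases hx : x ∈ K ∪ K'
  · exact hball p.2 hp2 (p.1, x) ⟨hp.1, hx⟩
  · have h1 : (g₀ + p.2 • k.toFun).at x = g₀.at x := by
      change g₀.at x + p.2 • k.toFun.at x = g₀.at x
      rw [hk0 x fun h => hx (Or.inl h), smul_zero, add_zero]
    have h2 : (h₀ + p.2 • l.toFun).at x = h₀.at x := by
      change h₀.at x + p.2 • l.toFun.at x = h₀.at x
      rw [hl0 x fun h => hx (Or.inr h), smul_zero, add_zero]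
    rw [h1, h2]
    exact hdom p.1 hp.1 x

end Geodesic

end GeodesicVariations

/-! ### Construction and characterisation of Jacobi fields -/

section JacobiFields

variable {n : ℕ} {M : Type*} [TopologicalSpace M] [ChartedSpace (EuclideanSpace ℝ (Fin n)) M]
  [IsManifold (𝓡 n) ∞ M] {J : Set ℝ} {g : ℝ → Met n M}

theorem geoVar_zero_zero (t : ℝ) (g h : Form n) : geoVar t g h 0 0 = 0 := by
  simp [geoVar]

theorem geoVar_apply_comm {t : ℝ} {g h k l : Form n}
    (hx : (t, g, h) ∈ geoDomain (EuclideanSpace ℝ (Fin n))) (hgs : ∀ v w, g v w = g w v)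
    (hhs : ∀ v w, h v w = h w v) (hks : ∀ v w, k v w = k w v) (hls : ∀ v w, l v w = l w v)
    (v w : EuclideanSpace ℝ (Fin n)) : geoVar t g h k l v w = geoVar t g h k l w v := by
  have h0 := hasDerivAt_geoVar hx k l
  have h1 := (h0.clm_apply (hasDerivAt_const 0 v)).clm_apply (hasDerivAt_const 0 w)
  have h2 := (h0.clm_apply (hasDerivAt_const 0 w)).clm_apply (hasDerivAt_const 0 v)
  have h3 := h1.unique (h2.congr_of_eventuallyEq ?_)
  · simpa using h3
  · filter_upwards [eventually_isPos_line hx.1 k] with s hs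
    refine (geoFlow_apply_comm hs (fun v w => ?_) (fun v w => ?_) t v w).1
    · simp only [add_apply, smul_apply, hgs v w, hks v w]
    · simp only [add_apply, smul_apply, hhs v w, hls v w]

/-- The linearised geodesic equation along `g`, for a vector field along `g`. -/
def LinGeodesicOn (J : Set ℝ) (g : ℝ → Met n M) (ξ : ℝ → TestTensor n M) : Prop :=
  ∀ t ∈ J, ∀ x, HasDerivWithinAt (fun τ => (velocity J (fun τ => (ξ τ).toFun) τ).at x)
    (linGeodesic ((g t).tensor.at x) ((velocity J (fun τ => (g τ).tensor) t).at x)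
      ((ξ t).toFun.at x) ((velocity J (fun τ => (ξ τ).toFun) t).at x)) J t

theorem jacobiEquationOn_iff (hJ : UniqueDiffOn ℝ J) (hg : IsGeodesicOn J g)
    {ξ : ℝ → TestTensor n M} (hξ : IsVectorFieldOn J ξ) :
    JacobiEquationOn J g ξ ↔ LinGeodesicOn J g ξ := by
  refine forall₂_congr fun t ht => ?_
  rw [funext_iff]
  refine forall_congr' fun x => ?_
  have hη := (hξ.1.velocity hJ).hasDerivWithinAt ht x
  refine (jacobi_iff_linGeodesic (hJ t ht) ((g t).isPos x).isInvertible
    (hg.hasDerivWithinAt ht x) (hg.hasDerivWithinAt_velocity hJ ht x)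
    (hξ.1.hasDerivWithinAt ht x) hη).trans ⟨fun h => hη.congr_deriv h, fun h => ?_⟩
  exact (hJ t ht).eq_deriv _ hη h

theorem IsJacobiFieldOn.linGeodesicOn (hJ : J.OrdConnected) (hnt : J.Nontrivial)
    (hg : IsGeodesicOn J g) {ξ : ℝ → TestTensor n M} (hξ : IsJacobiFieldOn J g ξ) :
    LinGeodesicOn J g ξ := by
  intro t ht x
  have hJu := uniqueDiffOn_of_ordConnected hJ hnt
  -- A nondegenerate segment of J ending at t. The derivative within J is already known to exist, so
  -- it may be computed within the segment.
  obtain ⟨c, hc, hct⟩ := hnt.exists_ne t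
  obtain ⟨a, b, hab, hsub, htI⟩ : ∃ a b : ℝ, a < b ∧ Icc a b ⊆ J ∧ t ∈ Icc a b :=
    ⟨min t c, max t c, min_lt_max.2 hct.symm, hJ.uIcc_subset ht hc, left_mem_uIcc⟩
  have hI : UniqueDiffOn ℝ (Icc a b) := uniqueDiffOn_Icc hab
  obtain ⟨ε, hε, α, hα, hd⟩ := hξ.2 a b hab hsub
  obtain ⟨η, hη⟩ := linGeodesic_of_isGeodesicVariation hab hε hα (x := x)
    (ξ := fun t => (ξ t).toFun.at x) fun t ht => hd t ht x
  have hvel : ∀ τ ∈ Icc a b, η τ = (velocity J (fun τ => (ξ τ).toFun) τ).at x := fun τ hτ =>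
    (hI τ hτ).eq_deriv _ (hη τ hτ).2.1 ((hξ.1.1.hasDerivWithinAt (hsub hτ) x).mono hsub)
  have h1 := (hξ.1.1.velocity hJu).hasDerivWithinAt ht x
  refine h1.congr_deriv ?_
  have h2 := (hη t htI).2.2
  rw [hvel t htI, hg.velocity_mono hI hsub htI] at h2
  exact (hI t htI).eq_deriv _ (h1.mono hsub)
    (h2.congr (fun τ hτ => (hvel τ hτ).symm) (hvel t htI).symm)

theorem LinGeodesicOn.eqOn (hJ : J.OrdConnected) (hnt : J.Nontrivial) (h0 : (0 : ℝ) ∈ J)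
    (hg : IsGeodesicOn J g) {ξ ξ' : ℝ → TestTensor n M} (hξ : IsVectorFieldOn J ξ)
    (hξ' : IsVectorFieldOn J ξ') (hlin : LinGeodesicOn J g ξ) (hlin' : LinGeodesicOn J g ξ')
    (hinit : ξ 0 = ξ' 0)
    (hvel : velocity J (fun τ => (ξ τ).toFun) 0 = velocity J (fun τ => (ξ' τ).toFun) 0) :
    EqOn ξ ξ' J := by
  intro t ht
  have hI : uIcc 0 t ⊆ J := hJ.uIcc_subset h0 ht
  have hJu := uniqueDiffOn_of_ordConnected hJ hnt
  refine TestTensor.ext (funext fun x => ?_)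
  refine linGeodesic_unique (a := min 0 t) (b := max 0 t) (t₀ := 0)
    (c := fun τ => (g τ).tensor.at x)
    (u := fun τ => (velocity J (fun τ => (g τ).tensor) τ).at x)
    (ξ := fun τ => (ξ τ).toFun.at x) (ξ' := fun τ => (ξ' τ).toFun.at x)
    (η := fun τ => (velocity J (fun τ => (ξ τ).toFun) τ).at x)
    (η' := fun τ => (velocity J (fun τ => (ξ' τ).toFun) τ).at x) left_mem_uIcc
    (fun s hs => ((hg.hasDerivWithinAt (hI hs) x).mono hI).continuousWithinAt)
    (fun s hs => ((hg.hasDerivWithinAt_velocity hJu (hI hs) x).mono hI).continuousWithinAt)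
    (fun s _ => ((g s).isPos x).isInvertible)
    (fun s hs => (hξ.1.hasDerivWithinAt (hI hs) x).mono hI)
    (fun s hs => (hlin s (hI hs) x).mono hI)
    (fun s hs => (hξ'.1.hasDerivWithinAt (hI hs) x).mono hI)
    (fun s hs => (hlin' s (hI hs) x).mono hI) ?_ ?_ right_mem_uIcc
  · simp only [hinit]
  · simp only [hvel]

/-- Fields are defined on all of ℝ but only their values on J matter, so a constructed Jacobi field
can be exchanged for a given field that agrees with it on J. -/
theorem IsJacobiFieldOn.congr {ξ ξ' : ℝ → TestTensor n M} (hξ : IsJacobiFieldOn J g ξ)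
    (hξ' : IsVectorFieldOn J ξ') (h : EqOn ξ' ξ J) : IsJacobiFieldOn J g ξ' := by
  refine ⟨hξ', fun a b hab hsub => ?_⟩
  obtain ⟨ε, hε, α, hα, hd⟩ := hξ.2 a b hab hsub
  refine ⟨ε, hε, α, hα, fun t ht x => ?_⟩
  rw [h (hsub ht)]
  exact hd t ht x

/-- The geodesic variation with given initial values. -/
theorem exists_isGeodesicVariation (hJ : J.OrdConnected) (hnt : J.Nontrivial) (h0 : (0 : ℝ) ∈ J)
    (hg : IsGeodesicOn J g) (k l : TestTensor n M) {a b : ℝ} (hab : a < b) (hsub : Icc a b ⊆ J) :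
    ∃ ε > 0, ∃ α : ℝ × ℝ → Met n M, IsGeodesicVariation a b ε g α ∧
      ∀ p ∈ strip a b ε, ∀ x, (α p).tensor.at x = geoFlow p.1
        ((g 0).tensor.at x + p.2 • k.toFun.at x)
        ((velocity J (fun τ => (g τ).tensor) 0).at x + p.2 • l.toFun.at x) := by
  have hJu := uniqueDiffOn_of_ordConnected hJ hnt
  have hI : UniqueDiffOn ℝ (Icc a b) := uniqueDiffOn_Icc hab
  set h₀ := velocity J (fun τ => (g τ).tensor) 0 with hh₀
  have hh₀s : IsSmoothTensor h₀ := (hg.isSmoothFamilyOn.velocity hJu).isSmoothTensor h0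
  obtain ⟨m, hm⟩ := exists_velocity_testTensor hJu hg.isSmoothFamilyOn (fun t => (g t).at_comm) h0
    (hg.1.2 0 h0)
  have hh₀c : ∀ x v w, h₀.at x v w = h₀.at x w v := by
    rw [hh₀, ← hm]
    exact m.at_comm
  -- The segment [a, b] need not contain 0: membership in `geoDomain` at time t already requires
  -- positivity all the way from 0 to t, so data may still be prescribed at time 0.
  obtain ⟨ε, hε, hdom⟩ := exists_strip_geoDomain (g 0).tensor h₀ (g 0).isSmoothTensor hh₀s k l
    fun t ht x => (hg.eq_geoFlow hJ hnt h0 (hsub ht) x).1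
  have hsnd : ContDiffOn ℝ ∞ (fun p : ℝ × ℝ => p.2) (strip a b ε) := contDiff_snd.contDiffOn
  set A : ℝ × ℝ → Tensor2 n M := fun p => tensorOf fun x => geoFlow p.1
    (((g 0).tensor + p.2 • k.toFun).at x) ((h₀ + p.2 • l.toFun).at x) with hA
  have hAs : IsSmoothFamilyOn (strip a b ε) A :=
    IsSmoothFamilyOn.geoFlow (τ := fun p : ℝ × ℝ => p.1)
      (g := fun p => (g 0).tensor + p.2 • k.toFun)
      (h := fun p => h₀ + p.2 • l.toFun) contDiff_fst.contDiffOn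
      (((g 0).isSmoothTensor.isSmoothFamilyOn _).add
        (IsSmoothFamilyOn.smul hsnd (k.isSmoothTensor.isSmoothFamilyOn _)))
      ((hh₀s.isSmoothFamilyOn _).add
        (IsSmoothFamilyOn.smul hsnd (l.isSmoothTensor.isSmoothFamilyOn _))) hdom
  have hcg : ∀ (s : ℝ) x v w, ((g 0).tensor + s • k.toFun).at x v w =
      ((g 0).tensor + s • k.toFun).at x w v := by
    intro s x v w
    change (g 0).tensor.at x v w + s * k.toFun.at x v w =
      (g 0).tensor.at x w v + s * k.toFun.at x w v
    rw [(g 0).at_comm, k.at_comm]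
  have hch : ∀ (s : ℝ) x v w, (h₀ + s • l.toFun).at x v w = (h₀ + s • l.toFun).at x w v := by
    intro s x v w
    change h₀.at x v w + s * l.toFun.at x v w = h₀.at x w v + s * l.toFun.at x w v
    rw [hh₀c, l.at_comm]
  have hex : ∀ p : ℝ × ℝ, ∃ m : Met n M, p ∈ strip a b ε → m.tensor = A p := by
    intro p
    by_cases hp : p ∈ strip a b ε
    · refine ⟨metOfTensor (A p) (fun x v w => ?_) (fun x => ?_) (hAs.isSmoothTensor hp),
        fun _ => rfl⟩
      · exact (geoFlow_apply_comm (hdom p hp x).1 (hcg p.2 x) (hch p.2 x) p.1 v w).1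
      · exact isPos_geoFlow (hdom p hp x).1 (hcg p.2 x) (hch p.2 x) p.1
    · exact ⟨g 0, fun h => absurd h hp⟩
  choose α hα using hex
  have hz : (0 : ℝ) ∈ Ioo (-ε) ε := ⟨neg_lt_zero.2 hε, hε⟩
  obtain ⟨K, hK, hk0⟩ := k.exists_support
  obtain ⟨K', hK', hl0⟩ := l.exists_support
  have hconst : ∀ t ∈ Icc a b, ∀ s : ℝ, ∀ x ∉ K ∪ K', (A (t, s)).at x = (g t).tensor.at x := by
    intro t ht s x hx
    rw [(hg.eq_geoFlow hJ hnt h0 (hsub ht) x).2]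
    change geoFlow t ((g 0).tensor.at x + s • k.toFun.at x) (h₀.at x + s • l.toFun.at x) = _
    rw [hk0 x fun h => hx (Or.inl h), hl0 x fun h => hx (Or.inr h), smul_zero, add_zero, add_zero]
  have hzero : ∀ t ∈ Icc a b, A (t, 0) = (g t).tensor := by
    intro t ht
    funext x
    refine Eq.trans ?_ (hg.eq_geoFlow hJ hnt h0 (hsub ht) x).2.symm
    change geoFlow t ((g 0).tensor.at x + (0 : ℝ) • k.toFun.at x)
      (h₀.at x + (0 : ℝ) • l.toFun.at x) = _
    rw [zero_smul, zero_smul, add_zero, add_zero]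
  -- The curve g itself moves, locally in time, only inside K₀, and the perturbation acts only
  -- inside K ∪ K'; the union serves for α.
  have hsm : IsSmoothMapOn (strip a b ε) α := by
    refine ⟨hAs.congr fun p hp => hα p hp, fun p hp => ?_⟩
    obtain ⟨U, hU, K₀, hK₀, hU0⟩ := hg.1.2 p.1 (hsub hp.1)
    refine ⟨strip a b ε ∩ Prod.fst ⁻¹' U, inter_mem self_mem_nhdsWithin ?_, K₀ ∪ (K ∪ K'),
      hK₀.union (hK.union hK'), fun q hq x hx => ?_⟩
    · have : Tendsto Prod.fst (𝓝[strip a b ε] p) (𝓝[J] p.1) :=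
        continuousWithinAt_fst.tendsto_nhdsWithin fun q hq => hsub hq.1
      exact this hU
    · have hx1 : x ∉ K ∪ K' := fun h => hx (Or.inr h)
      have h1 : (α q).tensor.at x = (α p).tensor.at x := by
        rw [hα q hq.1, hα p hp]
        have h2 := hconst q.1 hq.1.1 q.2 x hx1
        have h3 := hconst p.1 hp.1 p.2 x hx1
        rw [Prod.mk.eta] at h2 h3
        rw [h2, h3]
        exact hU0 q.1 hq.2 x fun h => hx (Or.inl h)
      exact h1
  have hline : ∀ s ∈ Ioo (-ε) ε, IsSmoothMapOn (Icc a b) (fun t => α (t, s)) := by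
    intro s hs
    have hmaps : MapsTo (fun t => (t, s)) (Icc a b) (strip a b ε) := fun t ht => ⟨ht, hs⟩
    have hcd : ContDiff ℝ ∞ (fun t : ℝ => (t, s)) := contDiff_id.prodMk contDiff_const
    refine ⟨IsSmoothFamilyOn.comp (σ := fun p => (α p).inner) hsm.1 hcd.contDiffOn hmaps,
      fun t ht => ?_⟩
    obtain ⟨U, hU, K₀, hK₀, hU0⟩ := hsm.2 (t, s) ⟨ht, hs⟩
    refine ⟨(fun t => (t, s)) ⁻¹' U, ?_, K₀, hK₀, fun q hq x hx => hU0 (q, s) hq x hx⟩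
    exact hcd.continuous.continuousWithinAt.tendsto_nhdsWithin hmaps hU
  refine ⟨ε, hε, α, ⟨hsm, fun s hs => ⟨hline s hs, fun t ht => ?_⟩, fun t ht => ?_⟩,
    fun p hp x => by rw [hα p hp]; rfl⟩
  · have hgt : ∀ τ ∈ Icc a b, (α (τ, s)).tensor = A (τ, s) := fun τ hτ => hα (τ, s) ⟨hτ, hs⟩
    have hvel : ∀ τ ∈ Icc a b, velocity (Icc a b) (fun τ => (α (τ, s)).tensor) τ =
        tensorOf fun x => geoFlow τ (((g 0).tensor + s • k.toFun).at x) ((h₀ + s • l.toFun).at x) ∘L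
          geoLog τ (((g 0).tensor + s • k.toFun).at x) ((h₀ + s • l.toFun).at x) := by
      intro τ hτ
      refine velocity_eq (hI τ hτ) fun x => ?_
      refine ((hasDerivAt_geoFlow (hdom (τ, s) ⟨hτ, hs⟩ x)).hasDerivWithinAt).congr
        (fun r hr => ?_) ?_
      · rw [hgt r hr]
        rfl
      · rw [hgt τ hτ]
        rfl
    funext x
    refine sub_eq_zero.2 ?_
    have h1 : HasDerivWithinAt
        (fun τ => (velocity (Icc a b) (fun τ => (α (τ, s)).tensor) τ).at x) _ (Icc a b) t :=
      ((hasDerivAt_geoVel (hdom (t, s) ⟨ht, hs⟩ x)).hasDerivWithinAt).congr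
        (fun r hr => by rw [hvel r hr]; rfl) (by rw [hvel t ht]; rfl)
    refine Eq.trans (h1.derivWithin (hI t ht)) ?_
    change _ = christoffelForm ((α (t, s)).tensor.at x)
      ((velocity (Icc a b) (fun τ => (α (τ, s)).tensor) t).at x)
      ((velocity (Icc a b) (fun τ => (α (τ, s)).tensor) t).at x)
    rw [hvel t ht, hgt t ht]
    rfl
  · refine Met.ext_tensor ?_
    rw [hα (t, 0) ⟨ht, hz⟩, hzero t ht]

/-- Existence of Jacobi fields with given initial values. -/
theorem exists_jacobiField (hJ : J.OrdConnected) (hnt : J.Nontrivial) (h0 : (0 : ℝ) ∈ J)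
    (hg : IsGeodesicOn J g) (k l : TestTensor n M) :
    ∃ ξ : ℝ → TestTensor n M, IsJacobiFieldOn J g ξ ∧ ξ 0 = k ∧
      velocity J (fun τ => (ξ τ).toFun) 0 = l.toFun := by
  have hJu := uniqueDiffOn_of_ordConnected hJ hnt
  set h₀ := velocity J (fun τ => (g τ).tensor) 0 with hh₀
  have hh₀s : IsSmoothTensor h₀ := (hg.isSmoothFamilyOn.velocity hJu).isSmoothTensor h0
  obtain ⟨m, hm⟩ := exists_velocity_testTensor hJu hg.isSmoothFamilyOn (fun t => (g t).at_comm) h0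
    (hg.1.2 0 h0)
  have hh₀c : ∀ x v w, h₀.at x v w = h₀.at x w v := by
    rw [hh₀, ← hm]
    exact m.at_comm
  obtain ⟨K, hK, hk0⟩ := k.exists_support
  obtain ⟨K', hK', hl0⟩ := l.exists_support
  have hdom : ∀ t ∈ J, ∀ x, (t, (g 0).tensor.at x, h₀.at x) ∈ geoDomain (EuclideanSpace ℝ (Fin n)) :=
    fun t ht x => (hg.eq_geoFlow hJ hnt h0 ht x).1
  -- The s-derivative of the explicit flow makes sense on all of J at once, whereas the variations
  -- exist only segment by segment, with ε depending on the segment.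
  set X : ℝ → Tensor2 n M := fun t => tensorOf fun x =>
    geoVar t ((g 0).tensor.at x) (h₀.at x) (k.toFun.at x) (l.toFun.at x) with hX
  have hXs : IsSmoothFamilyOn J X :=
    IsSmoothFamilyOn.geoVar (τ := fun t => t) (g := fun _ => (g 0).tensor) (h := fun _ => h₀)
      (k := fun _ => k.toFun) (l := fun _ => l.toFun) contDiff_id.contDiffOn
      ((g 0).isSmoothTensor.isSmoothFamilyOn J) (hh₀s.isSmoothFamilyOn J)
      (k.isSmoothTensor.isSmoothFamilyOn J) (l.isSmoothTensor.isSmoothFamilyOn J) hdom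
  have hX0 : ∀ t, ∀ x ∉ K ∪ K', (X t).at x = 0 := by
    intro t x hx
    rw [hX, tensorOf_at, hk0 x fun h => hx (Or.inl h), hl0 x fun h => hx (Or.inr h),
      geoVar_zero_zero]
  have hex : ∀ t, ∃ m : TestTensor n M, t ∈ J → m.toFun = X t := by
    intro t
    by_cases ht : t ∈ J
    · obtain ⟨m, hm⟩ := exists_testTensor (h := X t) (fun x => geoVar_apply_comm (hdom t ht x)
        ((g 0).at_comm x) (hh₀c x) (k.at_comm x) (l.at_comm x)) (hXs.isSmoothTensor ht)
        (hK.union hK') (hX0 t)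
      exact ⟨m, fun _ => hm⟩
    · exact ⟨k, fun h => absurd h ht⟩
  choose ξ hξ using hex
  have hvf : IsVectorFieldOn J ξ := by
    refine ⟨hXs.congr fun t ht => hξ t ht, fun t _ => ⟨J, self_mem_nhdsWithin, K ∪ K',
      hK.union hK', fun τ hτ x hx => ?_⟩⟩
    rw [hξ τ hτ]
    exact hX0 τ x hx
  have hvar : ∀ a b : ℝ, a < b → Icc a b ⊆ J → ∃ ε > 0, ∃ α : ℝ × ℝ → Met n M,
      IsGeodesicVariation a b ε g α ∧ (∀ p ∈ strip a b ε, ∀ x, (α p).tensor.at x = geoFlow p.1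
        ((g 0).tensor.at x + p.2 • k.toFun.at x) (h₀.at x + p.2 • l.toFun.at x)) ∧
      ∀ t ∈ Icc a b, ∀ x, HasDerivAt (fun s : ℝ => (α (t, s)).tensor.at x) ((ξ t).toFun.at x) 0 := by
    intro a b hab hsub
    obtain ⟨ε, hε, α, hα, hval⟩ := exists_isGeodesicVariation hJ hnt h0 hg k l hab hsub
    refine ⟨ε, hε, α, hα, hval, fun t ht x => ?_⟩
    rw [hξ t (hsub ht)]
    refine (hasDerivAt_geoVar (hdom t (hsub ht) x) (k.toFun.at x)
      (l.toFun.at x)).congr_of_eventuallyEq ?_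
    filter_upwards [Ioo_mem_nhds (neg_lt_zero.2 hε) hε] with s hs
    exact hval (t, s) ⟨ht, hs⟩ x
  have hjac : IsJacobiFieldOn J g ξ := by
    refine ⟨hvf, fun a b hab hsub => ?_⟩
    obtain ⟨ε, hε, α, hα, -, hd⟩ := hvar a b hab hsub
    exact ⟨ε, hε, α, hα, hd⟩
  refine ⟨ξ, hjac, ?_, ?_⟩
  · refine TestTensor.ext ?_
    rw [hξ 0 h0]
    funext x
    change geoVar 0 ((g 0).tensor.at x) (h₀.at x) (k.toFun.at x) (l.toFun.at x) = k.toFun.at x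
    simp only [geoVar, geoFlow_zero]
    exact (hasDerivAt_line _ _ 0).deriv
  -- The initial velocity is ∂_t ∂_s α = ∂_s ∂_t α at (0, 0), and for small s the curve α(·, s) has
  -- velocity h₀ + s l at time 0.
  · obtain ⟨c, hc, hct⟩ := hnt.exists_ne 0
    obtain ⟨a, b, hab, hsub, htI⟩ : ∃ a b : ℝ, a < b ∧ Icc a b ⊆ J ∧ (0 : ℝ) ∈ Icc a b :=
      ⟨min 0 c, max 0 c, min_lt_max.2 hct.symm, hJ.uIcc_subset h0 hc, left_mem_uIcc⟩
    have hI : UniqueDiffOn ℝ (Icc a b) := uniqueDiffOn_Icc hab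
    obtain ⟨ε, hε, α, hα, hval, hd⟩ := hvar a b hab hsub
    funext x
    obtain ⟨η, hη⟩ := linGeodesic_of_isGeodesicVariation hab hε hα (x := x)
      (ξ := fun t => (ξ t).toFun.at x) fun t ht => hd t ht x
    have h1 : η 0 = (velocity J (fun τ => (ξ τ).toFun) 0).at x :=
      (hI 0 htI).eq_deriv _ (hη 0 htI).2.1 ((hvf.1.hasDerivWithinAt h0 x).mono hsub)
    refine Eq.trans h1.symm ?_
    refine (hη 0 htI).1.unique ((hasDerivAt_line (h₀.at x) (l.toFun.at x) 0).congr_of_eventuallyEq ?_)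
    filter_upwards [eventually_isPos_line ((g 0).isPos x) (k.toFun.at x),
      Ioo_mem_nhds (neg_lt_zero.2 hε) hε] with s hs hsI
    have hdom0 : (0, (g 0).tensor.at x + s • k.toFun.at x, h₀.at x + s • l.toFun.at x) ∈
        geoDomain (EuclideanSpace ℝ (Fin n)) := ⟨hs, by simp [quadPos]⟩
    have h2 := (hα.2.1 s hsI).hasDerivWithinAt htI x
    have h3 := (hasDerivAt_geoFlow hdom0).hasDerivWithinAt (s := Icc a b)
    rw [geoFlow_zero, geoLog_zero, comp_raise hs.isInvertible] at h3
    exact (hI 0 htI).eq_deriv _ h2 (h3.congr (fun τ hτ => hval (τ, s) ⟨hτ, hsI⟩ x)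
      (hval (0, s) ⟨htI, hsI⟩ x))

/-- Once ξ(0) = k is fixed, prescribing the covariant or the ordinary derivative of ξ at 0 is the
same: they differ by Γ(g_t(0), k), which is again a test tensor. -/
theorem jacobi_field_theorem (hJ : J.OrdConnected) (hnt : J.Nontrivial) (h0 : (0 : ℝ) ∈ J)
    (hg : IsGeodesicOn J g) :
    (∀ k l : TestTensor n M,
      (∃ ξ : ℝ → TestTensor n M, IsJacobiFieldOn J g ξ ∧ ξ 0 = k ∧
        covDeriv J (fun t => (g t).inner) (fun t => (ξ t).toFun) 0 = l.toFun) ∧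
      ∀ ξ η : ℝ → TestTensor n M,
        (IsJacobiFieldOn J g ξ ∧ ξ 0 = k ∧
          covDeriv J (fun t => (g t).inner) (fun t => (ξ t).toFun) 0 = l.toFun) →
        (IsJacobiFieldOn J g η ∧ η 0 = k ∧
          covDeriv J (fun t => (g t).inner) (fun t => (η t).toFun) 0 = l.toFun) →
        EqOn ξ η J) ∧
    (∀ ξ : ℝ → TestTensor n M, IsVectorFieldOn J ξ →
      (JacobiEquationOn J g ξ ↔ IsJacobiFieldOn J g ξ)) := by
  have hJu := uniqueDiffOn_of_ordConnected hJ hnt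
  set h₀ := velocity J (fun τ => (g τ).tensor) 0 with hh₀
  have hcov : ∀ ξ : ℝ → TestTensor n M,
      covDeriv J (fun t => (g t).inner) (fun t => (ξ t).toFun) 0 =
        velocity J (fun t => (ξ t).toFun) 0 - christoffel (g 0).tensor h₀ (ξ 0).toFun :=
    fun ξ => rfl
  refine ⟨fun k l => ⟨?_, ?_⟩, fun ξ hξ => ?_⟩
  · obtain ⟨m, hm⟩ := exists_velocity_testTensor hJu hg.isSmoothFamilyOn (fun t => (g t).at_comm)
      h0 (hg.1.2 0 h0)
    obtain ⟨m', hm'⟩ := exists_christoffel_testTensor (g 0) m k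
    obtain ⟨l', hl'⟩ := exists_add_testTensor l m'
    obtain ⟨ξ, hξ, hξ0, hξv⟩ := exists_jacobiField hJ hnt h0 hg k l'
    refine ⟨ξ, hξ, hξ0, ?_⟩
    rw [hcov, hξv, hξ0, hl', hm', hm, ← hh₀]
    exact add_sub_cancel_right l.toFun (christoffel (g 0).tensor h₀ k.toFun)
  · rintro ξ η ⟨hξ, hξ0, hξv⟩ ⟨hη, hη0, hηv⟩
    refine (hξ.linGeodesicOn hJ hnt hg).eqOn hJ hnt h0 hg hξ.1 hη.1 (hη.linGeodesicOn hJ hnt hg)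
      (hξ0.trans hη0.symm) ?_
    rw [hcov, hξ0] at hξv
    rw [hcov, hη0] at hηv
    exact sub_left_injective (hξv.trans hηv.symm)
  · rw [jacobiEquationOn_iff hJu hg hξ]
    refine ⟨fun hlin => ?_, fun h => h.linGeodesicOn hJ hnt hg⟩
    obtain ⟨l, hl⟩ := exists_velocity_testTensor hJu hξ.1 (fun t => (ξ t).at_comm) h0 (by
      obtain ⟨U, hU, K, hK, hUK⟩ := hξ.2 0 h0
      exact ⟨U, hU, K, hK, fun τ hτ x hx => (hUK τ hτ x hx).trans
        (hUK 0 (mem_of_mem_nhdsWithin h0 hU) x hx).symm⟩)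
    -- The Jacobi field with the initial data of the given solution; both solve the linearised
    -- equation, hence they agree on J.
    obtain ⟨ξ', hξ', h1, h2⟩ := exists_jacobiField hJ hnt h0 hg (ξ 0) l
    exact hξ'.congr hξ (hlin.eqOn hJ hnt h0 hg hξ hξ'.1 (hξ'.linGeodesicOn hJ hnt hg) h1.symm
      (hl.symm.trans h2.symm))

end JacobiFields

/-! ### Derivative of the density of the canonical metric at a point -/

section VolumeDensity

variable {n : ℕ}

/-- The Gram matrix of a bilinear form in the standard basis. -/
def gram (G : Form n) : Matrix (Fin n) (Fin n) ℝ :=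
  Matrix.of fun a b => G (EuclideanSpace.single a 1) (EuclideanSpace.single b 1)

/-- The volume density of a bilinear form. -/
def formVol (G : Form n) : ℝ := Real.sqrt (gram G).det

/-- The density `tr(G⁻¹ K G⁻¹ L) √(det G)`. -/
def formDensity (G K L : Form n) : ℝ := tr (raise G K ∘L raise G L) * formVol G

theorem gram_comp (G : Form n) (A : EuclideanSpace ℝ (Fin n) →L[ℝ] EuclideanSpace ℝ (Fin n)) :
    gram (G ∘L A) = (LinearMap.toMatrix (EuclideanSpace.basisFun (Fin n) ℝ).toBasis
      (EuclideanSpace.basisFun (Fin n) ℝ).toBasis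
      (A : EuclideanSpace ℝ (Fin n) →ₗ[ℝ] EuclideanSpace ℝ (Fin n))).transpose * gram G := by
  ext a b
  have h1 : A (EuclideanSpace.single a 1) =
      ∑ c, (A (EuclideanSpace.single a 1)) c • EuclideanSpace.single c (1 : ℝ) := by
    have := (EuclideanSpace.basisFun (Fin n) ℝ).sum_repr (A (EuclideanSpace.single a 1))
    simpa using this.symm
  simp only [gram, Matrix.of_apply, Matrix.mul_apply, Matrix.transpose_apply,
    LinearMap.toMatrix_apply, ContinuousLinearMap.comp_apply]
  rw [h1]
  simp

/-- Jacobi's formula: H = G(G⁻¹H) factors the Gram matrix of G + sH as (1 + sAᵀ) times that of G,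
and det(1 + sAᵀ) = 1 + s tr A + O(s²). -/
theorem hasDerivAt_det_gram {G : Form n} (hG : G.IsInvertible) (H : Form n) :
    HasDerivAt (fun s : ℝ => (gram (G + s • H)).det) ((gram G).det * tr (raise G H)) 0 := by
  set A : Matrix (Fin n) (Fin n) ℝ :=
    LinearMap.toMatrix (EuclideanSpace.basisFun (Fin n) ℝ).toBasis
      (EuclideanSpace.basisFun (Fin n) ℝ).toBasis (raise G H : EuclideanSpace ℝ (Fin n) →ₗ[ℝ] EuclideanSpace ℝ (Fin n)) with hA
  have htr : A.transpose.trace = tr (raise G H) := by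
    rw [Matrix.trace_transpose]
    exact (LinearMap.trace_eq_matrix_trace ℝ (EuclideanSpace.basisFun (Fin n) ℝ).toBasis
      (raise G H : EuclideanSpace ℝ (Fin n) →ₗ[ℝ] EuclideanSpace ℝ (Fin n))).symm
  have hgram : ∀ s : ℝ, gram (G + s • H) = (1 + s • A.transpose) * gram G := by
    intro s
    have h1 : gram H = A.transpose * gram G := by
      rw [hA, ← gram_comp, comp_raise hG]
    rw [add_mul, one_mul, smul_mul_assoc, ← h1]
    ext a b
    simp [gram]
  have hdet : ∀ s : ℝ, (gram (G + s • H)).det = (1 + A.transpose.trace * s +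
      (1 + (Polynomial.X : Polynomial ℝ) • A.transpose.map Polynomial.C).det.divX.divX.eval s * s ^ 2) *
        (gram G).det := by
    intro s
    rw [hgram, Matrix.det_mul, Matrix.det_one_add_smul]
  simp_rw [hdet]
  have h2 := ((1 + (Polynomial.X : Polynomial ℝ) • A.transpose.map Polynomial.C).det.divX.divX.hasDerivAt
    (0 : ℝ)).fun_mul (hasDerivAt_pow 2 (0 : ℝ))
  have h3 := ((((hasDerivAt_id (0 : ℝ)).const_mul A.transpose.trace).const_add 1).fun_add
    h2).mul_const (gram G).det
  refine h3.congr_deriv ?_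
  rw [htr]
  simp [mul_comm]

theorem det_gram_pos {G : Form n} (hG : IsPos G) (hs : ∀ v w, G v w = G w v) :
    0 < (gram G).det := by
  refine Matrix.PosDef.det_pos (Matrix.PosDef.of_dotProduct_mulVec_pos ?_ fun x hx => ?_)
  · ext a b
    simp [gram, hs (EuclideanSpace.single b 1)]
  · set v : EuclideanSpace ℝ (Fin n) := WithLp.toLp 2 x with hv
    have hv0 : v ≠ 0 := fun h => hx (by simpa [hv] using h)
    have hsum : v = ∑ a, x a • EuclideanSpace.single a (1 : ℝ) := by
      have := (EuclideanSpace.basisFun (Fin n) ℝ).sum_repr v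
      simpa using this.symm
    have h1 := hG v hv0
    rw [hsum] at h1
    simp only [map_sum, map_smul, sum_apply, smul_apply, smul_eq_mul] at h1
    convert! h1 using 1
    simp only [dotProduct, Matrix.mulVec, gram, Matrix.of_apply, star_trivial, Finset.mul_sum]
    rw [Finset.sum_comm]
    refine Finset.sum_congr rfl fun b _ => Finset.sum_congr rfl fun a _ => ?_
    ring

theorem hasDerivAt_formVol {G : Form n} (hG : IsPos G) (hs : ∀ v w, G v w = G w v) (H : Form n) :
    HasDerivAt (fun s : ℝ => formVol (G + s • H)) (1 / 2 * tr (raise G H) * formVol G) 0 := by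
  have hpos := det_gram_pos hG hs
  have h1 := hasDerivAt_det_gram hG.isInvertible H
  have h2 := h1.sqrt (by simpa using hpos.ne')
  refine h2.congr_deriv ?_
  rw [zero_smul, add_zero, formVol]
  have h3 := Real.mul_self_sqrt hpos.le
  have h4 : 0 < Real.sqrt (gram G).det := Real.sqrt_pos.2 hpos
  rw [div_eq_iff (by positivity)]
  nth_rewrite 1 [← h3]
  ring

theorem hasDerivAt_raise_line {G : Form n} (hG : IsPos G) (H K : Form n) :
    HasDerivAt (fun s : ℝ => raise (G + s • H) K) (-(raise G H * raise G K)) 0 := by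
  have hU : IsOpen {s : ℝ | IsPos (G + s • H)} := isOpen_isPos.preimage (by fun_prop)
  have h0 : (0 : ℝ) ∈ {s : ℝ | IsPos (G + s • H)} := by simpa using hG
  have h1 := hasDerivWithinAt_raise (hU.uniqueDiffOn 0 h0) h0 (fun s hs => hs.isInvertible)
    (hasDerivAt_line G H 0).hasDerivWithinAt (hasDerivWithinAt_const 0 _ K)
  have h2 := h1.hasDerivAt (hU.mem_nhds h0)
  refine h2.congr_deriv ?_
  have h3 : raise G (0 : Form n) = 0 := ContinuousLinearMap.comp_zero _
  rw [zero_smul, add_zero, h3, zero_sub]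

/-- Metric compatibility before integration. With P, A, B the endomorphisms of H, K, L, both sides
equal -tr(PAB) - tr(APB) + ½ tr(P) tr(AB), times the volume density. The terms tr(PA) tr(B) and
tr(PB) tr(A) of the two Christoffel symbols cancel. -/
theorem hasDerivAt_formDensity_zero {G : Form n} (hG : IsPos G) (hs : ∀ v w, G v w = G w v)
    (H K L : Form n) :
    HasDerivAt (fun s : ℝ => formDensity (G + s • H) K L)
      (-(formDensity G (christoffelForm G H K) L + formDensity G K (christoffelForm G H L))) 0 := by
  have h1 := (hasDerivAt_raise_line hG H K).fun_mul (hasDerivAt_raise_line hG H L)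
  have h2 := ((trCLM (EuclideanSpace ℝ (Fin n))).hasFDerivAt.comp_hasDerivAt 0 h1).fun_mul
    (hasDerivAt_formVol hG hs H)
  refine h2.congr_deriv ?_
  simp only [Function.comp_apply, zero_smul, add_zero, trCLM_apply]
  rw [formDensity, formDensity, raise_christoffelForm hG.isInvertible,
    raise_christoffelForm hG.isInvertible]
  set P := raise G H
  set A := raise G K
  set B := raise G L
  change tr (-(P * A) * B + A * -(P * B)) * formVol G + tr (A * B) * (1 / 2 * tr P * formVol G) =
    -(tr (((1 / 2 : ℝ) • (P * A) + (1 / 2 : ℝ) • (A * P) + (1 / 4 * tr (P * A)) • 1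
        - (1 / 4 * tr P) • A - (1 / 4 * tr A) • P) * B) * formVol G +
      tr (A * ((1 / 2 : ℝ) • (P * B) + (1 / 2 : ℝ) • (B * P) + (1 / 4 * tr (P * B)) • 1
        - (1 / 4 * tr P) • B - (1 / 4 * tr B) • P)) * formVol G)
  have hneg : ∀ X : EuclideanSpace ℝ (Fin n) →L[ℝ] EuclideanSpace ℝ (Fin n), tr (-X) = -tr X :=
    fun X => map_neg (trCLM _) X
  simp only [add_mul, sub_mul, mul_add, mul_sub, neg_mul, mul_neg, smul_mul_assoc, mul_smul_comm,
    one_mul, mul_one, tr_add, tr_sub, tr_smul, hneg]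
  have c1 : tr (A * (B * P)) = tr (P * A * B) := by
    rw [← mul_assoc, tr_mul_comm, mul_assoc]
  have c2 : tr (A * P * B) = tr (A * (P * B)) := by rw [mul_assoc]
  have c3 : tr (A * P) = tr (P * A) := tr_mul_comm _ _
  rw [c1, c2, c3]
  ring

/-- Moves the base point along the line, since differentiating under the integral needs the
derivative at all s near 0. -/
theorem hasDerivAt_formDensity {G H : Form n} {s : ℝ} (hG : IsPos (G + s • H))
    (hs : ∀ v w, (G + s • H) v w = (G + s • H) w v) (K L : Form n) :
    HasDerivAt (fun s : ℝ => formDensity (G + s • H) K L)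
      (-(formDensity (G + s • H) (christoffelForm (G + s • H) H K) L +
        formDensity (G + s • H) K (christoffelForm (G + s • H) H L))) s := by
  have h1 := hasDerivAt_formDensity_zero hG hs H K L
  rw [← sub_self s] at h1
  have h2 := h1.comp_sub_const s s
  refine h2.congr_of_eventuallyEq (Eventually.of_forall fun r => ?_)
  have : G + r • H = G + s • H + (r - s) • H := by module
  simp only [this]

theorem continuous_formVol : Continuous (formVol : Form n → ℝ) := by
  refine Real.continuous_sqrt.comp (Continuous.matrix_det ?_)
  exact continuous_matrix fun a b => by
    simp only [gram, Matrix.of_apply]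
    fun_prop

section Continuity

variable {X : Type*} [TopologicalSpace X] {S : Set X} {G K L : X → Form n}

theorem continuousOn_raise (hG : ContinuousOn G S) (hp : ∀ x ∈ S, IsPos (G x))
    (hK : ContinuousOn K S) : ContinuousOn (fun x => raise (G x) (K x)) S := fun x hx =>
  ContinuousAt.comp_continuousWithinAt (f := fun x => (G x, K x))
    (contDiffAt_raise (hp x hx).isInvertible (K x) (m := 0)).continuousAt
    ((hG x hx).prodMk (hK x hx))

theorem continuousOn_christoffelForm (hG : ContinuousOn G S) (hp : ∀ x ∈ S, IsPos (G x))
    (hK : ContinuousOn K S) (hL : ContinuousOn L S) :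
    ContinuousOn (fun x => christoffelForm (G x) (K x) (L x)) S := fun x hx =>
  ContinuousAt.comp_continuousWithinAt (f := fun x => (G x, K x, L x))
    (contDiffAt_christoffelForm (hp x hx).isInvertible (K x) (L x) (m := 0)).continuousAt
    ((hG x hx).prodMk ((hK x hx).prodMk (hL x hx)))

theorem continuousOn_formDensity (hG : ContinuousOn G S) (hp : ∀ x ∈ S, IsPos (G x))
    (hK : ContinuousOn K S) (hL : ContinuousOn L S) :
    ContinuousOn (fun x => formDensity (G x) (K x) (L x)) S :=
  ((trCLM (EuclideanSpace ℝ (Fin n))).continuous.comp_continuousOn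
    ((continuousOn_raise hG hp hK).clm_comp (continuousOn_raise hG hp hL))).mul
    (continuous_formVol.comp_continuousOn hG)

end Continuity

/-- Differentiation of an integral over a compact set with respect to a parameter. -/
theorem hasDerivAt_setIntegral_of_isCompact {E : Type*} [NormedAddCommGroup E] [MeasurableSpace E]
    [BorelSpace E] [SecondCountableTopology E] {μ : Measure E} [IsFiniteMeasureOnCompacts μ]
    {C : Set E} (hC : IsCompact C) {δ : ℝ} (hδ : 0 < δ) {F F' : ℝ → E → ℝ}
    (hF : ContinuousOn (fun p : ℝ × E => F p.1 p.2) (Icc (-δ) δ ×ˢ C))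
    (hF' : ContinuousOn (fun p : ℝ × E => F' p.1 p.2) (Icc (-δ) δ ×ˢ C))
    (hd : ∀ s ∈ Icc (-δ) δ, ∀ y ∈ C, HasDerivAt (fun s => F s y) (F' s y) s) :
    HasDerivAt (fun s => ∫ y in C, F s y ∂μ) (∫ y in C, F' 0 y ∂μ) 0 := by
  obtain ⟨B, hB⟩ := (isCompact_Icc.prod hC).exists_bound_of_continuousOn hF'
  have hslice : ∀ {f : ℝ → E → ℝ}, ContinuousOn (fun p : ℝ × E => f p.1 p.2) (Icc (-δ) δ ×ˢ C) →
      ∀ s ∈ Icc (-δ) δ, ContinuousOn (f s) C := fun hf s hs =>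
    hf.comp (f := fun y => (s, y)) (by fun_prop) fun y hy => ⟨hs, hy⟩
  have h0 : (0 : ℝ) ∈ Icc (-δ) δ := ⟨by linarith, hδ.le⟩
  have hnhds : Icc (-δ) δ ∈ 𝓝 (0 : ℝ) := Icc_mem_nhds (by linarith) hδ
  refine (hasDerivAt_integral_of_dominated_loc_of_deriv_le (μ := μ.restrict C) (bound := fun _ => B)
    hnhds ?_ ((hslice hF 0 h0).integrableOn_compact hC) ?_ ?_ ?_ ?_).2
  · filter_upwards [hnhds] with s hs
    exact (hslice hF s hs).aestronglyMeasurable hC.measurableSet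
  · exact (hslice hF' 0 h0).aestronglyMeasurable hC.measurableSet
  · exact (ae_restrict_iff' hC.measurableSet).2 (ae_of_all _ fun y hy s hs => hB (s, y) ⟨hs, hy⟩)
  · exact (continuousOn_const (c := B)).integrableOn_compact hC
  · exact (ae_restrict_iff' hC.measurableSet).2 (ae_of_all _ fun y hy s hs => hd s hs y hy)

end VolumeDensity

/-! ### The Levi-Civita property on M -/

section LeviCivita

variable {n : ℕ} {M : Type*} [TopologicalSpace M] [ChartedSpace (EuclideanSpace ℝ (Fin n)) M]
  [IsManifold (𝓡 n) ∞ M]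

theorem IsSmoothTensor.continuousOn_rep {h : Tensor2 n M} (hh : IsSmoothTensor h) (i : M) :
    ContinuousOn (rep i h) (extChartAt (𝓡 n) i).target :=
  (isSmoothFamilyOn_iff.1 (hh.isSmoothFamilyOn (univ : Set ℝ)) i).continuousOn.comp
    (f := fun y => ((0 : ℝ), y)) (by fun_prop) fun y hy => ⟨mem_univ _, hy⟩

/-- The trace is invariant under the frame, and the volume density is by definition that of the Gram
matrix in coordinates; so the chart integrand is a fibrewise density of chart expressions. -/
theorem formDensity_rep {g h k : Tensor2 n M} (i : M) {y : EuclideanSpace ℝ (Fin n)}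
    (hy : y ∈ (extChartAt (𝓡 n) i).target)
    (hg : IsPos (g.at ((extChartAt (𝓡 n) i).symm y))) :
    formDensity (rep i g y) (rep i h y) (rep i k y) =
      tr (raise (g.at ((extChartAt (𝓡 n) i).symm y)) (h.at ((extChartAt (𝓡 n) i).symm y)) ∘L
        raise (g.at ((extChartAt (𝓡 n) i).symm y)) (k.at ((extChartAt (𝓡 n) i).symm y))) *
        volDensity g i y := by
  have hvol : formVol (rep i g y) = volDensity g i y := rfl
  obtain ⟨L, hL⟩ := exists_equiv_rep i hy
  rw [formDensity, hvol, hL, hL, hL, tr_raise_sq_pull hg]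

variable [T2Space M] [SecondCountableTopology M]

/-- The part of a compact set seen by the `i`-th function of the partition of unity, in
coordinates. -/
def localSupport (K : Set M) (i : M) : Set (EuclideanSpace ℝ (Fin n)) :=
  extChartAt (𝓡 n) i '' (K ∩ tsupport (chartPartition n M i))

theorem inter_tsupport_subset (K : Set M) (i : M) :
    K ∩ tsupport (chartPartition n M i) ⊆ (extChartAt (𝓡 n) i).source := by
  rw [extChartAt_source]
  exact inter_subset_right.trans (chartPartition_isSubordinate i)

theorem isCompact_localSupport {K : Set M} (hK : IsCompact K) (i : M) :
    IsCompact (localSupport (n := n) K i) :=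
  (hK.inter_right (isClosed_tsupport _)).image_of_continuousOn
    ((continuousOn_extChartAt i).mono (inter_tsupport_subset K i))

theorem localSupport_subset (K : Set M) (i : M) :
    localSupport (n := n) K i ⊆ (extChartAt (𝓡 n) i).target := by
  rintro _ ⟨x, hx, rfl⟩
  exact (extChartAt (𝓡 n) i).map_source (inter_tsupport_subset K i hx)

theorem finite_chartPartition {K : Set M} (hK : IsCompact K) :
    {i : M | (Function.support (chartPartition n M i) ∩ K).Nonempty}.Finite :=
  (chartPartition n M).locallyFinite.finite_nonempty_inter_compact hK

theorem continuousOn_chartPartition (i : M) :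
    ContinuousOn (fun y => chartPartition n M i ((extChartAt (𝓡 n) i).symm y))
      (extChartAt (𝓡 n) i).target :=
  (chartPartition n M i).contMDiff.continuous.comp_continuousOn (continuousOn_extChartAt_symm i)

/-- Local finiteness leaves finitely many charts meeting K. The index set and the compact domains do
not depend on g, so one formula is available for a whole line of metrics. -/
theorem canonicalMetric_eq_sum {g h k : Tensor2 n M} (hg : ∀ x, IsPos (g.at x)) {K : Set M}
    (hK : IsCompact K) (h0 : ∀ x ∉ K, h.at x = 0 ∨ k.at x = 0) :
    canonicalMetric g h k = ∑ i ∈ (finite_chartPartition (n := n) hK).toFinset,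
      ∫ y in localSupport K i, chartPartition n M i ((extChartAt (𝓡 n) i).symm y) *
        formDensity (rep i g y) (rep i h y) (rep i k y) := by
  have hlocal : ∀ i : M, ∀ y ∈ (extChartAt (𝓡 n) i).target,
      chartPartition n M i ((extChartAt (𝓡 n) i).symm y) *
        tr (raise (g.at ((extChartAt (𝓡 n) i).symm y)) (h.at ((extChartAt (𝓡 n) i).symm y)) ∘L
          raise (g.at ((extChartAt (𝓡 n) i).symm y)) (k.at ((extChartAt (𝓡 n) i).symm y))) *
          volDensity g i y =
      chartPartition n M i ((extChartAt (𝓡 n) i).symm y) *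
        formDensity (rep i g y) (rep i h y) (rep i k y) := by
    intro i y hy
    rw [formDensity_rep i hy (hg _), mul_assoc]
  have hint : ∀ i : M, (∫ y in (extChartAt (𝓡 n) i).target,
      chartPartition n M i ((extChartAt (𝓡 n) i).symm y) *
        tr (raise (g.at ((extChartAt (𝓡 n) i).symm y)) (h.at ((extChartAt (𝓡 n) i).symm y)) ∘L
          raise (g.at ((extChartAt (𝓡 n) i).symm y)) (k.at ((extChartAt (𝓡 n) i).symm y))) *
          volDensity g i y) =
      ∫ y in localSupport K i, chartPartition n M i ((extChartAt (𝓡 n) i).symm y) *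
        formDensity (rep i g y) (rep i h y) (rep i k y) := by
    intro i
    have hmeas : MeasurableSet (extChartAt (𝓡 n) i).target :=
      (isOpen_extChartAt_target i).measurableSet
    rw [setIntegral_congr_fun hmeas (hlocal i)]
    refine setIntegral_eq_of_subset_of_forall_sdiff_eq_zero hmeas (localSupport_subset K i) ?_
    rintro y ⟨hy, hyK⟩
    -- Outside the local support either the partition function vanishes, or one of the two tensors
    -- does.
    by_cases hx : (extChartAt (𝓡 n) i).symm y ∈ K
    · have : (extChartAt (𝓡 n) i).symm y ∉ tsupport (chartPartition n M i) := fun ht =>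
        hyK ⟨_, ⟨hx, ht⟩, (extChartAt (𝓡 n) i).right_inv hy⟩
      rw [image_eq_zero_of_notMem_tsupport this, zero_mul]
    · have hr : ∀ G : Form n, raise G (0 : Form n) = 0 := fun G => ContinuousLinearMap.comp_zero _
      have ht : tr (0 : EuclideanSpace ℝ (Fin n) →L[ℝ] EuclideanSpace ℝ (Fin n)) = 0 :=
        map_zero (trCLM _)
      rw [← hlocal i y hy]
      rcases h0 _ hx with h1 | h1
      · rw [h1, hr, ContinuousLinearMap.zero_comp, ht, mul_zero, zero_mul]
      · rw [h1, hr, ContinuousLinearMap.comp_zero, ht, mul_zero, zero_mul]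
  refine (finsum_congr hint).trans (finsum_eq_sum_of_support_subset _ fun i hi => ?_)
  rw [Finite.coe_toFinset]
  by_contra hne
  refine hi (setIntegral_eq_zero_of_forall_eq_zero ?_)
  rintro _ ⟨x, hx, rfl⟩
  rw [(extChartAt (𝓡 n) i).left_inv (inter_tsupport_subset K i hx)]
  have : chartPartition n M i x = 0 := by
    by_contra h
    exact hne ⟨x, h, hx.1⟩
  rw [this, zero_mul]

theorem hasDerivAt_canonicalMetric (g : Met n M) (h k l : TestTensor n M) :
    HasDerivAt (fun s : ℝ => canonicalMetric (g.tensor + s • h.toFun) k.toFun l.toFun)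
      (-(canonicalMetric g.tensor (christoffel g.tensor h.toFun k.toFun) l.toFun
        + canonicalMetric g.tensor k.toFun (christoffel g.tensor h.toFun l.toFun))) 0 := by
  obtain ⟨K, hK, hk0⟩ := k.exists_support
  obtain ⟨K', hK', hl0⟩ := l.exists_support
  -- On the degenerate interval [0, 0] the condition on w is void; only the uniform positivity of g
  -- + sh for |s| < ε is extracted, and the velocity data are arbitrary.
  obtain ⟨ε, hε, hdom⟩ := exists_strip_geoDomain (a := 0) (b := 0) g.tensor h.toFun
    g.isSmoothTensor h.isSmoothTensor h h fun t ht x => ⟨g.isPos x, by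
      obtain rfl : t = 0 := le_antisymm ht.2 ht.1
      simp [quadPos]⟩
  have hpos : ∀ s ∈ Ioo (-ε) ε, ∀ x, IsPos ((g.tensor + s • h.toFun).at x) := fun s hs x =>
    (hdom (0, s) ⟨⟨le_rfl, le_rfl⟩, hs⟩ x).1
  have hsymm : ∀ (s : ℝ) x v w, (g.tensor + s • h.toFun).at x v w =
      (g.tensor + s • h.toFun).at x w v := by
    intro s x v w
    change g.tensor.at x v w + s * h.toFun.at x v w = g.tensor.at x w v + s * h.toFun.at x w v
    rw [g.at_comm, h.at_comm]
  have hC := hK.union hK'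
  obtain ⟨mk, hmk⟩ := exists_christoffel_testTensor g h k
  obtain ⟨ml, hml⟩ := exists_christoffel_testTensor g h l
  rw [canonicalMetric_eq_sum g.isPos hC fun x hx => Or.inr (hl0 x fun h => hx (Or.inr h)),
    canonicalMetric_eq_sum g.isPos hC fun x hx => Or.inl (hk0 x fun h => hx (Or.inl h)),
    ← Finset.sum_add_distrib, ← Finset.sum_neg_distrib]
  have hev : (fun s : ℝ => canonicalMetric (g.tensor + s • h.toFun) k.toFun l.toFun) =ᶠ[𝓝 0]
      fun s => ∑ i ∈ (finite_chartPartition (n := n) hC).toFinset,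
        ∫ y in localSupport (K ∪ K') i, chartPartition n M i ((extChartAt (𝓡 n) i).symm y) *
        formDensity (rep i g.tensor y + s • rep i h.toFun y) (rep i k.toFun y)
          (rep i l.toFun y) := by
    filter_upwards [Ioo_mem_nhds (neg_lt_zero.2 hε) hε] with s hs
    exact canonicalMetric_eq_sum (hpos s hs) hC fun x hx => Or.inr (hl0 x fun h => hx (Or.inr h))
  refine HasDerivAt.congr_of_eventuallyEq (HasDerivAt.fun_sum fun i _ => ?_) hev
  have hcomp := isCompact_localSupport (n := n) hC i
  have hsub := localSupport_subset (n := n) (K ∪ K') i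
  set T := localSupport (n := n) (K ∪ K') i
  have hrepc : ∀ {m : Tensor2 n M}, IsSmoothTensor m → ContinuousOn (rep i m) T := fun hm =>
    (hm.continuousOn_rep i).mono hsub
  -- Halving ε gives a closed interval of parameters on which positivity still holds, so that
  -- compactness bounds the s-derivative.
  have hδ : 0 < ε / 2 := by positivity
  have hIcc : Icc (-(ε / 2)) (ε / 2) ⊆ Ioo (-ε) ε := fun s hs =>
    ⟨by linarith [hs.1], by linarith [hs.2]⟩
  have hGpos : ∀ s ∈ Icc (-(ε / 2)) (ε / 2), ∀ y ∈ T,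
      IsPos (rep i g.tensor y + s • rep i h.toFun y) ∧ ∀ v w,
        (rep i g.tensor y + s • rep i h.toFun y) v w =
          (rep i g.tensor y + s • rep i h.toFun y) w v := by
    intro s hs y hy
    have hrep : rep i g.tensor y + s • rep i h.toFun y = rep i (g.tensor + s • h.toFun) y := rfl
    obtain ⟨L, hL⟩ := exists_equiv_rep i (hsub hy)
    rw [hrep, hL]
    exact ⟨(hpos s (hIcc hs) _).pull L, fun v w => hsymm s _ _ _⟩
  have hchr : ∀ (m : TestTensor n M), ∀ y ∈ T,
      rep i (christoffel g.tensor h.toFun m.toFun) y =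
        christoffelForm (rep i g.tensor y) (rep i h.toFun y) (rep i m.toFun y) := by
    intro m y hy
    obtain ⟨L, hL⟩ := exists_equiv_rep i (hsub hy)
    rw [hL, hL, hL, hL, christoffelForm_pull (g.isPos _)]
    rfl
  have hfst : ContinuousOn (fun p : ℝ × EuclideanSpace ℝ (Fin n) => p.1)
      (Icc (-(ε / 2)) (ε / 2) ×ˢ T) := continuousOn_fst
  have hsnd : ∀ {m : Tensor2 n M}, IsSmoothTensor m → ContinuousOn
      (fun p : ℝ × EuclideanSpace ℝ (Fin n) => rep i m p.2) (Icc (-(ε / 2)) (ε / 2) ×ˢ T) :=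
    fun hm => (hrepc hm).comp continuousOn_snd fun p hp => hp.2
  have hG : ContinuousOn (fun p : ℝ × EuclideanSpace ℝ (Fin n) =>
      rep i g.tensor p.2 + p.1 • rep i h.toFun p.2) (Icc (-(ε / 2)) (ε / 2) ×ˢ T) :=
    (hsnd g.isSmoothTensor).add (hfst.smul (hsnd h.isSmoothTensor))
  have hGp : ∀ p ∈ Icc (-(ε / 2)) (ε / 2) ×ˢ T,
      IsPos (rep i g.tensor p.2 + p.1 • rep i h.toFun p.2) := fun p hp =>
    (hGpos p.1 hp.1 p.2 hp.2).1
  have hρ : ContinuousOn (fun p : ℝ × EuclideanSpace ℝ (Fin n) =>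
      chartPartition n M i ((extChartAt (𝓡 n) i).symm p.2)) (Icc (-(ε / 2)) (ε / 2) ×ˢ T) :=
    ((continuousOn_chartPartition i).mono hsub).comp continuousOn_snd fun p hp => hp.2
  have hkey := hasDerivAt_setIntegral_of_isCompact (μ := volume) hcomp hδ
    (F := fun s y => chartPartition n M i ((extChartAt (𝓡 n) i).symm y) *
        formDensity (rep i g.tensor y + s • rep i h.toFun y) (rep i k.toFun y) (rep i l.toFun y))
    (F' := fun s y => chartPartition n M i ((extChartAt (𝓡 n) i).symm y) *
      (-(formDensity (rep i g.tensor y + s • rep i h.toFun y)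
          (christoffelForm (rep i g.tensor y + s • rep i h.toFun y) (rep i h.toFun y)
            (rep i k.toFun y)) (rep i l.toFun y) +
        formDensity (rep i g.tensor y + s • rep i h.toFun y) (rep i k.toFun y)
          (christoffelForm (rep i g.tensor y + s • rep i h.toFun y) (rep i h.toFun y)
            (rep i l.toFun y)))))
    (hρ.mul (continuousOn_formDensity hG hGp (hsnd k.isSmoothTensor) (hsnd l.isSmoothTensor)))
    (hρ.mul ((continuousOn_formDensity hG hGp (continuousOn_christoffelForm hG hGp
      (hsnd h.isSmoothTensor) (hsnd k.isSmoothTensor)) (hsnd l.isSmoothTensor)).add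
      (continuousOn_formDensity hG hGp (hsnd k.isSmoothTensor) (continuousOn_christoffelForm hG hGp
      (hsnd h.isSmoothTensor) (hsnd l.isSmoothTensor)))).neg)
    (fun s hs y hy =>
      (hasDerivAt_formDensity (hGpos s hs y hy).1 (hGpos s hs y hy).2 _ _).const_mul _)
  refine hkey.congr_deriv ?_
  have hρT : ContinuousOn (fun y => chartPartition n M i ((extChartAt (𝓡 n) i).symm y)) T :=
    (continuousOn_chartPartition i).mono hsub
  have hgp : ∀ y ∈ T, IsPos (rep i g.tensor y) := fun y hy => by
    obtain ⟨L, hL⟩ := exists_equiv_rep i (hsub hy)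
    rw [hL]
    exact (g.isPos _).pull L
  rw [← hmk, ← hml]
  rw [← integral_add, ← integral_neg]
  · refine setIntegral_congr_fun hcomp.measurableSet fun y hy => ?_
    simp only [zero_smul, add_zero]
    rw [hmk, hml, hchr k y hy, hchr l y hy]
    ring
  · exact (hρT.mul (continuousOn_formDensity (hrepc g.isSmoothTensor) hgp
      (hrepc mk.isSmoothTensor) (hrepc l.isSmoothTensor))).integrableOn_compact hcomp
  · exact (hρT.mul (continuousOn_formDensity (hrepc g.isSmoothTensor) hgp
      (hrepc k.isSmoothTensor) (hrepc ml.isSmoothTensor))).integrableOn_compact hcomp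

theorem isLeviCivita_christoffel : IsLeviCivita n M christoffel := by
  intro g h k l
  refine ⟨exists_christoffel_testTensor g h k, ?_, ?_⟩
  · funext x
    exact christoffelForm_comm (g.tensor.at x) (h.toFun.at x) (k.toFun.at x)
  · exact hasDerivAt_canonicalMetric g h k l

end LeviCivita

end MetricManifold

end

open MetricManifold in
theorem theorem4p4 {n : ℕ} {M : Type*} [TopologicalSpace M]
    [ChartedSpace (EuclideanSpace ℝ (Fin n)) M] [IsManifold (𝓡 n) ∞ M]
    [T2Space M] [SecondCountableTopology M] :
    -- the connection used below is the Levi-Civita connection of the canonical metric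
    IsLeviCivita n M christoffel ∧
    ∀ (J : Set ℝ), J.OrdConnected → J.Nontrivial → (0 : ℝ) ∈ J →
    ∀ (g : ℝ → Met n M), IsGeodesicOn J g →
      -- existence and uniqueness of the Jacobi field with given initial values
      (∀ k l : TestTensor n M,
        (∃ ξ : ℝ → TestTensor n M, IsJacobiFieldOn J g ξ ∧ ξ 0 = k ∧
          covDeriv J (fun t => (g t).inner) (fun t => (ξ t).toFun) 0 = l.toFun) ∧
        ∀ ξ η : ℝ → TestTensor n M,
          (IsJacobiFieldOn J g ξ ∧ ξ 0 = k ∧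
            covDeriv J (fun t => (g t).inner) (fun t => (ξ t).toFun) 0 = l.toFun) →
          (IsJacobiFieldOn J g η ∧ η 0 = k ∧
            covDeriv J (fun t => (g t).inner) (fun t => (η t).toFun) 0 = l.toFun) →
          EqOn ξ η J) ∧
      -- the solutions of the Jacobi equation are exactly the Jacobi fields
      (∀ ξ : ℝ → TestTensor n M, IsVectorFieldOn J ξ →
        (JacobiEquationOn J g ξ ↔ IsJacobiFieldOn J g ξ)) := by
  exact ⟨isLeviCivita_christoffel, fun J hJ hnt h0 g hg => jacobi_field_theorem hJ hnt h0 hg⟩
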